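/- An arena is a finite bipartite directed graph with vertex set $V=V_0\sqcup V_1$, $V\neq\emptyset$, and edge set $E\subseteq (V_0\times V_1)\cup(V_1\times V_0)$, in which every vertex has an outgoing edge. A play from $v_0$ is an infinite path $\rho=v_0,v_1,v_2,\dots$ in which the owner of the current vertex ($v_i\in V_\sigma$ belongs to Player $\sigma\in\{0,1\}$) chooses the next edge, and $\mathrm{Inf}(\rho)$ is the set of vertices that occur infinitely often in $\rho$. A Rabin or Streett game $\mathcal G$ is an arena together with pairs $(U_1,V_1),\dots,(U_k,V_k)$ of subsets of $V$, $k\ge 0$. In the Rabin game Player 0 wins $\rho$ if for some $i$ one has $\mathrm{Inf}(\rho)\cap U_i\neq\emptyset$ and $\mathrm{Inf}(\rho)\cap V_i=\emptyset$; in the Streett game Player 0 wins $\rho$ if for all $i$, $\mathrm{Inf}(\rho)\cap U_i\neq\emptyset$ implies $\mathrm{Inf}(\rho)\cap V_i\neq\emptyset$; otherwise Player 1 wins. $Win_\sigma(\mathcal G)$ is the set of vertices from which Player $\sigma$ has a (history-dependent) strategy that wins every play consistent with it. To decide $\mathcal G$ is to compute the partition $V=Win_0(\mathcal G)\sqcup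 Win_1(\mathcal G)$. Games are given explicitly, by listing the vertices with their owners, the edges, and the pairs element by element, and $|\mathcal G|=|V|+|E|+\sum_{i=1}^k(1+|U_i|+|V_i|)$ denotes the size of this representation. Time is the number of steps of a unit-cost word RAM with words of $O(|V|+\log|\mathcal G|)$ bits, and space is its number of memory words, including those that hold the input. **Theorem.** There is an algorithm that decides every Rabin game $\mathcal G$, and there is an algorithm that decides every Streett game $\mathcal G$, each of them in time $O\big((k|V|+2^{|V|}|E|)\,|V|\big)$ and space $O\big(|\mathcal G|+2^{|V|}|V|\big)$. -/

import Mathlib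

namespace RegularGames

/-! ## Arenas, plays, strategies, winning regions -/

/-- A bipartite arena on the vertex set `V`: `owner v` is the player (`0` or `1`) whose position
`v` is, so that `V₀ = {v | owner v = 0}` and `V₁ = {v | owner v = 1}`; edges go between positions of
different players, and each node has an outgoing edge. -/
structure Arena (V : Type*) where
  owner : V → Fin 2
  edges : Finset (V × V)
  bipartite : ∀ u v, (u, v) ∈ edges → owner u ≠ owner v
  total : ∀ u, ∃ v, (u, v) ∈ edges

namespace Arena

variable {V : Type*}

/-- `ρ` is a play of the arena `A` that starts at `v₀`. -/
def IsPlayFrom (A : Arena V) (v₀ : V) (ρ : ℕ → V) : Prop :=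
  ρ 0 = v₀ ∧ ∀ i, (ρ i, ρ (i + 1)) ∈ A.edges

/-- A strategy of player `σ`: it maps every history that ends in a position of player `σ`
to a successor of that position (its values on other lists are irrelevant). -/
def IsStrategy (A : Arena V) (σ : Fin 2) (s : List V → V) : Prop :=
  ∀ (h : List V) (v : V), A.owner v = σ → (v, s (h ++ [v])) ∈ A.edges

/-- In the sequence `ρ` all moves of player `σ` are made according to `s`, which is
given the whole history `ρ 0, …, ρ i`. -/
def Consistent (A : Arena V) (σ : Fin 2) (s : List V → V) (ρ : ℕ → V) : Prop :=
  ∀ i, A.owner (ρ i) = σ → ρ (i + 1) = s ((List.range (i + 1)).map ρ)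

end Arena

/-- The infinity set of a play: the vertices that are visited infinitely often. -/
def infSet {V : Type*} (ρ : ℕ → V) : Set V :=
  {v | ∃ᶠ i in Filter.atTop, ρ i = v}

/-- The winning region of player `σ` when player `0` wins the plays whose infinity set satisfies
`Ω` and player `1` wins all the others: the set of those positions from which player `σ` has a
strategy that wins every play consistent with it. -/
def Arena.winRegion {V : Type*} (A : Arena V) (Ω : Set V → Prop) (σ : Fin 2) : Set V :=
  {v | ∃ s, A.IsStrategy σ s ∧ ∀ ρ, A.IsPlayFrom v ρ → A.Consistent σ s ρ →
    if σ = 0 then Ω (infSet ρ) else ¬ Ω (infSet ρ)}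

/-! ## Rabin and Streett games -/

/-- An arena with a finite sequence of winning pairs `(U₁, V₁), …, (U_k, V_k)`. It is read as a
Rabin game or as a Streett game. -/
structure PairGame (V : Type*) where
  arena : Arena V
  pairs : List (Finset V × Finset V)

namespace PairGame

variable {V : Type*}

/-- The index `k` of the game. -/
def index (G : PairGame V) : ℕ := G.pairs.length

/-- Rabin condition on the infinity set `X`. -/
def RabinCond (G : PairGame V) (X : Set V) : Prop :=
  ∃ p ∈ G.pairs, (X ∩ ↑p.1).Nonempty ∧ X ∩ ↑p.2 = ∅

/-- Streett condition on the infinity set `X`. -/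
def StreettCond (G : PairGame V) (X : Set V) : Prop :=
  ∀ p ∈ G.pairs, (X ∩ ↑p.1).Nonempty → (X ∩ ↑p.2).Nonempty

/-- The size of the explicit representation, which lists the vertices, the edges, and the pairs:
`|V| + |E| + ∑ᵢ (1 + |Uᵢ| + |Vᵢ|)`. -/
def size [Fintype V] (G : PairGame V) : ℕ :=
  Fintype.card V + G.arena.edges.card + (G.pairs.map fun p => 1 + p.1.card + p.2.card).sum

/-- `G.Encodes w` says that the word list `w` is an explicit representation of `G`, a game on
the vertices `0, …, n - 1`: the numbers `n`, `|E|`, `k`; the owners of the vertices; the list of the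
edges; and the pairs, each of the two sets of a pair preceded by its number of elements. The edges
and the elements of each set may be listed in any order, without repetitions. -/
def Encodes {n : ℕ} (G : PairGame (Fin n)) (w : List ℕ) : Prop :=
  ∃ (es : List (Fin n × Fin n)) (ps : List (List (Fin n) × List (Fin n))),
    es.Nodup ∧ es.toFinset = G.arena.edges ∧
    (∀ p ∈ ps, p.1.Nodup ∧ p.2.Nodup) ∧
    ps.map (fun p => (p.1.toFinset, p.2.toFinset)) = G.pairs ∧
    w = [n, es.length, ps.length]
      ++ List.ofFn (fun v : Fin n => (G.arena.owner v : ℕ))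
      ++ es.flatMap (fun e => [(e.1 : ℕ), (e.2 : ℕ)])
      ++ ps.flatMap (fun p =>
          (p.1.length :: p.1.map (fun v => (v : ℕ))) ++
          (p.2.length :: p.2.map (fun v => (v : ℕ))))

end PairGame

/-! ## The machine model: structured programs of a unit-cost word RAM -/

/-- An operand of an instruction: a register or a constant. -/
inductive Operand where
  | reg (r : ℕ)
  | const (c : ℕ)

/-- The arithmetic and bitwise instructions of the word RAM. -/
inductive BinOp where
  | add | sub | mul | div | mod | and | or | shl | shr

/-- Subtraction is truncated at `0`; `x div 0 = 0` and `x mod 0 = x`. -/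
def BinOp.eval : BinOp → ℕ → ℕ → ℕ
  | .add, x, y => x + y
  | .sub, x, y => x - y
  | .mul, x, y => x * y
  | .div, x, y => x / y
  | .mod, x, y => x % y
  | .and, x, y => x &&& y
  | .or, x, y => x ||| y
  | .shl, x, y => x <<< y
  | .shr, x, y => x >>> y

/-- A test: comparison of two operands. -/
inductive Test where
  | lt (a b : Operand)
  | eq (a b : Operand)

/-- Programs. A program mentions only finitely many registers; the memory is an array of words that
is accessed by indirect addressing. -/
inductive Program where
  /-- no operation -/
  | skip
  /-- `r := a o b` -/
  | op (r : ℕ) (o : BinOp) (a b : Operand)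
  /-- `r := mem[a]` -/
  | load (r : ℕ) (a : Operand)
  /-- `mem[a] := b` -/
  | store (a b : Operand)
  /-- sequential composition -/
  | seq (p q : Program)
  /-- `if t then p else q` -/
  | branch (t : Test) (p q : Program)
  /-- `while t do p` -/
  | loop (t : Test) (p : Program)

/-- A state of the machine: the contents of the registers and of the memory. -/
structure State where
  reg : ℕ → ℕ
  mem : ℕ → ℕ

def Operand.eval (s : State) : Operand → ℕ
  | .reg r => s.reg r
  | .const c => c

def Test.Holds (s : State) : Test → Prop
  | .lt a b => a.eval s < b.eval s
  | .eq a b => a.eval s = b.eval s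

/-- `Exec S W p s t s'`: on a machine with `S` memory cells whose words are the numbers below `W`,
the program `p`, started in the state `s`, halts after exactly `t` steps in the state `s'`. Every
instruction and every evaluation of a test is one step. A computation that accesses a memory
cell with an address `≥ S`, or produces a word `≥ W`, is not an execution. -/
inductive Exec (S W : ℕ) : Program → State → ℕ → State → Prop where
  | skip (s : State) : Exec S W .skip s 1 s
  | op (s : State) (r : ℕ) (o : BinOp) (a b : Operand)
      (hW : o.eval (a.eval s) (b.eval s) < W) :
      Exec S W (.op r o a b) s 1
        { s with reg := Function.update s.reg r (o.eval (a.eval s) (b.eval s)) }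
  | load (s : State) (r : ℕ) (a : Operand) (hS : a.eval s < S) (hW : s.mem (a.eval s) < W) :
      Exec S W (.load r a) s 1
        { s with reg := Function.update s.reg r (s.mem (a.eval s)) }
  | store (s : State) (a b : Operand) (hS : a.eval s < S) (hW : b.eval s < W) :
      Exec S W (.store a b) s 1
        { s with mem := Function.update s.mem (a.eval s) (b.eval s) }
  | seq (s s' s'' : State) (p q : Program) (t t' : ℕ)
      (hp : Exec S W p s t s') (hq : Exec S W q s' t' s'') :
      Exec S W (.seq p q) s (t + t') s''
  | branch_true (s s' : State) (b : Test) (p q : Program) (t : ℕ) (hb : b.Holds s)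
      (hp : Exec S W p s t s') : Exec S W (.branch b p q) s (t + 1) s'
  | branch_false (s s' : State) (b : Test) (p q : Program) (t : ℕ) (hb : ¬ b.Holds s)
      (hq : Exec S W q s t s') : Exec S W (.branch b p q) s (t + 1) s'
  | loop_false (s : State) (b : Test) (p : Program) (hb : ¬ b.Holds s) :
      Exec S W (.loop b p) s 1 s
  | loop_true (s s' s'' : State) (b : Test) (p : Program) (t t' : ℕ) (hb : b.Holds s)
      (hp : Exec S W p s t s') (hl : Exec S W (.loop b p) s' t' s'') :
      Exec S W (.loop b p) s (t + t' + 1) s''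

/-- The initial state: all registers are `0`, the memory holds the input from address `0` on and
is `0` elsewhere. -/
def initState (w : List ℕ) : State where
  reg := fun _ => 0
  mem := fun i => w.getD i 0

/-! ## Deciding games within resource bounds -/

/-- The program `P` decides the games of a class, in which the condition of player `0` in the game
`G` is `Ω G`, with constant `c`: given any explicit representation of a game `G` with
`n ≥ 1` vertices, it halts within `c · time n |E| k` steps, uses memory cells with
addresses below `c · space n |G|` and words of at most `c · (n + log₂ |G|)` bits, and leaves in the
memory cells `0, …, n - 1` the partition of the vertices into `Win₀` and `Win₁`: cell `v` contains
the unique player who wins from `v`. -/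
def Decides (P : Program) (c : ℕ) (Ω : ∀ {n : ℕ}, PairGame (Fin n) → Set (Fin n) → Prop)
    (time : ℕ → ℕ → ℕ → ℕ) (space : ℕ → ℕ → ℕ) : Prop :=
  ∀ (n : ℕ), 0 < n → ∀ (G : PairGame (Fin n)) (w : List ℕ), G.Encodes w →
    ∃ (t : ℕ) (s : State),
      Exec (c * space n G.size) (2 ^ (c * (n + Nat.log 2 G.size))) P (initState w) t s ∧
      t ≤ c * time n G.arena.edges.card G.index ∧
      ∀ v : Fin n, ∃ σ : Fin 2, s.mem (v : ℕ) = (σ : ℕ) ∧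
        ∀ τ : Fin 2, v ∈ G.arena.winRegion (Ω G) τ ↔ τ = σ

end RegularGames

/-!
A play that visits exactly the vertices of `X` infinitely often is won by a player who depends on
`X` only; call that player `σ`, and the opponent `τ`. The subgame on a subarena `X` is solved from
the subgames on smaller subarenas (`wins_step`, after McNaughton). Remove from `X`, for some `v ∈
X`, the `σ`-attractor of `v`; what `τ` wins in the rest is won by `τ` in `X`, since `σ` cannot
return to the attractor. If this gives a nonempty set `W` of vertices won by `τ`, then the
`τ`-attractor of `W` is won by `τ` too, and the rest of `X` is decided by the smaller subgame that
remains. Otherwise `σ` wins everywhere outside of the attractor of each `v`; then `σ` wins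
everywhere in `X` (`wins_of_forall_target`), by making the vertices of `X` targets in turns: if a
target is never reached, then the play finally remains outside of its attractor and is won there,
and if all targets are reached, then the infinity set is `X`. Strategies are handled as
`Controller`s, graphs of states that can be glued together; `Wins.mem_winRegion` turns them into
functions of the history.

A set of vertices is a machine word `enc X`, so that Boolean operations are single instructions,
and tables with `2 ^ n` entries are indexed by sets. Proper subsets have smaller words, hence the
recursion is a loop over the words in increasing order. For each `X` there are at most `n + 1`
attractor computations, each of which takes time `O(|E|)`: every attracted vertex is treated once,
at a cost proportional to its number of predecessors, because the lowest bit of a word is found in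
constant time (`attrProg_run`). This accounts for `2 ^ n * |E| * n` steps.

The winner `σ` for `X` is found without looking at the pairs again. Reading the `k` pairs, in time
`O(k * n)`, one stores for each set `Z` the union of the `Uᵢ` with `Vᵢ = Z`. A further loop over
all sets turns this into the union of the `Uᵢ` with `Vᵢ ⊆ Z`, from the entries for `Z` without one
of its elements (`closeProg_run`). Then `X` satisfies the Rabin condition if and only if `X` meets
the entry for its complement (`pairsBelow_inter_nonempty`). The Streett condition is the negation
of the Rabin condition, so that the same program with the two players exchanged at this point
decides Streett games.

Programs are verified with the predicate `Run`. Loops carry an invariant and a potential that pays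
for the steps (`Run.loop`), and what a program leaves unchanged for syntactic reasons is provided
by `Frame`.
-/

namespace RegularGames

/-! ### Controllers and winning sets -/

section

open Filter

variable {V : Type} (A : Arena V) (Ω : Set V → Prop)

/-- Player `σ` wins the plays with infinity set `X`, when player `0` wins those with `Ω X`. -/
def Good (σ : Fin 2) (X : Set V) : Prop :=
  if σ = 0 then Ω X else ¬ Ω X

/-- A controller of player `σ` for the subgame on `X`: a graph `R` of states, each located at a
vertex of `X`. From each state there is a transition for some move of player `σ`, respectively for
each move of the opponent inside `X`, and all infinite paths of states project to sequences of
vertices won by `σ`. This is a nondeterministic strategy with memory; there is no initial state, so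
that it wins from every state. -/
structure Controller (σ : Fin 2) (X : Set V) (C : Type) where
  pos : C → V
  R : C → C → Prop
  pos_mem : ∀ c, pos c ∈ X
  edge : ∀ c c', R c c' → (pos c, pos c') ∈ A.edges
  own : ∀ c, A.owner (pos c) = σ → ∃ c', R c c'
  opp : ∀ c, A.owner (pos c) ≠ σ → ∀ u ∈ X, (pos c, u) ∈ A.edges → ∃ c', R c c' ∧ pos c' = u
  win : ∀ p : ℕ → C, (∀ i, R (p i) (p (i + 1))) → Good Ω σ (infSet fun i => pos (p i))

/-- Player `σ` wins the subgame on `X` from all vertices of `Y`. -/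
def Wins (σ : Fin 2) (X Y : Set V) : Prop :=
  ∃ (C : Type) (K : Controller A Ω σ X C), Y ⊆ Set.range K.pos

theorem infSet_shift (ρ : ℕ → V) (N : ℕ) : infSet (fun i => ρ (i + N)) = infSet ρ := by
  ext v
  simp only [infSet, Set.mem_ofPred_eq, Filter.frequently_atTop]
  constructor
  · intro h a
    obtain ⟨b, hb, e⟩ := h a
    exact ⟨b + N, by omega, e⟩
  · intro h a
    obtain ⟨b, hb, e⟩ := h (a + N)
    exact ⟨b - N, by omega, by rwa [Nat.sub_add_cancel (by omega)]⟩

variable {A Ω} {σ : Fin 2} {X Y Z : Set V}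

theorem wins_empty : Wins A Ω σ X ∅ :=
  ⟨Empty, ⟨fun c => c.elim, fun c => c.elim, fun c => c.elim, fun c => c.elim, fun c => c.elim,
    fun c => c.elim, fun p => (p 0).elim⟩, Set.empty_subset _⟩

theorem Wins.mono (h : Wins A Ω σ X Y) (hZ : Z ⊆ Y) : Wins A Ω σ X Z := by
  obtain ⟨C, K, hK⟩ := h
  exact ⟨C, K, hZ.trans hK⟩

/-- A union of controllers is a controller. -/
theorem wins_iUnion {ι : Type} {Y : ι → Set V} (h : ∀ i, Wins A Ω σ X (Y i)) :
    Wins A Ω σ X (⋃ i, Y i) := by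
  choose C K hK using h
  refine ⟨Σ i, C i, ⟨fun c => (K c.1).pos c.2,
    fun c c' => ∃ h : c'.1 = c.1, (K c.1).R c.2 (h ▸ c'.2), ?_, ?_, ?_, ?_, ?_⟩, ?_⟩
  · exact fun c => (K c.1).pos_mem c.2
  · rintro ⟨i, c⟩ ⟨j, c'⟩ ⟨h, hR⟩
    cases h
    exact (K _).edge _ _ hR
  · rintro ⟨i, c⟩ ho
    obtain ⟨c', hc⟩ := (K i).own c ho
    exact ⟨⟨i, c'⟩, rfl, hc⟩
  · rintro ⟨i, c⟩ ho u hu he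
    obtain ⟨c', hc, hp⟩ := (K i).opp c ho u hu he
    exact ⟨⟨i, c'⟩, ⟨rfl, hc⟩, hp⟩
  · intro p hp
    obtain ⟨i, hi⟩ : ∃ i, i = (p 0).1 := ⟨_, rfl⟩
    have h1 : ∀ j, ∃ c : C i, p j = ⟨i, c⟩ := by
      intro j
      induction j with
      | zero => subst hi; exact ⟨_, rfl⟩
      | succ j ih =>
        obtain ⟨c, hc⟩ := ih
        obtain ⟨h, -⟩ := hp j
        generalize p (j + 1) = q at h
        rw [hc] at h
        obtain ⟨i', c'⟩ := q
        cases h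
        exact ⟨_, rfl⟩
    choose c hc using h1
    have := (K i).win c fun j => by
      obtain ⟨h, hR⟩ := hp j
      revert h hR
      rw [hc j, hc (j + 1)]
      intro h hR
      exact hR
    have e : ∀ j, (K (p j).1).pos (p j).2 = (K i).pos (c j) := fun j => by rw [hc j]
    simpa only [e] using this
  · rintro v hv
    obtain ⟨i, hi⟩ := Set.mem_iUnion.1 hv
    obtain ⟨c, hc⟩ := hK i hi
    exact ⟨⟨i, c⟩, hc⟩

/-- A subset that the opponent cannot leave can be played in isolation. -/
theorem Wins.of_trap (h : Wins A Ω σ Y Z) (hYX : Y ⊆ X)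
    (ht : ∀ v ∈ Y, A.owner v ≠ σ → ∀ u ∈ X, (v, u) ∈ A.edges → u ∈ Y) : Wins A Ω σ X Z := by
  obtain ⟨C, K, hK⟩ := h
  exact ⟨C, ⟨K.pos, K.R, fun c => hYX (K.pos_mem c), K.edge, K.own,
    fun c ho u hu he => K.opp c ho u (ht _ (K.pos_mem c) ho u hu he) he, K.win⟩, hK⟩

/-- Switching: a graph `RD` of states that are won as long as the play remains among them is
combined with a region `B` that is won already. -/
theorem Wins.switch {B : Set V} (hB : Wins A Ω σ X B) {D : Type} (pos : D → V)
    (RD : D → D → Prop) (hpos : ∀ d, pos d ∈ X)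
    (hedge : ∀ d d', RD d d' → (pos d, pos d') ∈ A.edges)
    (hown : ∀ d, A.owner (pos d) = σ → (∃ d', RD d d') ∨ ∃ u ∈ B, (pos d, u) ∈ A.edges)
    (hopp : ∀ d, A.owner (pos d) ≠ σ → ∀ u ∈ X, (pos d, u) ∈ A.edges →
      (∃ d', RD d d' ∧ pos d' = u) ∨ u ∈ B)
    (hwin : ∀ p : ℕ → D, (∀ i, RD (p i) (p (i + 1))) → Good Ω σ (infSet fun i => pos (p i))) :
    Wins A Ω σ X (Set.range pos ∪ B) := by
  obtain ⟨C, K, hK⟩ := hB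
  let R : D ⊕ C → D ⊕ C → Prop
    | .inl d, .inl d' => RD d d'
    | .inl d, .inr c => (pos d, K.pos c) ∈ A.edges
    | .inr _, .inl _ => False
    | .inr c, .inr c' => K.R c c'
  refine ⟨D ⊕ C, ⟨Sum.elim pos K.pos, R, ?_, ?_, ?_, ?_, ?_⟩, ?_⟩
  · rintro (d | c)
    · exact hpos d
    · exact K.pos_mem c
  · rintro (d | c) (d' | c') h
    · exact hedge _ _ h
    · exact h
    · exact h.elim
    · exact K.edge _ _ h
  · rintro (d | c) ho
    · rcases hown d ho with ⟨d', h⟩ | ⟨u, hu, he⟩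
      · exact ⟨.inl d', h⟩
      · obtain ⟨c, rfl⟩ := hK hu
        exact ⟨.inr c, he⟩
    · obtain ⟨c', h⟩ := K.own c ho
      exact ⟨.inr c', h⟩
  · rintro (d | c) ho u hu he
    · rcases hopp d ho u hu he with ⟨d', h, e⟩ | hu
      · exact ⟨.inl d', h, e⟩
      · obtain ⟨c, rfl⟩ := hK hu
        exact ⟨.inr c, he, rfl⟩
    · obtain ⟨c', h, e⟩ := K.opp c ho u hu he
      exact ⟨.inr c', h, e⟩
  · intro p hp
    -- the region `B` is never left, and the winner does not depend on a finite prefix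
    by_cases hr : ∃ N c, p N = .inr c
    · obtain ⟨N, c, hc⟩ := hr
      have h1 : ∀ i, ∃ c, p (i + N) = .inr c := by
        intro i
        induction i with
        | zero => exact ⟨c, by simpa using hc⟩
        | succ i ih =>
          obtain ⟨c, hc⟩ := ih
          have := hp (i + N)
          rw [hc] at this
          rw [show i + 1 + N = i + N + 1 by omega]
          generalize p (i + N + 1) = q at this
          cases q with
          | inl d => exact this.elim
          | inr c' => exact ⟨c', rfl⟩
      choose c hc using h1
      have h2 := K.win c fun i => by
        have := hp (i + N)
        rw [hc, show i + N + 1 = i + 1 + N by omega, hc] at this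
        exact this
      rw [← infSet_shift _ N]
      simpa [hc] using h2
    · push Not at hr
      have h1 : ∀ i, ∃ d, p i = .inl d := by
        intro i
        cases h : p i with
        | inl d => exact ⟨d, rfl⟩
        | inr c => exact (hr i c h).elim
      choose d hd using h1
      have h2 := hwin d fun i => by
        have := hp i
        rw [hd, hd] at this
        exact this
      simpa [hd] using h2
  · rintro v (⟨d, rfl⟩ | hv)
    · exact ⟨.inl d, rfl⟩
    · obtain ⟨c, rfl⟩ := hK hv
      exact ⟨.inr c, rfl⟩

variable (A σ X) in
/-- `AttrSeq A σ X S T`: the set `T` arises from `S` by adding vertices of `X` one after the other,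
each of which is a vertex of `σ` with an edge into the set reached so far, or a vertex of the
opponent with all its edges inside `X` going there. -/
inductive AttrSeq (S : Set V) : Set V → Prop where
  | base : AttrSeq S S
  | own {T : Set V} {p u : V} (h : AttrSeq S T) (hp : p ∈ X) (ho : A.owner p = σ)
      (hu : u ∈ T) (he : (p, u) ∈ A.edges) : AttrSeq S (insert p T)
  | opp {T : Set V} {p : V} (h : AttrSeq S T) (hp : p ∈ X) (ho : A.owner p ≠ σ)
      (hu : ∀ u ∈ X, (p, u) ∈ A.edges → u ∈ T) : AttrSeq S (insert p T)

/-- A region won by `σ` remains so when vertices are attracted to it. -/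
theorem Wins.attr {S T : Set V} (hS : Wins A Ω σ X S) (h : AttrSeq A σ X S T) :
    Wins A Ω σ X T := by
  induction h with
  | base => exact hS
  | @own T p u _ hp ho hu he ih =>
    refine (ih.switch (D := Unit) (fun _ => p) (fun _ _ => False) (fun _ => hp)
      (fun _ _ h => h.elim) (fun _ _ => .inr ⟨u, hu, he⟩) (fun _ h => (h ho).elim)
      (fun _ h => (h 0).elim)).mono ?_
    rintro v (rfl | hv)
    · exact .inl ⟨(), rfl⟩
    · exact .inr hv
  | @opp T p _ hp ho hu ih =>
    refine (ih.switch (D := Unit) (fun _ => p) (fun _ _ => False) (fun _ => hp)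
      (fun _ _ h => h.elim) (fun _ h => (ho h).elim) (fun _ _ u hX he => .inr (hu u hX he))
      (fun _ h => (h 0).elim)).mono ?_
    rintro v (rfl | hv)
    · exact .inl ⟨(), rfl⟩
    · exact .inr hv

/-- The order in which vertices are attracted is a ranking: outside of `S` player `σ` can, and the
opponent must, move to a vertex of smaller rank. -/
theorem AttrSeq.exists_rank {S T : Set V} (h : AttrSeq A σ X S T) :
    ∃ (rank : V → ℕ) (N : ℕ), (∀ v ∈ T, rank v < N) ∧ ∀ v ∈ T, v ∉ S → v ∈ X ∧
      (A.owner v = σ → ∃ u ∈ T, (v, u) ∈ A.edges ∧ rank u < rank v) ∧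
      (A.owner v ≠ σ → ∀ u ∈ X, (v, u) ∈ A.edges → u ∈ T ∧ rank u < rank v) := by
  classical
  have step : ∀ (T : Set V) (p : V), p ∈ X →
      (A.owner p = σ → ∃ u ∈ T, (p, u) ∈ A.edges) →
      (A.owner p ≠ σ → ∀ u ∈ X, (p, u) ∈ A.edges → u ∈ T) →
      (∃ (rank : V → ℕ) (N : ℕ), (∀ v ∈ T, rank v < N) ∧ ∀ v ∈ T, v ∉ S → v ∈ X ∧
      (A.owner v = σ → ∃ u ∈ T, (v, u) ∈ A.edges ∧ rank u < rank v) ∧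
      (A.owner v ≠ σ → ∀ u ∈ X, (v, u) ∈ A.edges → u ∈ T ∧ rank u < rank v)) →
      (∃ (rank : V → ℕ) (N : ℕ), (∀ v ∈ insert p T, rank v < N) ∧
        ∀ v ∈ insert p T, v ∉ S → v ∈ X ∧
      (A.owner v = σ → ∃ u ∈ insert p T, (v, u) ∈ A.edges ∧ rank u < rank v) ∧
      (A.owner v ≠ σ → ∀ u ∈ X, (v, u) ∈ A.edges → u ∈ insert p T ∧ rank u < rank v)) := by
    rintro T p hp h1 h2 ⟨r, N, hN, hr⟩
    by_cases hpT : p ∈ T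
    · rw [Set.insert_eq_of_mem hpT]
      exact ⟨r, N, hN, hr⟩
    have hne : ∀ u ∈ T, u ≠ p := fun u hu e => hpT (e ▸ hu)
    refine ⟨Function.update r p N, N + 1, ?_, ?_⟩
    · rintro v (rfl | hv)
      · simp
      · rw [Function.update_of_ne (hne v hv)]
        have := hN v hv
        omega
    · rintro v (rfl | hv) hvS
      · refine ⟨hp, fun ho => ?_, fun ho u hu he => ?_⟩
        · obtain ⟨u, hu, he⟩ := h1 ho
          refine ⟨u, .inr hu, he, ?_⟩
          simpa [Function.update_of_ne (hne u hu)] using hN u hu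
        · have hu := h2 ho u hu he
          refine ⟨.inr hu, ?_⟩
          simpa [Function.update_of_ne (hne u hu)] using hN u hu
      · obtain ⟨hX, h3, h4⟩ := hr v hv hvS
        refine ⟨hX, fun ho => ?_, fun ho u hu he => ?_⟩
        · obtain ⟨u, hu, he, hlt⟩ := h3 ho
          refine ⟨u, .inr hu, he, ?_⟩
          simpa [Function.update_of_ne (hne u hu), Function.update_of_ne (hne v hv)] using hlt
        · obtain ⟨hu, hlt⟩ := h4 ho u hu he
          refine ⟨.inr hu, ?_⟩
          simpa [Function.update_of_ne (hne u hu), Function.update_of_ne (hne v hv)] using hlt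
  induction h with
  | base => exact ⟨fun _ => 0, 1, fun _ _ => one_pos, fun v hv hv' => (hv' hv).elim⟩
  | @own T p u _ hp ho hu he ih =>
    exact step T p hp (fun _ => ⟨u, hu, he⟩) (fun h => (h ho).elim) ih
  | @opp T p _ hp ho hu ih => exact step T p hp (fun h => (ho h).elim) (fun _ => hu) ih

/-- The states of the controller of `wins_of_forall_target`: the `j`-th target is pursued, either
according to the controller of the subgame that avoids the attractor of the target, or inside that
attractor. -/
inductive TState (C : V → Type) (t : ℕ → V) where
  | play (j : ℕ) (c : C (t j))
  | attr (j : ℕ) (u : V)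

/-- If `σ` wins the plays that visit exactly the vertices of `X` infinitely often, and if for each
`v ∈ X` player `σ` wins everywhere outside of the attractor `T v` of `v`, then `σ` wins everywhere
in `X`: the vertices of `X` are taken as targets in turns; if a target is never reached, then the
play eventually remains outside of its attractor. -/
theorem wins_of_forall_target [Countable V] (hsub : ∀ v ∈ X, ∃ u ∈ X, (v, u) ∈ A.edges)
    (hX : Good Ω σ X) (T : V → Set V) (hTX : ∀ v ∈ X, T v ⊆ X) (hmem : ∀ v ∈ X, v ∈ T v)
    (hT : ∀ v ∈ X, AttrSeq A σ X {v} (T v)) (hw : ∀ v ∈ X, Wins A Ω σ (X \ T v) (X \ T v)) :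
    Wins A Ω σ X X := by
  classical
  rcases X.eq_empty_or_nonempty with rfl | hne
  · exact wins_empty
  -- a sequence of targets in which each vertex of `X` occurs infinitely often
  obtain ⟨t, htX, ht⟩ : ∃ t : ℕ → V, (∀ j, t j ∈ X) ∧ ∀ v ∈ X, ∀ a, ∃ b ≥ a, t b = v := by
    obtain ⟨f, hf⟩ := (Set.to_countable X).exists_eq_range hne
    refine ⟨fun j => f (Nat.unpair j).1, fun j => hf ▸ ⟨_, rfl⟩, fun v hv a => ?_⟩
    rw [hf] at hv
    obtain ⟨i, rfl⟩ := hv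
    exact ⟨Nat.pair i a, Nat.right_le_pair i a, by simp⟩
  have hw' : ∀ v, ∃ (C : Type), v ∈ X → ∃ (K : Controller A Ω σ (X \ T v) C),
      X \ T v ⊆ Set.range K.pos := by
    intro v
    by_cases hv : v ∈ X
    · obtain ⟨C, K, hK⟩ := hw v hv
      exact ⟨C, fun _ => ⟨K, hK⟩⟩
    · exact ⟨Unit, fun h => (hv h).elim⟩
  choose C hC using hw'
  have hC' : ∀ j, ∃ K : Controller A Ω σ (X \ T (t j)) (C (t j)), X \ T (t j) ⊆ Set.range K.pos :=
    fun j => hC _ (htX j)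
  choose K hK using hC'
  choose rank N hN hrank using fun j => (hT _ (htX j)).exists_rank
  let pos : TState C t → V
    | .play j c => (K j).pos c
    | .attr _ u => u
  let ok : TState C t → Prop
    | .play _ _ => True
    | .attr j u => u ∈ T (t j)
  -- the ranks decrease until the target is reached, and then the next target is pursued
  let R : TState C t → TState C t → Prop := fun x y => (pos x, pos y) ∈ A.edges ∧
    match x with
    | .play j c => (∃ c', y = .play j c' ∧ (K j).R c c') ∨ ∃ u, y = .attr j u
    | .attr j u => (u ≠ t j ∧ ∃ u', y = .attr j u' ∧ rank j u' < rank j u) ∨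
        (u = t j ∧ ((∃ c, y = .play (j + 1) c) ∨ ∃ u', y = .attr (j + 1) u'))
  have hposX : ∀ x, ok x → pos x ∈ X := by
    rintro (⟨j, c⟩ | ⟨j, u⟩) hx
    · exact ((K j).pos_mem c).1
    · exact hTX _ (htX j) hx
  -- each vertex of `X` can be entered with a given target
  have henter : ∀ j, ∀ u ∈ X, ∃ y, ok y ∧ pos y = u ∧
      ((∃ c, y = .play j c) ∨ ∃ u', y = .attr j u') := by
    intro j u hu
    by_cases h : u ∈ T (t j)
    · exact ⟨.attr j u, h, rfl, .inr ⟨u, rfl⟩⟩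
    · obtain ⟨c, hc⟩ := hK j ⟨hu, h⟩
      exact ⟨.play j c, trivial, hc, .inl ⟨c, rfl⟩⟩
  refine ⟨{x // ok x}, ⟨fun x => pos x, fun x y => R x y, fun x => hposX x x.2,
    fun x y h => h.1, ?_, ?_, ?_⟩, ?_⟩
  · rintro ⟨⟨j, c⟩ | ⟨j, u⟩, hx⟩ ho
    · obtain ⟨c', hc'⟩ := (K j).own c ho
      exact ⟨⟨.play j c', trivial⟩, (K j).edge _ _ hc', .inl ⟨c', rfl, hc'⟩⟩
    · by_cases hu : u = t j
      · obtain ⟨u', hu', he⟩ := hsub u (hposX (.attr j u) hx)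
        obtain ⟨y, hy, rfl, hy'⟩ := henter (j + 1) u' hu'
        exact ⟨⟨y, hy⟩, he, .inr ⟨hu, hy'⟩⟩
      · obtain ⟨u', hu', he, hlt⟩ := (hrank j u hx hu).2.1 ho
        exact ⟨⟨.attr j u', hu'⟩, he, .inl ⟨hu, u', rfl, hlt⟩⟩
  · rintro ⟨⟨j, c⟩ | ⟨j, u⟩, hx⟩ ho w hwX he
    · by_cases hwT : w ∈ T (t j)
      · exact ⟨⟨.attr j w, hwT⟩, ⟨he, .inr ⟨w, rfl⟩⟩, rfl⟩
      · obtain ⟨c', hc', rfl⟩ := (K j).opp c ho w ⟨hwX, hwT⟩ he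
        exact ⟨⟨.play j c', trivial⟩, ⟨he, .inl ⟨c', rfl, hc'⟩⟩, rfl⟩
    · by_cases hu : u = t j
      · obtain ⟨y, hy, rfl, hy'⟩ := henter (j + 1) w hwX
        exact ⟨⟨y, hy⟩, ⟨he, .inr ⟨hu, hy'⟩⟩, rfl⟩
      · obtain ⟨hwT, hlt⟩ := (hrank j u hx hu).2.2 ho w hwX he
        exact ⟨⟨.attr j w, hwT⟩, ⟨he, .inl ⟨hu, w, rfl, hlt⟩⟩, rfl⟩
  · intro p hp
    -- the number of the current target
    let idx : TState C t → ℕ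
      | .play j _ => j
      | .attr j _ => j
    have hidx : ∀ i, idx (p (i + 1)).1 = idx (p i).1 ∨
        (idx (p (i + 1)).1 = idx (p i).1 + 1 ∧ pos (p i).1 = t (idx (p i).1)) := by
      intro i
      have h := (hp i).2
      cases hx : (p i).1 with
      | play j c =>
        rw [hx] at h
        rcases h with ⟨c', e, -⟩ | ⟨u, e⟩ <;> rw [e] <;> exact .inl rfl
      | attr j u =>
        rw [hx] at h
        rcases h with ⟨-, u', e, -⟩ | ⟨hu, ⟨c, e⟩ | ⟨u', e⟩⟩ <;> rw [e]
        · exact .inl rfl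
        · exact .inr ⟨rfl, hu⟩
        · exact .inr ⟨rfl, hu⟩
    have hmono : Monotone fun i => idx (p i).1 := by
      refine monotone_nat_of_le_succ fun i => ?_
      rcases hidx i with h | ⟨h, -⟩ <;> simp only [h] <;> omega
    by_cases hb : ∀ J, ∃ i, J < idx (p i).1
    · -- each target is reached
      have hreach : ∀ J, idx (p 0).1 ≤ J →
          ∃ i, J ≤ idx (p i).1 ∧ idx (p i).1 ≤ J ∧ pos (p i).1 = t J := by
        intro J hJ
        have hex := hb J
        have h1 := Nat.find_spec hex
        have h2 := fun m => Nat.find_min hex (m := m)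
        generalize Nat.find hex = i at h1 h2
        cases i with
        | zero => omega
        | succ i =>
          have h3 := h2 i (by omega)
          rcases hidx i with h | ⟨h, h'⟩
          · omega
          · have : idx (p i).1 = J := by omega
            exact ⟨i, by omega, by omega, by rw [h', this]⟩
      have : infSet (fun i => pos (p i).1) = X := by
        ext v
        simp only [infSet, Set.mem_ofPred_eq, Filter.frequently_atTop]
        constructor
        · intro h
          obtain ⟨b, -, rfl⟩ := h 0
          exact hposX _ (p b).2
        · intro hv a
          obtain ⟨J, hJ, rfl⟩ := ht v hv (idx (p a).1 + idx (p 0).1 + 1)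
          obtain ⟨i, h1, h2, h3⟩ := hreach J (by omega)
          refine ⟨i, ?_, h3⟩
          by_contra hlt
          have := hmono (show i ≤ a by omega)
          simp only at this
          omega
      rw [this]
      exact hX
    · -- the target remains the same from some time on
      push Not at hb
      obtain ⟨J₀, hJ₀⟩ := hb
      obtain ⟨J, M, hM⟩ : ∃ J M, ∀ i ≥ M, idx (p i).1 = J := by
        have hfin : ∃ J, ∃ M, idx (p M).1 = J ∧ ∀ i, idx (p i).1 ≤ J := by
          have hex : ∃ J, ∀ i, idx (p i).1 ≤ J := ⟨J₀, hJ₀⟩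
          have h1 := Nat.find_spec hex
          have h2 := fun m => Nat.find_min hex (m := m)
          generalize Nat.find hex = J at h1 h2
          refine ⟨J, ?_⟩
          by_contra hcon
          push Not at hcon
          have h3 : ∀ i, idx (p i).1 < J := fun i => by
            rcases (h1 i).lt_or_eq with h | h
            · exact h
            · obtain ⟨i', hi'⟩ := hcon i h
              exact absurd (h1 i') (by omega)
          have := h3 0
          refine h2 (J - 1) (by omega) fun i => ?_
          have := h3 i
          omega
        obtain ⟨J, M, hM, hle⟩ := hfin
        refine ⟨J, M, fun i hi => ?_⟩
        have := hmono hi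
        have := hle i
        simp only at *
        omega
      -- the attractor is not left before its target is reached, so it cannot be entered any more
      have hattr : ∀ (i : ℕ) (u : V), M ≤ i → (p i).1 = .attr J u →
          ∃ u', (p (i + 1)).1 = .attr J u' ∧ rank J u' < rank J u := by
        intro i u hi hx
        have h := (hp i).2
        rw [hx] at h
        rcases h with ⟨-, u', e, h⟩ | ⟨hu, ⟨c, e⟩ | ⟨u', e⟩⟩
        · exact ⟨u', e, h⟩
        · have := hM (i + 1) (by omega)
          rw [e] at this
          simp only [idx] at this
          omega
        · have := hM (i + 1) (by omega)
          rw [e] at this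
          simp only [idx] at this
          omega
      have hno : ∀ (r : ℕ) (i : ℕ) (u : V), M ≤ i → (p i).1 = .attr J u → rank J u < r → False := by
        intro r
        induction r with
        | zero => intro i u _ _ h; omega
        | succ r ih =>
          intro i u hi hx hr
          obtain ⟨u', hx', hlt⟩ := hattr i u hi hx
          exact ih (i + 1) u' (by omega) hx' (by omega)
      have hplay : ∀ i, ∃ c, (p (i + M)).1 = .play J c := by
        intro i
        have h := hM (i + M) (by omega)
        cases hx : (p (i + M)).1 with
        | play j c =>
          rw [hx] at h
          simp only [idx] at h
          subst h
          exact ⟨c, rfl⟩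
        | attr j u =>
          rw [hx] at h
          simp only [idx] at h
          subst h
          exact (hno _ _ u (by omega) hx (Nat.lt_succ_self _)).elim
      choose c hc using hplay
      have := (K J).win c fun i => by
        have h := (hp (i + M)).2
        have e' := hc (i + 1)
        rw [show i + 1 + M = i + M + 1 by omega] at e'
        rw [hc i, e'] at h
        rcases h with ⟨c', e, h⟩ | ⟨u, e⟩
        · cases e
          exact h
        · cases e
      rw [← infSet_shift _ M]
      simpa [hc, pos] using this
  · intro v hv
    obtain ⟨y, hy, hyv, -⟩ := henter 0 v hv
    exact ⟨⟨y, hy⟩, hyv⟩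

end

/-! ### Solving a subarena from smaller ones -/

section

open Filter

variable {V : Type} {A : Arena V} {Ω : Set V → Prop} {σ τ : Fin 2} {X Y Z : Set V}

variable (A) in
/-- The subarenas: sets of vertices in which each vertex has a successor. -/
def IsSub (X : Set V) : Prop := ∀ v ∈ X, ∃ u ∈ X, (v, u) ∈ A.edges

variable (A) in
/-- `T` is the attractor of player `σ` to `S` in the subgame on `X`: vertices have been added to `S`
by attraction, and no further vertex is attracted. -/
structure IsAttr (σ : Fin 2) (X S T : Set V) : Prop where
  subset : S ⊆ T
  le : T ⊆ X
  seq : AttrSeq A σ X S T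
  own : ∀ p ∈ X, p ∉ T → A.owner p = σ → ∀ u ∈ T, (p, u) ∉ A.edges
  opp : ∀ p ∈ X, p ∉ T → A.owner p ≠ σ → (∃ u ∈ X, (p, u) ∈ A.edges) →
    ∃ u ∈ X, u ∉ T ∧ (p, u) ∈ A.edges

theorem IsAttr.isSub_diff {S T : Set V} (h : IsAttr A σ X S T) (hX : IsSub A X) :
    IsSub A (X \ T) := by
  rintro p ⟨hp, hpT⟩
  by_cases ho : A.owner p = σ
  · obtain ⟨u, hu, he⟩ := hX p hp
    exact ⟨u, ⟨hu, fun huT => h.own p hp hpT ho u huT he⟩, he⟩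
  · obtain ⟨u, hu, huT, he⟩ := h.opp p hp hpT ho (hX p hp)
    exact ⟨u, ⟨hu, huT⟩, he⟩

/-- In a subarena nothing is attracted to the empty set. -/
theorem AttrSeq.eq_empty {T : Set V} (h : AttrSeq A σ X ∅ T) (hX : IsSub A X) : T = ∅ := by
  induction h with
  | base => rfl
  | own _ _ _ hu _ ih =>
    rw [ih] at hu
    exact hu.elim
  | opp _ hp _ hu ih =>
    obtain ⟨u, hu', he⟩ := hX _ hp
    have := hu u hu' he
    rw [ih] at this
    exact this.elim

/-- Player `σ` cannot enter the attractor from outside, so the opponent can play in the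
complement in isolation. -/
theorem IsAttr.wins_diff {S T : Set V} (h : IsAttr A σ X S T) (hστ : σ ≠ τ)
    (hw : Wins A Ω τ (X \ T) Y) : Wins A Ω τ X Y := by
  refine hw.of_trap Set.sdiff_subset fun v hv ho u hu he => ⟨hu, fun huT => ?_⟩
  exact h.own v hv.1 hv.2 (by omega) u huT he

variable (A Ω) in
/-- `r σ` is, for both players `σ`, the winning region of `σ` in the subgame on `X`, provided that
`X` is a subarena. -/
structure Solves (X : Set V) (r : Fin 2 → Set V) : Prop where
  subset : ∀ σ, r σ ⊆ X
  cover : X ⊆ r 0 ∪ r 1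
  wins : IsSub A X → ∀ σ, Wins A Ω σ X (r σ)

/-- The recursion on subarenas. Suppose that `σ` wins the plays with infinity set `X`. The set `W`
of the vertices that the opponent `τ` wins in a subgame outside of the `σ`-attractor of some vertex
is won by `τ`. If it is empty, then `σ` wins everywhere; otherwise, after removal of the
`τ`-attractor of `W`, a smaller subgame decides about the remaining vertices. -/
theorem wins_step [Countable V] (hστ : σ ≠ τ) (hsub : IsSub A X) (hX : Good Ω σ X)
    {T : V → Set V} (hT : ∀ v ∈ X, IsAttr A σ X {v} (T v))
    {r₁ : V → Fin 2 → Set V} (h₁ : ∀ v ∈ X, Solves A Ω (X \ T v) (r₁ v))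
    {W B Z : Set V} (hW : W = ⋃ v ∈ X, r₁ v τ) (hB : IsAttr A τ X W B)
    {r₂ : Fin 2 → Set V} (h₂ : W ≠ ∅ → Solves A Ω (X \ B) r₂)
    (hZ₀ : W = ∅ → B ∪ Z = ∅) (hZ₁ : W ≠ ∅ → Z = r₂ τ) :
    Wins A Ω τ X (B ∪ Z) ∧ Wins A Ω σ X (X \ (B ∪ Z)) := by
  have hcov : ∀ {Y} {r : Fin 2 → Set V}, Solves A Ω Y r → ∀ v ∈ Y, v ∉ r τ → v ∈ r σ := by
    intro Y r h v hv hr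
    have := h.cover hv
    have h2 : (σ = 0 ∧ τ = 1) ∨ (σ = 1 ∧ τ = 0) := by omega
    rcases h2 with ⟨rfl, rfl⟩ | ⟨rfl, rfl⟩ <;> rcases this with h | h <;>
      first | exact h | exact (hr h).elim
  by_cases hW0 : W = ∅
  · rw [hZ₀ hW0]
    refine ⟨wins_empty, ?_⟩
    rw [Set.sdiff_empty]
    refine wins_of_forall_target hsub hX T (fun v hv => (hT v hv).le)
      (fun v hv => (hT v hv).subset rfl) (fun v hv => (hT v hv).seq) fun v hv => ?_
    refine ((h₁ v hv).wins ((hT v hv).isSub_diff hsub) σ).mono fun u hu => ?_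
    refine hcov (h₁ v hv) u hu fun hu' => ?_
    have : u ∈ W := hW ▸ Set.mem_biUnion hv hu'
    rw [hW0] at this
    exact this
  · rw [hZ₁ hW0]
    have hWw : Wins A Ω τ X W := by
      rw [hW]
      refine wins_iUnion fun v => ?_
      by_cases hv : v ∈ X
      · simp only [hv, Set.iUnion_true]
        exact (hT v hv).wins_diff hστ ((h₁ v hv).wins ((hT v hv).isSub_diff hsub) τ)
      · simpa [hv] using wins_empty
    have hBw := hWw.attr hB.seq
    have hS := h₂ hW0
    have hZs := hB.isSub_diff hsub
    constructor
    · obtain ⟨C, K, hK⟩ := hS.wins hZs τ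
      refine (hBw.switch K.pos K.R (fun d => (K.pos_mem d).1) K.edge (fun d ho => .inl (K.own d ho))
        (fun d ho u hu he => ?_) K.win).mono ?_
      · by_cases huB : u ∈ B
        · exact .inr huB
        · exact .inl (K.opp d ho u ⟨hu, huB⟩ he)
      · rintro u (hu | hu)
        · exact .inr hu
        · exact .inl (hK hu)
    · refine (hB.wins_diff hστ.symm (hS.wins hZs σ)).mono ?_
      rintro u ⟨hu, hu'⟩
      exact hcov hS u ⟨hu, fun h => hu' (.inl h)⟩ fun h => hu' (.inr h)

/-- A controller yields a strategy: the state is updated along the history. -/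
theorem Wins.mem_winRegion (h : Wins A Ω σ Set.univ Y) {v : V} (hv : v ∈ Y) :
    v ∈ A.winRegion Ω σ := by
  classical
  obtain ⟨C, K, hK⟩ := h
  obtain ⟨c₀, hc₀⟩ := hK hv
  let nxt : C → V → C := fun c u => if h : ∃ c', K.R c c' ∧ K.pos c' = u then h.choose else c
  let mv : C → V := fun c => if h : ∃ c', K.R c c' then K.pos h.choose else K.pos c
  let st : List V → C := fun h => h.tail.foldl nxt c₀
  choose any hany using A.total
  -- after histories that do not fit the state, any successor will do
  let s : List V → V := fun h =>
    match h.getLast? with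
    | none => v
    | some u => if A.owner u = σ ∧ K.pos (st h) = u then mv (st h) else any u
  refine ⟨s, ?_, ?_⟩
  · intro h u ho
    simp only [s, List.getLast?_append, List.getLast?_singleton, Option.some_or]
    split_ifs with hc
    · have hex := K.own (st (h ++ [u])) (by rw [hc.2, ho])
      have := K.edge _ _ hex.choose_spec
      rw [hc.2] at this
      simpa only [mv, dif_pos hex] using this
    · exact hany u
  · rintro ρ ⟨h0, hρ⟩ hcons
    let p : ℕ → C := fun i => st ((List.range (i + 1)).map ρ)
    have hp0 : p 0 = c₀ := by simp [p, st]
    have hps : ∀ i, p (i + 1) = nxt (p i) (ρ (i + 1)) := by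
      intro i
      simp only [p, st]
      rw [List.range_succ, List.map_append, List.tail_append_of_ne_nil (by simp), List.foldl_append]
      simp
    have hstep : ∀ i, K.pos (p i) = ρ i →
        K.R (p i) (p (i + 1)) ∧ K.pos (p (i + 1)) = ρ (i + 1) := by
      intro i hi
      have hex : ∃ c', K.R (p i) c' ∧ K.pos c' = ρ (i + 1) := by
        by_cases ho : A.owner (ρ i) = σ
        · have hex := K.own (p i) (by rw [hi, ho])
          refine ⟨hex.choose, hex.choose_spec, ?_⟩
          rw [hcons i ho]
          have hlast : ((List.range (i + 1)).map ρ).getLast? = some (ρ i) := by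
            rw [List.range_succ]; simp
          simp only [s, hlast]
          rw [if_pos ⟨ho, hi⟩]
          exact (show mv (p i) = K.pos hex.choose from dif_pos hex).symm
        · exact K.opp (p i) (by rwa [hi]) _ trivial (by rw [hi]; exact hρ i)
      rw [hps, show nxt (p i) (ρ (i + 1)) = hex.choose from dif_pos hex]
      exact hex.choose_spec
    have hpos : ∀ i, K.pos (p i) = ρ i := by
      intro i
      induction i with
      | zero => rw [hp0, hc₀, h0]
      | succ i ih => exact (hstep i ih).2
    have := K.win p fun i => (hstep i (hpos i)).1
    simp only [hpos] at this
    exact this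

/-- The winning regions are disjoint. -/
theorem not_mem_winRegion_of_mem {v : V} (h0 : v ∈ A.winRegion Ω 0) : v ∉ A.winRegion Ω 1 := by
  rintro ⟨s₁, hs₁, hw₁⟩
  obtain ⟨s₀, hs₀, hw₀⟩ := h0
  -- the play in which both players follow their strategies
  let s : List V → V → V := fun h u => if A.owner u = 0 then s₀ h else s₁ h
  let H : ℕ → List V × V := fun i =>
    Nat.rec ([], v) (fun _ x => (x.1 ++ [x.2], s (x.1 ++ [x.2]) x.2)) i
  let ρ : ℕ → V := fun i => (H i).2
  have hH : ∀ i, (H i).1 = (List.range i).map ρ := by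
    intro i
    induction i with
    | zero => rfl
    | succ i ih =>
      rw [List.range_succ, List.map_append, ← ih]
      rfl
  have hρ : ∀ i, ρ (i + 1) = s ((List.range (i + 1)).map ρ) (ρ i) := by
    intro i
    rw [← hH]
  have hplay : A.IsPlayFrom v ρ := by
    refine ⟨rfl, fun i => ?_⟩
    rw [hρ, List.range_succ, List.map_append]
    by_cases ho : A.owner (ρ i) = 0
    · simp only [s, if_pos ho]
      exact hs₀ _ _ ho
    · simp only [s, if_neg ho]
      exact hs₁ _ _ (by omega)
  have h0 := hw₀ ρ hplay fun i ho => by rw [hρ]; exact if_pos ho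
  have h1 := hw₁ ρ hplay fun i ho => by rw [hρ]; exact if_neg (by omega)
  simp only [if_true] at h0
  simp only [one_ne_zero, if_false] at h1
  exact h1 h0

/-- A solution of the whole arena is the partition into the winning regions. -/
theorem Solves.mem_winRegion_iff {r : Fin 2 → Set V} (h : Solves A Ω Set.univ r) {v : V}
    (hv : v ∈ r σ) (τ : Fin 2) : v ∈ A.winRegion Ω τ ↔ τ = σ := by
  have hw := (h.wins (fun v _ => (A.total v).imp fun u hu => ⟨trivial, hu⟩) σ).mem_winRegion hv
  refine ⟨fun hτ => ?_, fun e => e ▸ hw⟩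
  by_contra hne
  have h2 : (σ = 0 ∧ τ = 1) ∨ (σ = 1 ∧ τ = 0) := by omega
  rcases h2 with ⟨rfl, rfl⟩ | ⟨rfl, rfl⟩
  · exact not_mem_winRegion_of_mem hw hτ
  · exact not_mem_winRegion_of_mem hτ hw

end

/-! ### Sets of vertices as machine words -/

section

theorem and_mod_two (x y : ℕ) : (x &&& y) % 2 = x % 2 &&& y % 2 := by
  simpa using Nat.and_mod_two_pow (a := x) (b := y) (n := 1)

theorem or_mod_two (x y : ℕ) : (x ||| y) % 2 = x % 2 ||| y % 2 := by
  simpa using Nat.or_mod_two_pow (a := x) (b := y) (n := 1)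

theorem or_eq_add_of_and_eq_zero : ∀ x y : ℕ, x &&& y = 0 → x ||| y = x + y := by
  intro x
  induction x using Nat.strong_induction_on with
  | _ x ih =>
    intro y h
    rcases Nat.eq_zero_or_pos x with rfl | hx
    · simp
    have h1 : x / 2 &&& y / 2 = 0 := by rw [← Nat.and_div_two, h]
    have h2 := ih (x / 2) (by omega) _ h1
    rw [← Nat.or_div_two] at h2
    have h3 : (x ||| y) % 2 = x % 2 + y % 2 := by
      have h4 : (x &&& y) % 2 = 0 := by rw [h]
      rw [and_mod_two] at h4
      rw [or_mod_two]
      rcases Nat.mod_two_eq_zero_or_one x with e | e <;>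
        rcases Nat.mod_two_eq_zero_or_one y with e' | e' <;> simp [e, e'] at h4 ⊢
    omega

/-- Clearing the lowest bit of a word removes one of its bits. -/
theorem exists_lowbit (x : ℕ) (hx : 0 < x) :
    ∃ i, x.testBit i = true ∧ x - (x &&& (x - 1)) = 2 ^ i := by
  induction x using Nat.strong_induction_on with
  | _ x ih =>
    have h1 : (x &&& (x - 1)) / 2 = x / 2 &&& (x - 1) / 2 := Nat.and_div_two
    have h2 : (x &&& (x - 1)) % 2 = 0 := by
      rw [and_mod_two]
      rcases Nat.mod_two_eq_zero_or_one x with e | e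
      · simp [e]
      · have : (x - 1) % 2 = 0 := by omega
        simp [this]
    rcases Nat.mod_two_eq_zero_or_one x with e | e
    · obtain ⟨i, hi, h⟩ := ih (x / 2) (by omega) (by omega)
      refine ⟨i + 1, by rwa [Nat.testBit_succ], ?_⟩
      rw [show (x - 1) / 2 = x / 2 - 1 by omega] at h1
      rw [pow_succ]
      omega
    · refine ⟨0, by simp [e], ?_⟩
      rw [show (x - 1) / 2 = x / 2 by omega, Nat.and_self] at h1
      omega

variable {n : ℕ}

/-- The word whose bits are the elements of `F`. -/
def enc (F : Finset (Fin n)) : ℕ := Nat.ofBits fun v => decide (v ∈ F)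

theorem testBit_enc (F : Finset (Fin n)) (i : ℕ) :
    (enc F).testBit i = decide (∃ h : i < n, ⟨i, h⟩ ∈ F) := by
  by_cases h : i < n <;> simp [enc, Nat.testBit_ofBits, h]

theorem testBit_enc_val (F : Finset (Fin n)) (v : Fin n) :
    (enc F).testBit v = decide (v ∈ F) := by
  simp [testBit_enc]

theorem enc_lt (F : Finset (Fin n)) : enc F < 2 ^ n := Nat.ofBits_lt_two_pow _

theorem enc_inj {F G : Finset (Fin n)} : enc F = enc G ↔ F = G := by
  refine ⟨fun h => ?_, fun h => h ▸ rfl⟩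
  ext v
  have := testBit_enc_val F v
  rw [h, testBit_enc_val] at this
  simpa using this.symm

theorem exists_enc {x : ℕ} (hx : x < 2 ^ n) : ∃ F : Finset (Fin n), enc F = x := by
  refine ⟨Finset.univ.filter fun v => x.testBit v = true, Nat.eq_of_testBit_eq fun i => ?_⟩
  rw [testBit_enc]
  by_cases h : i < n
  · simp [h]
  · rw [Nat.testBit_lt_two_pow (hx.trans_le (Nat.pow_le_pow_right two_pos (by omega)))]
    simp [h]

theorem enc_empty : enc (∅ : Finset (Fin n)) = 0 :=
  Nat.eq_of_testBit_eq fun i => by simp [testBit_enc]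

theorem enc_eq_zero {F : Finset (Fin n)} : enc F = 0 ↔ F = ∅ := by
  rw [← enc_empty, enc_inj]

theorem enc_pos {F : Finset (Fin n)} : 0 < enc F ↔ F.Nonempty := by
  rw [Nat.pos_iff_ne_zero, Ne, enc_eq_zero, Finset.nonempty_iff_ne_empty]

theorem enc_univ : enc (Finset.univ : Finset (Fin n)) = 2 ^ n - 1 :=
  Nat.eq_of_testBit_eq fun i => by simp [testBit_enc, Nat.testBit_two_pow_sub_one]

theorem enc_singleton (v : Fin n) : enc {v} = 2 ^ (v : ℕ) :=
  Nat.eq_of_testBit_eq fun i => by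
    rw [testBit_enc, Nat.testBit_two_pow]
    refine decide_eq_decide.2 ⟨?_, ?_⟩
    · rintro ⟨h, h'⟩
      rw [Finset.mem_singleton] at h'
      rw [← h']
    · rintro rfl
      exact ⟨v.2, Finset.mem_singleton.2 rfl⟩

theorem shiftLeft_eq_enc (v : Fin n) : 1 <<< (v : ℕ) = enc {v} := by
  rw [enc_singleton, Nat.one_shiftLeft]

theorem enc_and (F G : Finset (Fin n)) : enc F &&& enc G = enc (F ∩ G) :=
  Nat.eq_of_testBit_eq fun i => by
    by_cases h : i < n <;> simp [testBit_enc, h]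

theorem enc_or (F G : Finset (Fin n)) : enc F ||| enc G = enc (F ∪ G) :=
  Nat.eq_of_testBit_eq fun i => by
    by_cases h : i < n <;> simp [testBit_enc, h]

theorem enc_sub_of_subset {F G : Finset (Fin n)} (h : G ⊆ F) : enc F - enc G = enc (F \ G) := by
  have h1 : enc (F \ G) &&& enc G = 0 := by
    rw [enc_and, enc_eq_zero]
    ext; simp
  have h2 := or_eq_add_of_and_eq_zero _ _ h1
  rw [enc_or, Finset.sdiff_union_of_subset h] at h2
  omega

theorem enc_sub_inter (F G : Finset (Fin n)) : enc F - enc (F ∩ G) = enc (F \ G) := by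
  rw [enc_sub_of_subset Finset.inter_subset_left, Finset.sdiff_inter_self_left]

theorem enc_lt_of_ssubset {F G : Finset (Fin n)} (h : F ⊂ G) : enc F < enc G := by
  have h1 := enc_sub_of_subset h.1
  have h2 : 0 < enc (G \ F) := enc_pos.2 (Finset.sdiff_nonempty.2 h.2)
  omega

/-- The lowest bit of a nonempty set, found by three instructions. -/
theorem enc_lowbit {F : Finset (Fin n)} (hF : F.Nonempty) :
    ∃ v ∈ F, enc F - (enc F &&& (enc F - 1)) = enc {v} := by
  obtain ⟨i, hi, h⟩ := exists_lowbit (enc F) (enc_pos.2 hF)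
  rw [testBit_enc, decide_eq_true_iff] at hi
  obtain ⟨hn, hi⟩ := hi
  exact ⟨⟨i, hn⟩, hi, by rw [h, enc_singleton]⟩

theorem enc_sub_singleton {F : Finset (Fin n)} {v : Fin n} (h : v ∈ F) :
    enc F - enc {v} = enc (F.erase v) := by
  rw [enc_sub_of_subset (Finset.singleton_subset_iff.2 h), Finset.sdiff_singleton_eq_erase]

end

/-! ### Verification of programs -/

section

attribute [simp] BinOp.eval Operand.eval Test.Holds

infixr:35 " ;; " => Program.seq

namespace State

/-- The state after the assignment of `v` to the register `r`. -/
def set (s : State) (r v : ℕ) : State := { s with reg := Function.update s.reg r v }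

/-- The state after the assignment of `v` to the memory cell `a`. -/
def put (s : State) (a v : ℕ) : State := { s with mem := Function.update s.mem a v }

@[simp] theorem set_reg (s : State) (r v r' : ℕ) :
    (s.set r v).reg r' = if r' = r then v else s.reg r' :=
  Function.update_apply ..

@[simp] theorem set_mem (s : State) (r v : ℕ) : (s.set r v).mem = s.mem := rfl

@[simp] theorem put_reg (s : State) (a v : ℕ) : (s.put a v).reg = s.reg := rfl

@[simp] theorem put_mem (s : State) (a v a' : ℕ) :
    (s.put a v).mem a' = if a' = a then v else s.mem a' :=
  Function.update_apply ..

@[simp] theorem set_set (s : State) (r v w : ℕ) : (s.set r v).set r w = s.set r w := by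
  simp [set, Function.update_idem]

end State

/-- The registers that a program may change. -/
def Program.writes : Program → ℕ → Bool
  | .skip, _ => false
  | .op r _ _ _, r' => r == r'
  | .load r _, r' => r == r'
  | .store _ _, _ => false
  | .seq p q, r' => p.writes r' || q.writes r'
  | .branch _ p q, r' => p.writes r' || q.writes r'
  | .loop _ p, r' => p.writes r'

/-- Whether a program contains an instruction that changes the memory. -/
def Program.stores : Program → Bool
  | .skip => false
  | .op _ _ _ _ => false
  | .load _ _ => false
  | .store _ _ => true
  | .seq p q => p.stores || q.stores
  | .branch _ p q => p.stores || q.stores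
  | .loop _ p => p.stores

/-- `s'` agrees with `s` on what `p` cannot change for syntactic reasons. -/
structure Frame (p : Program) (s s' : State) : Prop where
  reg : ∀ r, p.writes r = false → s'.reg r = s.reg r
  mem : p.stores = false → s'.mem = s.mem

theorem Frame.refl (p : Program) (s : State) : Frame p s s := ⟨fun _ _ => rfl, fun _ => rfl⟩

theorem Frame.trans {p : Program} {s s' s'' : State} (h : Frame p s s') (h' : Frame p s' s'') :
    Frame p s s'' :=
  ⟨fun r hr => (h'.reg r hr).trans (h.reg r hr), fun hp => (h'.mem hp).trans (h.mem hp)⟩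

variable {S W : ℕ}

theorem Exec.frame {p : Program} {s s' : State} {t : ℕ} (h : Exec S W p s t s') :
    Frame p s s' := by
  induction h with
  | skip s => exact Frame.refl _ _
  | op s r o a b hW =>
    refine ⟨fun r' hr => Function.update_of_ne ?_ _ _, fun _ => rfl⟩
    rintro rfl
    simp [Program.writes] at hr
  | load s r a hS hW =>
    refine ⟨fun r' hr => Function.update_of_ne ?_ _ _, fun _ => rfl⟩
    rintro rfl
    simp [Program.writes] at hr
  | store s a b hS hW => exact ⟨fun _ _ => rfl, fun h => by simp [Program.stores] at h⟩
  | seq s s' s'' p q t t' _ _ ih ih' =>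
    refine ⟨fun r hr => ?_, fun hp => ?_⟩
    · simp only [Program.writes, Bool.or_eq_false_iff] at hr
      rw [ih'.reg r hr.2, ih.reg r hr.1]
    · simp only [Program.stores, Bool.or_eq_false_iff] at hp
      rw [ih'.mem hp.2, ih.mem hp.1]
  | branch_true s s' b p q t hb _ ih =>
    refine ⟨fun r hr => ?_, fun hp => ?_⟩
    · simp only [Program.writes, Bool.or_eq_false_iff] at hr
      exact ih.reg r hr.1
    · simp only [Program.stores, Bool.or_eq_false_iff] at hp
      exact ih.mem hp.1
  | branch_false s s' b p q t hb _ ih =>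
    refine ⟨fun r hr => ?_, fun hp => ?_⟩
    · simp only [Program.writes, Bool.or_eq_false_iff] at hr
      exact ih.reg r hr.2
    · simp only [Program.stores, Bool.or_eq_false_iff] at hp
      exact ih.mem hp.2
  | loop_false s b p hb => exact Frame.refl _ _
  | loop_true s s' s'' b p t t' hb _ _ ih ih' =>
    exact Frame.trans ⟨ih.reg, ih.mem⟩ ih'

variable (S W) in
/-- The program `p` halts from the state `s`, with a number of steps and a final state that
satisfy `Q`. -/
def Run (p : Program) (s : State) (Q : ℕ → State → Prop) : Prop :=
  ∃ t s', Exec S W p s t s' ∧ Q t s'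

namespace Run

variable {p q : Program} {s : State} {P Q : ℕ → State → Prop}

theorem skip (h : Q 1 s) : Run S W .skip s Q := ⟨1, s, .skip s, h⟩

/-- Execution of an arithmetic instruction with the result `v`. -/
theorem op {r : ℕ} {o : BinOp} {a b : Operand} (v : ℕ) (hv : o.eval (a.eval s) (b.eval s) = v)
    (hW : v < W) (h : Q 1 (s.set r v)) : Run S W (.op r o a b) s Q := by
  subst hv
  exact ⟨1, _, .op s r o a b hW, h⟩

theorem load {r : ℕ} {a : Operand} (i v : ℕ) (hi : a.eval s = i) (hv : s.mem i = v)
    (hS : i < S) (hW : v < W) (h : Q 1 (s.set r v)) : Run S W (.load r a) s Q := by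
  subst hi hv
  exact ⟨1, _, .load s r a hS hW, h⟩

theorem store {a b : Operand} (i v : ℕ) (hi : a.eval s = i) (hv : b.eval s = v)
    (hS : i < S) (hW : v < W) (h : Q 1 (s.put i v)) : Run S W (.store a b) s Q := by
  subst hi hv
  exact ⟨1, _, .store s a b hS hW, h⟩

theorem seq (h : Run S W p s fun t s' => Run S W q s' fun t' s'' => Q (t + t') s'') :
    Run S W (p ;; q) s Q := by
  obtain ⟨t, s', h, t', s'', h', hQ⟩ := h
  exact ⟨t + t', s'', .seq _ _ _ _ _ _ _ h h', hQ⟩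

theorem mono (h : Run S W p s P) (hPQ : ∀ t s', P t s' → Frame p s s' → Q t s') :
    Run S W p s Q := by
  obtain ⟨t, s', h, hP⟩ := h
  exact ⟨t, s', h, hPQ t s' hP h.frame⟩

/-- Use of the specification `P` of the first part of a program. -/
theorem seq_of (h : Run S W p s P)
    (h' : ∀ t s', P t s' → Frame p s s' → Run S W q s' fun t' s'' => Q (t + t') s'') :
    Run S W (p ;; q) s Q :=
  (h.mono h').seq

theorem seq_op {r : ℕ} {o : BinOp} {a b : Operand} (v : ℕ)
    (hv : o.eval (a.eval s) (b.eval s) = v) (hW : v < W)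
    (h : Run S W q (s.set r v) fun t s' => Q (1 + t) s') : Run S W (.op r o a b ;; q) s Q :=
  (op v hv hW h).seq

theorem seq_load {r : ℕ} {a : Operand} (i v : ℕ) (hi : a.eval s = i) (hv : s.mem i = v)
    (hS : i < S) (hW : v < W) (h : Run S W q (s.set r v) fun t s' => Q (1 + t) s') :
    Run S W (.load r a ;; q) s Q :=
  (load i v hi hv hS hW h).seq

theorem seq_store {a b : Operand} (i v : ℕ) (hi : a.eval s = i) (hv : b.eval s = v)
    (hS : i < S) (hW : v < W) (h : Run S W q (s.put i v) fun t s' => Q (1 + t) s') :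
    Run S W (.store a b ;; q) s Q :=
  (store i v hi hv hS hW h).seq

theorem branch {b : Test} (h : b.Holds s → Run S W p s fun t s' => Q (t + 1) s')
    (h' : ¬ b.Holds s → Run S W q s fun t s' => Q (t + 1) s') : Run S W (.branch b p q) s Q := by
  by_cases hb : b.Holds s
  · obtain ⟨t, s', h, hQ⟩ := h hb
    exact ⟨_, _, .branch_true _ _ _ _ _ _ hb h, hQ⟩
  · obtain ⟨t, s', h, hQ⟩ := h' hb
    exact ⟨_, _, .branch_false _ _ _ _ _ _ hb h, hQ⟩

/-- A loop with an invariant `I`, indexed by ghost data `g`, and with a potential `Φ` that pays for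
the steps of the iterations. -/
theorem loop {γ : Type} {b : Test} (I : γ → State → Prop) (Φ : γ → ℕ) (g : γ) (hI : I g s)
    (step : ∀ g s', I g s' → Frame p s s' → b.Holds s' →
      Run S W p s' fun t s'' => ∃ g', I g' s'' ∧ t + 1 + Φ g' ≤ Φ g)
    (hQ : ∀ g' t s', I g' s' → Frame p s s' → ¬ b.Holds s' → t + Φ g' ≤ Φ g + 1 → Q t s') :
    Run S W (.loop b p) s Q := by
  have key : ∀ (N : ℕ) (g : γ) (s' : State), Φ g ≤ N → I g s' → Frame p s s' →
      ∃ t s'' g', Exec S W (.loop b p) s' t s'' ∧ I g' s'' ∧ Frame p s s'' ∧ ¬ b.Holds s'' ∧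
        t + Φ g' ≤ Φ g + 1 := by
    intro N
    induction N with
    | zero =>
      intro g s' hN hI hF
      by_cases hb : b.Holds s'
      · obtain ⟨t, s'', -, g', -, h⟩ := step g s' hI hF hb
        omega
      · exact ⟨1, s', g, .loop_false _ _ _ hb, hI, hF, hb, by omega⟩
    | succ N ih =>
      intro g s' hN hI hF
      by_cases hb : b.Holds s'
      · obtain ⟨t, s'', hE, g', hI', h⟩ := step g s' hI hF hb
        obtain ⟨t', s₃, g₃, hE', hI₃, hF₃, hb₃, h₃⟩ :=
          ih g' s'' (by omega) hI' (hF.trans hE.frame)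
        exact ⟨_, s₃, g₃, .loop_true _ _ _ _ _ _ _ hb hE hE', hI₃, hF₃, hb₃, by omega⟩
      · exact ⟨1, s', g, .loop_false _ _ _ hb, hI, hF, hb, by omega⟩
  obtain ⟨t, s', g', hE, hI', hF, hb, ht⟩ := key _ g s le_rfl hI (Frame.refl _ _)
  exact ⟨t, s', hE, hQ g' t s' hI' hF hb ht⟩

end Run

/-- The lowest bit of the register `x` is removed from it and put into the register `d`. -/
def popBit (d x : ℕ) : Program :=
  .op d .sub (.reg x) (.const 1) ;; .op d .and (.reg x) (.reg d) ;;
  .op d .sub (.reg x) (.reg d) ;; .op x .sub (.reg x) (.reg d)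

theorem Run.popBit {n d x : ℕ} {s : State} {Q : ℕ → State → Prop} {F : Finset (Fin n)}
    (hdx : d ≠ x) (hW : 2 ^ n ≤ W) (hF : s.reg x = enc F) (hne : 0 < s.reg x)
    (h : ∀ v ∈ F, Q 4 ((s.set d (enc {v})).set x (enc (F.erase v)))) :
    Run S W (popBit d x) s Q := by
  have hF' : F.Nonempty := enc_pos.1 (hF ▸ hne)
  have h1 := enc_lt F
  obtain ⟨v, hv, hv'⟩ := enc_lowbit hF'
  have h2 := enc_lt (F.erase v)
  have h3 := enc_lt {v}
  have hxd := hdx.symm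
  have h4 : enc F &&& (enc F - 1) ≤ enc F := Nat.and_le_left
  refine .seq_op (enc F - 1) (by simp [hF]) (by omega) ?_
  refine .seq_op (enc F &&& (enc F - 1))
    (by simp [hF, hxd]) (by omega) ?_
  refine .seq_op (enc {v}) (by simp [hF, hxd, hv'])
    (by omega) ?_
  refine .op (enc (F.erase v))
    (by simp [hF, hxd, enc_sub_singleton hv]) (by omega) ?_
  simpa using h v hv

end

/-! ### Computing attractors -/

section

variable {n : ℕ} {S W : ℕ}

/-- The word `2ⁿ`. -/
abbrev rN : ℕ := 0
/-- The set of all vertices. -/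
abbrev rFull : ℕ := 1
/-- The base address of the table of the sets of predecessors. -/
abbrev rPre : ℕ := 2
/-- The base address of the table of the sets of successors. -/
abbrev rSuc : ℕ := 3
/-- The base address of the table of the winning pairs. -/
abbrev rPairs : ℕ := 4
/-- The set of the vertices of player `0`. -/
abbrev rOwn0 : ℕ := 5
/-- The set of the vertices of player `1`. -/
abbrev rOwn1 : ℕ := 6
/-- The base address of the table of the regions won by player `0`. -/
abbrev rWin0 : ℕ := 7
/-- The base address of the table of the regions won by player `1`. -/
abbrev rWin1 : ℕ := 8
/-- The set of vertices that is treated: a subgame, or the index of a table entry. -/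
abbrev rX : ℕ := 10
/-- The set of the vertices of the attracting player. -/
abbrev rOwn : ℕ := 11
/-- The vertices attracted so far. -/
abbrev rA : ℕ := 12
/-- The attracted vertices whose predecessors have not been considered. -/
abbrev rQ : ℕ := 13
/-- The vertex whose predecessors are considered; while the input is read, the source of an edge or
the first set of a pair. -/
abbrev rU : ℕ := 14
/-- The predecessors that remain to be considered. -/
abbrev rM : ℕ := 15
/-- The predecessor that is considered. -/
abbrev rP : ℕ := 16
/-- A temporary register. -/
abbrev rTmp : ℕ := 17
/-- A temporary register. -/
abbrev rTmp' : ℕ := 18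

open Program Operand Test

/-- The vertex `rP` is attracted. -/
def attractVertex : Program :=
  op rA .or (reg rA) (reg rP) ;; op rQ .or (reg rQ) (reg rP)

/-- Attracts `rP` if its owner is the attracting player or if it has no successor in `rX` outside of
`rA`. -/
def tryVertex : Program :=
  op rTmp .and (reg rP) (reg rOwn) ;;
  branch (eq (reg rTmp) (const 0))
    (op rTmp .add (reg rSuc) (reg rP) ;; load rTmp (reg rTmp) ;; op rTmp .and (reg rTmp) (reg rX) ;;
      op rTmp' .and (reg rTmp) (reg rA) ;; branch (eq (reg rTmp) (reg rTmp')) attractVertex skip)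
    attractVertex

/-- Tries all predecessors. -/
def tryPreds : Program :=
  loop (lt (const 0) (reg rM)) (popBit rP rM ;; tryVertex)

/-- Computes, for the vertices in `rA = rQ`, their attractor in the subgame `rX`, for the player who
owns `rOwn`. -/
def attrProg : Program :=
  loop (lt (const 0) (reg rQ))
    (popBit rU rQ ;; op rTmp .add (reg rPre) (reg rU) ;; load rM (reg rTmp) ;;
      op rM .and (reg rM) (reg rX) ;; op rTmp .and (reg rM) (reg rA) ;;
      op rM .sub (reg rM) (reg rTmp) ;; tryPreds)

variable (A : Arena (Fin n))

/-- The predecessors of `v`. -/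
def preds (v : Fin n) : Finset (Fin n) := Finset.univ.filter fun u => (u, v) ∈ A.edges

/-- The successors of `v`. -/
def succs (v : Fin n) : Finset (Fin n) := Finset.univ.filter fun u => (v, u) ∈ A.edges

/-- The vertices of player `σ`. -/
def owned (σ : Fin 2) : Finset (Fin n) := Finset.univ.filter fun v => A.owner v = σ

theorem mem_preds {u v : Fin n} : u ∈ preds A v ↔ (u, v) ∈ A.edges := by simp [preds]

theorem mem_succs {u v : Fin n} : u ∈ succs A v ↔ (v, u) ∈ A.edges := by simp [succs]

theorem mem_owned {σ : Fin 2} {v : Fin n} : v ∈ owned A σ ↔ A.owner v = σ := by simp [owned]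

theorem sum_card_preds : ∑ v, (preds A v).card = A.edges.card := by
  rw [Finset.card_eq_sum_card_fiberwise (f := Prod.snd) (t := Finset.univ) (by simp)]
  refine Finset.sum_congr rfl fun v _ => ?_
  refine Finset.card_bij' (fun u _ => (u, v)) (fun e _ => e.1) ?_ ?_ ?_ ?_
  · simp [mem_preds]
  · rintro ⟨a, b⟩ h
    rw [Finset.mem_filter] at h
    obtain ⟨h, rfl⟩ := h
    simpa [mem_preds] using h
  · simp
  · rintro ⟨a, b⟩ h
    rw [Finset.mem_filter] at h
    obtain ⟨h, rfl⟩ := h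
    rfl

theorem le_card_edges : n ≤ A.edges.card := by
  choose f hf using A.total
  have := Finset.card_le_card_of_injOn (s := Finset.univ) (t := A.edges) (fun u => (u, f u))
    (fun u _ => hf u) (fun u _ v _ h => congrArg Prod.fst h)
  simpa using this

/-- The memory holds the tables of predecessors and successors, from the address `b` on. -/
structure GraphTables (b : ℕ) (m : ℕ → ℕ) : Prop where
  pre : ∀ v, m (b + enc {v}) = enc (preds A v)
  suc : ∀ v, m (b + 2 ^ n + enc {v}) = enc (succs A v)

variable (σ : Fin 2) (X : Finset (Fin n))

/-- The vertex `p` is not attracted by the vertices in `P`. -/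
structure Unattracted (P : Finset (Fin n)) (p : Fin n) : Prop where
  own : A.owner p = σ → ∀ u ∈ P, (p, u) ∉ A.edges
  opp : A.owner p ≠ σ → (∃ u ∈ X, (p, u) ∈ A.edges) → ∃ u ∈ X, u ∉ P ∧ (p, u) ∈ A.edges

variable {A σ X}

theorem Unattracted.insert {P : Finset (Fin n)} {u p : Fin n} (h : Unattracted A σ X P p)
    (hp : p ∉ preds A u) : Unattracted A σ X (insert u P) p := by
  rw [mem_preds] at hp
  refine ⟨fun ho v hv he => ?_, fun ho hex => ?_⟩
  · rcases Finset.mem_insert.1 hv with rfl | hv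
    · exact hp he
    · exact h.own ho v hv he
  · obtain ⟨v, hv, hvP, he⟩ := h.opp ho hex
    refine ⟨v, hv, fun hv' => ?_, he⟩
    rcases Finset.mem_insert.1 hv' with rfl | hv'
    · exact hp he
    · exact hvP hv'

/-- The state of the attractor computation: the vertices `T` are attracted, the vertices `P` have
been considered, and `M` are the vertices outside of `T` that possibly are attracted by `P`. -/
structure AttrInv (A : Arena (Fin n)) (σ : Fin 2) (X S₀ P M T : Finset (Fin n)) (s : State) :
    Prop where
  rA : s.reg rA = enc T
  rQ : s.reg rQ = enc (T \ P)
  start : S₀ ⊆ T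
  le : T ⊆ X
  done : P ⊆ T
  todo : M ⊆ X \ T
  seq : AttrSeq A σ X S₀ T
  unattracted : ∀ p ∈ X, p ∉ T → p ∉ M → Unattracted A σ X P p

/-- Attraction of a further vertex. -/
theorem AttrInv.attract {S₀ P M T : Finset (Fin n)} {s : State} (h : AttrInv A σ X S₀ P M T s)
    {p : Fin n} (hp : p ∈ M) (ha : AttrSeq A σ (X : Set (Fin n)) S₀ (insert p (T : Set (Fin n))))
    {s' : State} (hA : s'.reg RegularGames.rA = enc (T ∪ {p}))
    (hQ : s'.reg RegularGames.rQ = enc (T \ P ∪ {p})) :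
    AttrInv A σ X S₀ P (M.erase p) (T ∪ {p}) s' := by
  have hpX := h.todo hp
  rw [Finset.mem_sdiff] at hpX
  refine ⟨hA, ?_, h.start.trans Finset.subset_union_left, ?_, h.done.trans Finset.subset_union_left,
    ?_, ?_, ?_⟩
  · rw [hQ, enc_inj]
    ext v
    have := fun hv : p ∈ P => hpX.2 (h.done hv)
    simp only [Finset.mem_union, Finset.mem_sdiff, Finset.mem_singleton]
    grind
  · exact Finset.union_subset h.le (Finset.singleton_subset_iff.2 hpX.1)
  · intro v hv
    have := h.todo (Finset.mem_of_mem_erase hv)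
    have := Finset.ne_of_mem_erase hv
    simp_all
  · simpa [Set.union_singleton] using ha
  · intro q hqX hqT hqM
    simp only [Finset.mem_union, Finset.mem_singleton, not_or] at hqT
    exact h.unattracted q hqX hqT.1 fun hq => hqM (Finset.mem_erase.2 ⟨hqT.2, hq⟩)

/-- A vertex that has been found not to be attracted by `P` is removed from `M`. -/
theorem AttrInv.drop {S₀ P M T : Finset (Fin n)} {s : State} (h : AttrInv A σ X S₀ P M T s)
    {p : Fin n} (hu : Unattracted A σ X P p) {s' : State}
    (hA : s'.reg RegularGames.rA = s.reg RegularGames.rA)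
    (hQ : s'.reg RegularGames.rQ = s.reg RegularGames.rQ) :
    AttrInv A σ X S₀ P (M.erase p) T s' := by
  refine ⟨by rw [hA, h.rA], by rw [hQ, h.rQ], h.start, h.le, h.done,
    (Finset.erase_subset _ _).trans h.todo, h.seq, fun q hqX hqT hqM => ?_⟩
  by_cases hqp : q = p
  · exact hqp ▸ hu
  · exact h.unattracted q hqX hqT fun hq => hqM (Finset.mem_erase.2 ⟨hqp, hq⟩)

theorem attractVertex_run {T Q : Finset (Fin n)} {p : Fin n} {s : State} (hW : 2 ^ n ≤ W)
    (hA : s.reg rA = enc T) (hQ : s.reg rQ = enc Q) (hP : s.reg rP = enc {p}) :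
    Run S W attractVertex s fun t s' =>
      t = 2 ∧ s'.reg rA = enc (T ∪ {p}) ∧ s'.reg rQ = enc (Q ∪ {p}) := by
  have h1 := enc_lt (T ∪ {p})
  have h2 := enc_lt (Q ∪ {p})
  refine .seq_op (enc (T ∪ {p})) (by simp [hA, hP, enc_or]) (by omega) ?_
  refine .op (enc (Q ∪ {p})) (by simp [hQ, hP, enc_or]) (by omega) ?_
  simp

theorem tryVertex_run {b : ℕ} {S₀ P M T : Finset (Fin n)} {p : Fin n} {s : State}
    (hS : b + 2 * 2 ^ n ≤ S) (hW : b + 2 * 2 ^ n ≤ W) (hg : GraphTables A b s.mem)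
    (hX : s.reg rX = enc X) (hown : s.reg rOwn = enc (owned A σ)) (hsuc : s.reg rSuc = b + 2 ^ n)
    (hI : AttrInv A σ X S₀ P M T s) (hp : p ∈ M) (hpP : ∃ u ∈ T, (p, u) ∈ A.edges)
    (hP : s.reg rP = enc {p}) :
    Run S W tryVertex s fun t s' => t ≤ 9 ∧ ∃ T', AttrInv A σ X S₀ P (M.erase p) T' s' := by
  have h1 := enc_lt ({p} : Finset (Fin n))
  have h2 := enc_lt ({p} ∩ owned A σ)
  have h3 := enc_lt (succs A p)
  have h4 := enc_lt (succs A p ∩ X)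
  have h5 := enc_lt (succs A p ∩ X ∩ T)
  have hpX := Finset.mem_sdiff.1 (hI.todo hp)
  have hA := hI.rA
  have hQ := hI.rQ
  refine .seq_op (enc ({p} ∩ owned A σ)) (by simp [hP, hown, enc_and]) (by omega) ?_
  refine .branch (fun hb => ?_) fun hb => ?_
  · have ho : A.owner p ≠ σ := by
      simp only [Test.Holds, Operand.eval, State.set_reg, if_true, enc_eq_zero] at hb
      intro ho
      have : p ∈ {p} ∩ owned A σ := by simp [mem_owned, ho]
      simp [hb] at this
    refine .seq_op (b + 2 ^ n + enc {p}) (by simp [hP, hsuc]) (by omega) ?_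
    refine .seq_load (b + 2 ^ n + enc {p}) (enc (succs A p)) (by simp) (by simp [hg.suc])
      (by omega) (by omega) ?_
    refine .seq_op (enc (succs A p ∩ X)) (by simp [hX, enc_and]) (by omega) ?_
    refine .seq_op (enc (succs A p ∩ X ∩ T)) (by simp [hA, enc_and]) (by omega) ?_
    refine .branch (fun hb => ?_) fun hb => ?_
    · refine (attractVertex_run (T := T) (Q := T \ P) (p := p) (by omega) (by simp [hA])
        (by simp [hQ]) (by simp [hP])).mono ?_
      rintro t s' ⟨ht, h6, h7⟩ -
      refine ⟨by omega, _, hI.attract hp (.opp hI.seq hpX.1 ho fun u hu he => ?_) h6 h7⟩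
      simp only [Test.Holds, Operand.eval, State.set_reg] at hb
      simp only [if_true] at hb
      have hb := enc_inj.1 hb
      have : u ∈ succs A p ∩ X := by simp [mem_succs, he]; exact hu
      rw [hb] at this
      exact (Finset.mem_inter.1 this).2
    · refine .skip ⟨by omega, T, hI.drop ⟨fun h => (ho h).elim, fun _ _ => ?_⟩ (by simp) (by simp)⟩
      by_contra hcon
      push Not at hcon
      apply hb
      simp only [Test.Holds, Operand.eval, State.set_reg]
      simp only [if_true]
      refine enc_inj.2 (Finset.inter_eq_left.2 fun u hu => ?_).symm
      rw [Finset.mem_inter, mem_succs] at hu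
      by_contra hT
      exact hcon u hu.2 (fun h => hT (hI.done h)) hu.1
  · have ho : A.owner p = σ := by
      simp only [Test.Holds, Operand.eval, State.set_reg, if_true, enc_eq_zero] at hb
      by_contra ho
      apply hb
      ext v
      simp only [Finset.mem_inter, Finset.mem_singleton, mem_owned, Finset.notMem_empty, iff_false]
      rintro ⟨rfl, h⟩
      exact ho h
    refine (attractVertex_run (T := T) (Q := T \ P) (p := p) (by omega) (by simp [hA])
      (by simp [hQ]) (by simp [hP])).mono ?_
    rintro t s' ⟨ht, h6, h7⟩ -
    obtain ⟨u, hu, he⟩ := hpP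
    exact ⟨by omega, _, hI.attract hp (.own hI.seq hpX.1 ho hu he) h6 h7⟩

/-- Once all predecessors of `u` have been tried, the vertices outside of the set reached are not
attracted by `P`, of which `u` is an element. -/
theorem tryPreds_run {b : ℕ} {S₀ P M T : Finset (Fin n)} {u : Fin n} {s : State}
    (hS : b + 2 * 2 ^ n ≤ S) (hW : b + 2 * 2 ^ n ≤ W) (hg : GraphTables A b s.mem)
    (hX : s.reg rX = enc X) (hown : s.reg rOwn = enc (owned A σ)) (hsuc : s.reg rSuc = b + 2 ^ n)
    (hI : AttrInv A σ X S₀ P M T s) (hM : s.reg rM = enc M) (hu : u ∈ P) (hMu : M ⊆ preds A u) :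
    Run S W tryPreds s fun t s' =>
      t ≤ 14 * M.card + 1 ∧ ∃ T', AttrInv A σ X S₀ P ∅ T' s' := by
  refine .loop (fun M s' => M ⊆ preds A u ∧ s'.reg rM = enc M ∧ ∃ T', AttrInv A σ X S₀ P M T' s')
    (fun M => 14 * M.card) M ⟨hMu, hM, T, hI⟩ ?_ ?_
  · rintro M s₁ ⟨hMu, hM, T, hI⟩ hF hb
    simp only [Test.Holds, Operand.eval] at hb
    refine .seq (.popBit (by decide) (by omega) hM hb fun p hp => ?_)
    refine (tryVertex_run (A := A) (σ := σ) (X := X) (b := b) (S₀ := S₀) (P := P) (M := M) (T := T)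
      (p := p) hS hW ?_ ?_ ?_ ?_ ?_ hp ?_ ?_).mono ?_
    · simpa [hF.mem rfl] using hg
    · simpa [hF.reg rX rfl] using hX
    · simpa [hF.reg rOwn rfl] using hown
    · simpa [hF.reg rSuc rfl] using hsuc
    · exact ⟨by simp [hI.rA], by simp [hI.rQ], hI.start, hI.le, hI.done, hI.todo, hI.seq,
        hI.unattracted⟩
    · exact ⟨u, hI.done hu, (mem_preds A).1 (hMu hp)⟩
    · simp
    · rintro t s' ⟨ht, T', hI'⟩ hF'
      refine ⟨M.erase p, ⟨(Finset.erase_subset _ _).trans hMu, ?_, T', hI'⟩, ?_⟩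
      · rw [hF'.reg rM rfl]
        simp
      · have := Finset.card_erase_add_one hp
        omega
  · rintro M' t s' ⟨-, hM', T', hI'⟩ - hb ht
    simp only [Test.Holds, Operand.eval, hM', enc_pos, Finset.not_nonempty_iff_eq_empty] at hb
    subst hb
    exact ⟨by omega, T', hI'⟩

/-- The attractor computation is correct, and takes time linear in the number of edges. -/
theorem attrProg_run {b : ℕ} {S₀ : Finset (Fin n)} {s : State}
    (hS : b + 2 * 2 ^ n ≤ S) (hW : b + 2 * 2 ^ n ≤ W) (hg : GraphTables A b s.mem)
    (hX : s.reg rX = enc X) (hown : s.reg rOwn = enc (owned A σ)) (hpre : s.reg rPre = b)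
    (hsuc : s.reg rSuc = b + 2 ^ n) (hA : s.reg rA = enc S₀) (hQ : s.reg rQ = enc S₀)
    (hS₀ : S₀ ⊆ X) :
    Run S W attrProg s fun t s' => t ≤ 26 * A.edges.card + 1 ∧
      ∃ T : Finset (Fin n), s'.reg rA = enc T ∧ IsAttr A σ (X : Set (Fin n)) S₀ T := by
  -- each vertex that has not been considered pays for one iteration
  refine .loop (fun P s' => ∃ T, AttrInv A σ X S₀ P ∅ T s')
    (fun P => ∑ u ∈ Pᶜ, (12 + 14 * (preds A u).card)) (∅ : Finset (Fin n))
    ⟨S₀, hA, by simpa using hQ, subset_rfl, hS₀, by simp, by simp, .base, ?_⟩ ?_ ?_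
  · intro p hp hpT _
    exact ⟨by simp, fun _ ⟨u, hu, he⟩ => ⟨u, hu, by simp, he⟩⟩
  · rintro P s₁ ⟨T, hI⟩ hF hb
    simp only [Test.Holds, Operand.eval] at hb
    refine .seq (.popBit (by decide) (by omega) hI.rQ hb fun u hu => ?_)
    rw [Finset.mem_sdiff] at hu
    have h1 := enc_lt ({u} : Finset (Fin n))
    have h2 := enc_lt (preds A u)
    have h3 := enc_lt (preds A u ∩ X)
    have h4 := enc_lt (preds A u ∩ X ∩ T)
    have h5 := enc_lt ((preds A u ∩ X) \ T)
    refine .seq_op (b + enc {u}) (by simp [hF.reg rPre rfl, hpre]) (by omega) ?_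
    refine .seq_load (b + enc {u}) (enc (preds A u)) (by simp) (by simp [hF.mem rfl, hg.pre])
      (by omega) (by omega) ?_
    refine .seq_op (enc (preds A u ∩ X)) (by simp [hF.reg rX rfl, hX, enc_and]) (by omega) ?_
    refine .seq_op (enc (preds A u ∩ X ∩ T)) (by simp [hI.rA, enc_and]) (by omega) ?_
    refine .seq_op (enc ((preds A u ∩ X) \ T)) (by simp [← enc_sub_inter]) (by omega) ?_
    refine (tryPreds_run (A := A) (σ := σ) (X := X) (b := b) (S₀ := S₀) (P := insert u P)
      (M := (preds A u ∩ X) \ T) (T := T) (u := u) hS hW ?_ ?_ ?_ ?_ ?_ ?_ ?_ ?_).mono ?_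
    · simpa [hF.mem rfl] using hg
    · simpa [hF.reg rX rfl] using hX
    · simpa [hF.reg rOwn rfl] using hown
    · simpa [hF.reg rSuc rfl] using hsuc
    · refine ⟨by simp [hI.rA], ?_, hI.start, hI.le, Finset.insert_subset hu.1 hI.done,
        Finset.sdiff_subset_sdiff Finset.inter_subset_right subset_rfl, hI.seq, ?_⟩
      · simp [Finset.sdiff_insert]
      · intro p hp hpT hpM
        refine (hI.unattracted p hp hpT (by simp)).insert fun hpu => hpM ?_
        simp [hp, hpT, hpu]
    · simp
    · simp
    · exact Finset.sdiff_subset.trans Finset.inter_subset_left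
    · rintro t s' ⟨ht, T', hI'⟩ -
      refine ⟨insert u P, ⟨T', hI'⟩, ?_⟩
      have hc : ((preds A u ∩ X) \ T).card ≤ (preds A u).card :=
        Finset.card_le_card (Finset.sdiff_subset.trans Finset.inter_subset_left)
      have hsum := Finset.add_sum_erase Pᶜ (fun u => 12 + 14 * (preds A u).card)
        (Finset.mem_compl.2 hu.2)
      rw [Finset.compl_insert]
      omega
  · rintro P t s' ⟨T, hI⟩ - hb ht
    simp only [Test.Holds, Operand.eval, hI.rQ, enc_pos, Finset.not_nonempty_iff_eq_empty,
      Finset.sdiff_eq_empty_iff_subset] at hb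
    have hPT := Finset.Subset.antisymm hb hI.done
    subst hPT
    constructor
    · have h1 := sum_card_preds A
      have h2 := le_card_edges A
      simp only [Finset.compl_empty, Finset.sum_add_distrib, ← Finset.mul_sum, h1, Finset.sum_const,
        Finset.card_univ, Fintype.card_fin, smul_eq_mul] at ht
      omega
    · refine ⟨T, hI.rA, hI.start, hI.le, hI.seq, fun p hp hpT => ?_, fun p hp hpT => ?_⟩
      · exact (hI.unattracted p hp hpT (by simp)).own
      · exact (hI.unattracted p hp hpT (by simp)).opp

end

/-! ### The table of the winning pairs -/

section

variable {n : ℕ} {S W : ℕ}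

open Program Operand Test

/-- The current vertex; while the edges are read, the target of an edge. -/
abbrev rV : ℕ := 19
/-- The vertices that remain to be treated. -/
abbrev rL : ℕ := 20
/-- An accumulator. -/
abbrev rAcc : ℕ := 21

/-- The register with the set of the vertices of player `σ`. -/
def rOwnOf (σ : Fin 2) : ℕ := rOwn0 + σ

/-- The register with the base address of the table of the regions won by player `σ`. -/
def rWinOf (σ : Fin 2) : ℕ := rWin0 + σ

/-- The contents of the registers that remain constant after the initialization: parameters of the
arena `A`, and the base addresses of five tables of `2ⁿ` words each, from the address `b` on. -/
structure Env (A : Arena (Fin n)) (b : ℕ) (s : State) : Prop where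
  rN : s.reg rN = 2 ^ n
  rFull : s.reg rFull = enc (Finset.univ : Finset (Fin n))
  rPre : s.reg rPre = b
  rSuc : s.reg rSuc = b + 2 ^ n
  rPairs : s.reg rPairs = b + 2 * 2 ^ n
  rOwn : ∀ σ, s.reg (rOwnOf σ) = enc (owned A σ)
  rWin : ∀ σ : Fin 2, s.reg (rWinOf σ) = b + (3 + σ) * 2 ^ n

theorem Env.congr {A : Arena (Fin n)} {b : ℕ} {s s' : State} (h : Env A b s)
    (h' : ∀ r < 9, s'.reg r = s.reg r) : Env A b s' := by
  refine ⟨?_, ?_, ?_, ?_, ?_, fun σ => ?_, fun σ => ?_⟩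
  · rw [h' _ (by decide), h.rN]
  · rw [h' _ (by decide), h.rFull]
  · rw [h' _ (by decide), h.rPre]
  · rw [h' _ (by decide), h.rSuc]
  · rw [h' _ (by decide), h.rPairs]
  · rw [h' _ (by simp only [rOwnOf, rOwn0]; omega), h.rOwn]
  · rw [h' _ (by simp only [rWinOf, rWin0]; omega), h.rWin]

theorem Env.frame {A : Arena (Fin n)} {b : ℕ} {s s' : State} (h : Env A b s) {p : Program}
    (hF : Frame p s s') (hp : ∀ r < 9, p.writes r = false) : Env A b s' :=
  h.congr fun r hr => hF.reg r (hp r hr)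

/-- The union of the `Uᵢ` with `Vᵢ = Z`. -/
def pairsAt (l : List (Finset (Fin n) × Finset (Fin n))) (Z : Finset (Fin n)) :
    Finset (Fin n) :=
  Finset.univ.filter fun a => ∃ p ∈ l, p.2 = Z ∧ a ∈ p.1

/-- The union of the `Uᵢ` with `Vᵢ ⊆ Z`. -/
def pairsBelow (l : List (Finset (Fin n) × Finset (Fin n))) (Z : Finset (Fin n)) :
    Finset (Fin n) :=
  Finset.univ.filter fun a => ∃ p ∈ l, p.2 ⊆ Z ∧ a ∈ p.1

/-- A proper subset of `Z` omits some element of `Z`. -/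
theorem mem_pairsBelow_iff (l : List (Finset (Fin n) × Finset (Fin n))) (Z : Finset (Fin n))
    (a : Fin n) : a ∈ pairsBelow l Z ↔ a ∈ pairsAt l Z ∨ ∃ v ∈ Z, a ∈ pairsBelow l (Z.erase v) := by
  simp only [pairsBelow, pairsAt, Finset.mem_filter, Finset.mem_univ, true_and]
  constructor
  · rintro ⟨p, hp, hpZ, ha⟩
    by_cases h : p.2 = Z
    · exact .inl ⟨p, hp, h, ha⟩
    · obtain ⟨v, hv, hvp⟩ := Finset.exists_of_ssubset (hpZ.ssubset_of_ne h)
      exact .inr ⟨v, hv, p, hp, Finset.subset_erase.2 ⟨hpZ, hvp⟩, ha⟩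
  · rintro (⟨p, hp, h, ha⟩ | ⟨v, hv, p, hp, h, ha⟩)
    · exact ⟨p, hp, h.le, ha⟩
    · exact ⟨p, hp, h.trans (Finset.erase_subset _ _), ha⟩

/-- The table of the pairs tells whether `X` satisfies the Rabin condition. -/
theorem pairsBelow_inter_nonempty (G : PairGame (Fin n)) (X : Finset (Fin n)) :
    (pairsBelow G.pairs Xᶜ ∩ X).Nonempty ↔ G.RabinCond X := by
  constructor
  · rintro ⟨a, ha⟩
    simp only [pairsBelow, Finset.mem_inter, Finset.mem_filter, Finset.mem_univ, true_and] at ha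
    obtain ⟨⟨p, hp, hpX, hap⟩, haX⟩ := ha
    refine ⟨p, hp, ⟨a, haX, hap⟩, Set.eq_empty_of_forall_notMem fun v hv => ?_⟩
    exact Finset.mem_compl.1 (hpX hv.2) hv.1
  · rintro ⟨p, hp, ⟨a, haX, hap⟩, h⟩
    refine ⟨a, ?_⟩
    simp only [pairsBelow, Finset.mem_inter, Finset.mem_filter, Finset.mem_univ, true_and]
    refine ⟨⟨p, hp, fun v hv => Finset.mem_compl.2 fun hvX => ?_, hap⟩, haX⟩
    have : v ∈ (X : Set (Fin n)) ∩ p.2 := ⟨hvX, hv⟩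
    rw [h] at this
    exact this

/-- Collects the entries of the table for `rX` without one of its elements. -/
def collectProg : Program :=
  loop (lt (const 0) (reg rL))
    (popBit rV rL ;; op rTmp .sub (reg rX) (reg rV) ;; op rTmp .add (reg rPairs) (reg rTmp) ;;
      load rTmp (reg rTmp) ;; op rAcc .or (reg rAcc) (reg rTmp))

/-- Turns the table of `pairsAt` into the table of `pairsBelow`, by increasing words. -/
def closeProg : Program :=
  loop (lt (reg rX) (reg rN))
    (op rTmp .add (reg rPairs) (reg rX) ;; load rAcc (reg rTmp) ;; op rL .add (reg rX) (const 0) ;;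
      collectProg ;; op rTmp .add (reg rPairs) (reg rX) ;; store (reg rTmp) (reg rAcc) ;;
      op rX .add (reg rX) (const 1))

variable {A : Arena (Fin n)} {b : ℕ} {l : List (Finset (Fin n) × Finset (Fin n))}

theorem collectProg_run {Z : Finset (Fin n)} {s : State} (hS : b + 5 * 2 ^ n ≤ S)
    (hW : b + 5 * 2 ^ n ≤ W) (hE : Env A b s) (hX : s.reg rX = enc Z) (hL : s.reg rL = enc Z)
    (hAcc : s.reg rAcc = enc (pairsAt l Z))
    (hm : ∀ v ∈ Z, s.mem (b + 2 * 2 ^ n + enc (Z.erase v)) = enc (pairsBelow l (Z.erase v))) :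
    Run S W collectProg s fun t s' =>
      t ≤ 9 * n + 1 ∧ s'.reg rAcc = enc (pairsBelow l Z) := by
  refine .loop (fun L s' => L ⊆ Z ∧ s'.reg rL = enc L ∧ ∃ D : Finset (Fin n), s'.reg rAcc = enc D ∧
      ∀ a, a ∈ D ↔ a ∈ pairsAt l Z ∨ ∃ v ∈ Z, v ∉ L ∧ a ∈ pairsBelow l (Z.erase v))
    (fun L => 9 * L.card) Z ⟨subset_rfl, hL, _, hAcc, fun a => ?_⟩ ?_ ?_
  · refine ⟨.inl, ?_⟩
    rintro (h | ⟨v, hv, hv', -⟩)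
    · exact h
    · exact (hv' hv).elim
  · rintro L s₁ ⟨hLZ, hL, D, hD, hDa⟩ hF hb
    simp only [Test.Holds, Operand.eval] at hb
    refine .seq (.popBit (by decide) (by omega) hL hb fun v hv => ?_)
    have hvZ := hLZ hv
    have h1 := enc_lt (Z.erase v)
    have h2 := enc_lt (pairsBelow l (Z.erase v))
    have h3 := enc_lt (D ∪ pairsBelow l (Z.erase v))
    refine .seq_op (enc (Z.erase v))
      (by simp [hF.reg rX rfl, hX, enc_sub_singleton hvZ]) (by omega) ?_
    refine .seq_op (b + 2 * 2 ^ n + enc (Z.erase v)) (by simp [hF.reg rPairs rfl, hE.rPairs])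
      (by omega) ?_
    refine .seq_load (b + 2 * 2 ^ n + enc (Z.erase v)) (enc (pairsBelow l (Z.erase v))) (by simp)
      (by simp [hF.mem rfl, hm v hvZ]) (by omega) (by omega) ?_
    refine .op (enc (D ∪ pairsBelow l (Z.erase v))) (by simp [hD, enc_or]) (by omega) ?_
    refine ⟨L.erase v, ⟨(Finset.erase_subset _ _).trans hLZ, by simp, _, by simp; rfl, ?_⟩, ?_⟩
    · intro a
      rw [Finset.mem_union, hDa]
      constructor
      · rintro ((h | ⟨u, hu, huL, h⟩) | h)
        · exact .inl h
        · exact .inr ⟨u, hu, fun h' => huL (Finset.mem_of_mem_erase h'), h⟩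
        · exact .inr ⟨v, hvZ, by simp, h⟩
      · rintro (h | ⟨u, hu, huL, h⟩)
        · exact .inl (.inl h)
        · by_cases huv : u = v
          · exact .inr (huv ▸ h)
          · exact .inl (.inr ⟨u, hu, fun h' => huL (Finset.mem_erase.2 ⟨huv, h'⟩), h⟩)
    · have := Finset.card_erase_add_one hv
      omega
  · rintro L t s' ⟨-, hL, D, hD, hDa⟩ - hb ht
    simp only [Test.Holds, Operand.eval, hL, enc_pos, Finset.not_nonempty_iff_eq_empty] at hb
    subst hb
    constructor
    · have := Finset.card_le_univ Z
      rw [Fintype.card_fin] at this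
      omega
    · rw [hD, enc_inj]
      ext a
      rw [hDa, mem_pairsBelow_iff]
      simp

theorem closeProg_run {s : State} (hS : b + 5 * 2 ^ n ≤ S)
    (hW : b + 5 * 2 ^ n ≤ W) (hE : Env A b s) (hX : s.reg rX = 0)
    (hm : ∀ Z, s.mem (b + 2 * 2 ^ n + enc Z) = enc (pairsAt l Z)) :
    Run S W closeProg s fun t s' => t ≤ 2 ^ n * (9 * n + 8) + 1 ∧
      (∀ Z, s'.mem (b + 2 * 2 ^ n + enc Z) = enc (pairsBelow l Z)) ∧
      ∀ a, (a < b + 2 * 2 ^ n ∨ b + 3 * 2 ^ n ≤ a) → s'.mem a = s.mem a := by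
  refine .loop (fun x s' => x ≤ 2 ^ n ∧ s'.reg rX = x ∧
      (∀ Z : Finset (Fin n), s'.mem (b + 2 * 2 ^ n + enc Z) =
        if enc Z < x then enc (pairsBelow l Z) else enc (pairsAt l Z)) ∧
      ∀ a, (a < b + 2 * 2 ^ n ∨ b + 3 * 2 ^ n ≤ a) → s'.mem a = s.mem a)
    (fun x => (2 ^ n - x) * (9 * n + 8)) 0 ⟨by simp, hX, by simp [hm], fun _ _ => rfl⟩ ?_ ?_
  · rintro x s₁ ⟨-, hx, hm, hm'⟩ hF hb
    have hE' := hE.frame hF (by decide)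
    simp only [Test.Holds, Operand.eval, hx, hE'.rN] at hb
    obtain ⟨Z, rfl⟩ := exists_enc hb
    have h1 := enc_lt (pairsAt l Z)
    have h2 := enc_lt (pairsBelow l Z)
    refine .seq_op (b + 2 * 2 ^ n + enc Z) (by simp [hE'.rPairs, hx]) (by omega) ?_
    refine .seq_load (b + 2 * 2 ^ n + enc Z) (enc (pairsAt l Z)) (by simp) (by simp [hm])
      (by omega) (by omega) ?_
    refine .seq_op (enc Z) (by simp [hx]) (by omega) ?_
    refine .seq_of (collectProg_run (A := A) (Z := Z) (l := l) hS hW ?_ ?_ ?_ ?_ ?_) ?_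
    · refine hE'.congr fun r hr => ?_
      have h1 : r ≠ rTmp := by simp only [rTmp]; omega
      have h2 : r ≠ rAcc := by simp only [rAcc]; omega
      have h3 : r ≠ rL := by simp only [rL]; omega
      simp [h1, h2, h3]
    · simp [hx]
    · simp
    · simp
    · intro v hv
      simp [hm, enc_lt_of_ssubset (Finset.erase_ssubset hv)]
    · rintro t s₂ ⟨ht, hacc⟩ hF₂
      have hX₂ : s₂.reg rX = enc Z := by rw [hF₂.reg rX rfl]; simp [hx]
      have hP₂ : s₂.reg rPairs = b + 2 * 2 ^ n := by rw [hF₂.reg rPairs rfl]; simp [hE'.rPairs]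
      have hm₂ : s₂.mem = s₁.mem := by rw [hF₂.mem rfl]; simp
      refine .seq_op (b + 2 * 2 ^ n + enc Z) (by simp [hX₂, hP₂]) (by omega) ?_
      refine .seq_store (b + 2 * 2 ^ n + enc Z) (enc (pairsBelow l Z)) (by simp) (by simp [hacc])
        (by omega) (by omega) ?_
      refine .op (enc Z + 1) (by simp [hX₂]) (by omega) ?_
      refine ⟨enc Z + 1, ⟨hb, by simp, fun Y => ?_, fun a ha => ?_⟩, ?_⟩
      · simp only [State.set_mem, State.put_mem, hm₂, hm, add_right_inj, enc_inj]
        by_cases hYZ : Y = Z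
        · subst hYZ
          simp
        · have : enc Y ≠ enc Z := fun h => hYZ (enc_inj.1 h)
          have h5 : enc Y < enc Z + 1 ↔ enc Y < enc Z := by omega
          simp [hYZ, h5]
      · simp only [State.set_mem, State.put_mem, hm₂]
        rw [if_neg (by omega), hm' a ha]
      · obtain ⟨d, hd⟩ : ∃ d, 2 ^ n - enc Z = d + 1 := ⟨2 ^ n - enc Z - 1, by omega⟩
        rw [hd, show 2 ^ n - (enc Z + 1) = d by omega, add_mul d 1]
        omega
  · rintro x t s' ⟨hx2, hx, hm, hm'⟩ hF hb ht
    have hE' := hE.frame hF (by decide)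
    simp only [Test.Holds, Operand.eval, hx, hE'.rN] at hb
    refine ⟨?_, fun Z => ?_, hm'⟩
    · rw [Nat.sub_zero] at ht
      exact le_trans (Nat.le_add_right _ _) ht
    · rw [hm, if_pos ((enc_lt Z).trans_le (by omega))]

end

/-! ### The recursion over all sets of vertices -/

section

variable {n : ℕ} {S W : ℕ}

open Program Operand Test

/-- The set of the vertices of the player who wins the plays that visit exactly `rX` infinitely
often. -/
abbrev rOwnS : ℕ := 22
/-- The set of the vertices of the opponent. -/
abbrev rOwnO : ℕ := 23
/-- The table of the regions won by the player of `rOwnS`. -/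
abbrev rWinS : ℕ := 24
/-- The table of the regions won by the opponent. -/
abbrev rWinO : ℕ := 25

/-- Sets the player of `rOwnS` to `σ`. -/
def setPlayers (σ : Fin 2) : Program :=
  op rOwnS .add (reg (rOwnOf σ)) (const 0) ;; op rOwnO .add (reg (rOwnOf (1 - σ))) (const 0) ;;
  op rWinS .add (reg (rWinOf σ)) (const 0) ;; op rWinO .add (reg (rWinOf (1 - σ))) (const 0)

/-- Determines the winner of the plays that visit exactly `rX` infinitely often, which is `α` if
`rX` satisfies the Rabin condition. -/
def winnerProg (α : Fin 2) : Program :=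
  op rTmp .sub (reg rFull) (reg rX) ;; op rTmp .add (reg rPairs) (reg rTmp) ;;
  load rTmp (reg rTmp) ;; op rTmp .and (reg rTmp) (reg rX) ;;
  branch (eq (reg rTmp) (const 0)) (setPlayers (1 - α)) (setPlayers α)

/-- Collects in `rAcc` the vertices that the opponent wins in the subgames of `rX` that avoid the
attractor of some vertex. -/
def searchProg : Program :=
  loop (lt (const 0) (reg rL))
    (popBit rV rL ;; op rA .add (reg rV) (const 0) ;; op rQ .add (reg rV) (const 0) ;;
      op rOwn .add (reg rOwnS) (const 0) ;; attrProg ;; op rTmp .sub (reg rX) (reg rA) ;;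
      op rTmp .add (reg rWinO) (reg rTmp) ;; load rTmp (reg rTmp) ;;
      op rAcc .or (reg rAcc) (reg rTmp))

/-- Attracts to `rAcc`, and adds the vertices that the opponent wins in the remaining subgame. If
`rAcc` is empty, then that subgame is `rX`, and its entry of the table is still `0`. -/
def extendProg : Program :=
  op rA .add (reg rAcc) (const 0) ;; op rQ .add (reg rAcc) (const 0) ;;
  op rOwn .add (reg rOwnO) (const 0) ;; attrProg ;; op rTmp .sub (reg rX) (reg rA) ;;
  op rTmp .add (reg rWinO) (reg rTmp) ;; load rTmp (reg rTmp) ;; op rA .or (reg rA) (reg rTmp)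

/-- Stores the regions won in `rX`. -/
def storeProg : Program :=
  op rTmp .add (reg rWinO) (reg rX) ;; store (reg rTmp) (reg rA) ;;
  op rA .sub (reg rX) (reg rA) ;; op rTmp .add (reg rWinS) (reg rX) ;;
  store (reg rTmp) (reg rA)

/-- Solves the subgames on all sets of vertices, by increasing words. -/
def solveProg (α : Fin 2) : Program :=
  loop (lt (reg rX) (reg rN))
    (winnerProg α ;; op rAcc .add (const 0) (const 0) ;; op rL .add (reg rX) (const 0) ;;
      searchProg ;; extendProg ;; storeProg ;; op rX .add (reg rX) (const 1))

theorem winnerProg_writes (α : Fin 2) : ∀ r < 9, (winnerProg α).writes r = false := by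
  decide +revert

theorem solveProg_writes (α : Fin 2) : ∀ r < 9, (solveProg α).writes r = false := by
  decide +revert

/-- The address of the region won by `σ` in the subgame on `Y`. -/
def winAddr (b : ℕ) (σ : Fin 2) (Y : Finset (Fin n)) : ℕ := b + (3 + σ) * 2 ^ n + enc Y

theorem winAddr_lt (b : ℕ) (σ : Fin 2) (Y : Finset (Fin n)) : winAddr b σ Y < b + 5 * 2 ^ n := by
  have := enc_lt Y
  have h : (σ : ℕ) = 0 ∨ (σ : ℕ) = 1 := by omega
  rcases h with h | h <;> simp only [winAddr, h] <;> omega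

theorem le_winAddr (b : ℕ) (σ : Fin 2) (Y : Finset (Fin n)) : b + 3 * 2 ^ n ≤ winAddr b σ Y := by
  have h : (σ : ℕ) = 0 ∨ (σ : ℕ) = 1 := by omega
  rcases h with h | h <;> simp only [winAddr, h] <;> omega

theorem winAddr_inj {b : ℕ} {σ τ : Fin 2} {Y Z : Finset (Fin n)} :
    winAddr b σ Y = winAddr b τ Z ↔ σ = τ ∧ Y = Z := by
  have hY := enc_lt Y
  have hZ := enc_lt Z
  constructor
  · intro h
    have h1 : σ = τ := by
      have hσ : (σ : ℕ) = 0 ∨ (σ : ℕ) = 1 := by omega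
      have hτ : (τ : ℕ) = 0 ∨ (τ : ℕ) = 1 := by omega
      rcases hσ with hσ | hσ <;> rcases hτ with hτ | hτ <;> simp only [winAddr, hσ, hτ] at h <;>
        omega
    subst h1
    exact ⟨rfl, enc_inj.1 (by simp only [winAddr] at h; omega)⟩
  · rintro ⟨rfl, rfl⟩
    rfl

variable {A : Arena (Fin n)} {b : ℕ} {Ω : Set (Fin n) → Prop}

theorem setPlayers_run {σ τ : Fin 2} (hστ : σ ≠ τ) {s : State} (hW : b + 5 * 2 ^ n ≤ W)
    (hE : Env A b s) :
    Run S W (setPlayers σ) s fun t s' => t = 4 ∧ s'.reg rOwnS = enc (owned A σ) ∧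
      s'.reg rOwnO = enc (owned A τ) ∧ s'.reg rWinS = b + (3 + σ) * 2 ^ n ∧
      s'.reg rWinO = b + (3 + τ) * 2 ^ n := by
  obtain rfl : τ = 1 - σ := by omega
  have h1 := enc_lt (owned A σ)
  have h2 := enc_lt (owned A (1 - σ))
  have h3 := fun σ => winAddr_lt b σ (∅ : Finset (Fin n))
  simp only [winAddr, enc_empty] at h3
  have h4 := h3 σ
  have h5 := h3 (1 - σ)
  have hne : ∀ σ, rOwnOf σ < 9 ∧ rWinOf σ < 9 := fun σ => by
    simp only [rOwnOf, rOwn0, rWinOf, rWin0]; omega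
  have hn : ∀ (σ : Fin 2) r, 9 ≤ r → rOwnOf σ ≠ r ∧ rWinOf σ ≠ r := fun σ r hr => by
    have := hne σ
    omega
  refine .seq_op (enc (owned A σ)) (by simp [hE.rOwn]) (by omega) ?_
  refine .seq_op (enc (owned A (1 - σ))) (by simp [hE.rOwn, hn _ 22]) (by omega) ?_
  refine .seq_op (b + (3 + σ) * 2 ^ n) (by simp [hE.rWin, hn _ 22, hn _ 23]) (by omega) ?_
  refine .op (b + (3 + (1 - σ : Fin 2)) * 2 ^ n)
    (by simp [hE.rWin, hn _ 22, hn _ 23, hn _ 24]) (by omega) ?_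
  simp

theorem winnerProg_run {α : Fin 2} {X D : Finset (Fin n)} {s : State}
    (hS : b + 5 * 2 ^ n ≤ S) (hW : b + 5 * 2 ^ n ≤ W) (hE : Env A b s) (hX : s.reg rX = enc X)
    (hD : s.mem (b + 2 * 2 ^ n + enc Xᶜ) = enc D) (hΩ : Good Ω α X ↔ (D ∩ X).Nonempty) :
    Run S W (winnerProg α) s fun t s' => t = 9 ∧ ∃ σ τ, σ ≠ τ ∧ Good Ω σ X ∧
      s'.reg rOwnS = enc (owned A σ) ∧ s'.reg rOwnO = enc (owned A τ) ∧
      s'.reg rWinS = b + (3 + σ) * 2 ^ n ∧ s'.reg rWinO = b + (3 + τ) * 2 ^ n := by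
  have h1 := enc_lt Xᶜ
  have h2 := enc_lt D
  have h3 := enc_lt (D ∩ X)
  have hne : 1 - α ≠ α := by omega
  have hE' : ∀ v, Env A b (s.set rTmp v) := fun v => hE.congr fun r hr => by
    have : r ≠ rTmp := by simp only [rTmp]; omega
    simp [this]
  refine .seq_op (enc Xᶜ)
    (by simp [hE.rFull, hX, enc_sub_of_subset, Finset.compl_eq_univ_sdiff]) (by omega) ?_
  refine .seq_op (b + 2 * 2 ^ n + enc Xᶜ) (by simp [hE.rPairs]) (by omega) ?_
  refine .seq_load (b + 2 * 2 ^ n + enc Xᶜ) (enc D) (by simp) (by simp [hD]) (by omega)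
    (by omega) ?_
  refine .seq_op (enc (D ∩ X)) (by simp [hX, enc_and]) (by omega) ?_
  simp only [State.set_set]
  refine .branch (fun hb => ?_) fun hb => ?_
  · refine (setPlayers_run (σ := 1 - α) (τ := α) hne hW (hE' _)).mono ?_
    rintro t s' ⟨ht, h⟩ -
    refine ⟨by omega, 1 - α, α, hne, ?_, h⟩
    simp only [Test.Holds, Operand.eval, State.set_reg, if_true, enc_eq_zero] at hb
    rw [hb] at hΩ
    have h2 : α = 0 ∨ α = 1 := by omega
    rcases h2 with rfl | rfl <;> simpa [Good] using hΩ
  · refine (setPlayers_run (σ := α) (τ := 1 - α) hne.symm hW (hE' _)).mono ?_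
    rintro t s' ⟨ht, h⟩ -
    refine ⟨by omega, α, 1 - α, hne.symm, hΩ.2 ?_, h⟩
    simp only [Test.Holds, Operand.eval, State.set_reg, if_true, enc_eq_zero] at hb
    exact Finset.nonempty_iff_ne_empty.2 hb

theorem searchProg_run {σ τ : Fin 2} {X : Finset (Fin n)} {s : State}
    {R : Finset (Fin n) → Fin 2 → Finset (Fin n)}
    (hS : b + 5 * 2 ^ n ≤ S) (hW : b + 5 * 2 ^ n ≤ W) (hE : Env A b s)
    (hg : GraphTables A b s.mem) (hR : ∀ Y σ, s.mem (winAddr b σ Y) = enc (R Y σ))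
    (hX : s.reg rX = enc X) (hL : s.reg rL = enc X) (hAcc : s.reg rAcc = 0)
    (hownS : s.reg rOwnS = enc (owned A σ)) (hwinO : s.reg rWinO = b + (3 + τ) * 2 ^ n) :
    Run S W searchProg s fun t s' => t ≤ n * (26 * A.edges.card + 13) + 1 ∧
      ∃ (T : Fin n → Finset (Fin n)) (D : Finset (Fin n)),
        (∀ v ∈ X, IsAttr A σ X {v} (T v)) ∧ s'.reg rAcc = enc D ∧
        ∀ a, a ∈ D ↔ ∃ v ∈ X, a ∈ R (X \ T v) τ := by
  refine .loop (fun L s' => L ⊆ X ∧ s'.reg rL = enc L ∧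
      ∃ (T : Fin n → Finset (Fin n)) (D : Finset (Fin n)),
        (∀ v ∈ X, v ∉ L → IsAttr A σ X {v} (T v)) ∧ s'.reg rAcc = enc D ∧
        ∀ a, a ∈ D ↔ ∃ v ∈ X, v ∉ L ∧ a ∈ R (X \ T v) τ)
    (fun L => L.card * (26 * A.edges.card + 13)) X
    ⟨subset_rfl, hL, fun _ => ∅, ∅, fun v hv hv' => (hv' hv).elim, by rw [hAcc, enc_empty],
      fun a => ?_⟩ ?_ ?_
  · simp only [Finset.notMem_empty, false_iff]
    rintro ⟨v, hv, hv', -⟩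
    exact hv' hv
  · rintro L s₁ ⟨hLX, hL, T, D, hT, hD, hDa⟩ hF hb
    simp only [Test.Holds, Operand.eval] at hb
    refine .seq (.popBit (by decide) (by omega) hL hb fun v hv => ?_)
    have hvX := hLX hv
    have h1 := enc_lt ({v} : Finset (Fin n))
    have h2 := enc_lt (owned A σ)
    refine .seq_op (enc {v}) (by simp) (by omega) ?_
    refine .seq_op (enc {v}) (by simp) (by omega) ?_
    refine .seq_op (enc (owned A σ)) (by simp [hF.reg rOwnS rfl, hownS]) (by omega) ?_
    refine .seq_of (attrProg_run (A := A) (σ := σ) (X := X) (b := b) (S₀ := {v}) (by omega)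
      (by omega) ?_ ?_ ?_ ?_ ?_ ?_ ?_ ?_) ?_
    · simpa [hF.mem rfl] using hg
    · simpa [hF.reg rX rfl] using hX
    · simp
    · simpa [hF.reg rPre rfl] using hE.rPre
    · simpa [hF.reg rSuc rfl] using hE.rSuc
    · simp
    · simp
    · simpa using hvX
    · rintro t s₂ ⟨ht, T', hA, hT'⟩ hF₂
      have hTX : T' ⊆ X := hT'.le
      have hX₂ : s₂.reg rX = enc X := by
        rw [hF₂.reg rX rfl]; simpa [hF.reg rX rfl] using hX
      have hw₂ : s₂.reg rWinO = b + (3 + τ) * 2 ^ n := by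
        rw [hF₂.reg rWinO rfl]; simpa [hF.reg rWinO rfl] using hwinO
      have hm₂ : s₂.mem = s.mem := by
        rw [hF₂.mem rfl]; simp [hF.mem rfl]
      have hacc₂ : s₂.reg rAcc = enc D := by
        rw [hF₂.reg rAcc rfl]; simp [hD]
      have hL₂ : s₂.reg rL = enc (L.erase v) := by
        rw [hF₂.reg rL rfl]; simp
      have h3 := enc_lt (X \ T')
      have h4 := winAddr_lt b τ (X \ T')
      have h5 := enc_lt (R (X \ T') τ)
      have h6 := enc_lt (D ∪ R (X \ T') τ)
      refine .seq_op (enc (X \ T')) (by simp [hX₂, hA, enc_sub_of_subset hTX]) (by omega) ?_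
      refine .seq_op (winAddr b τ (X \ T')) (by simp [hw₂, winAddr]) (by omega) ?_
      refine .seq_load (winAddr b τ (X \ T')) (enc (R (X \ T') τ)) (by simp) (by simp [hm₂, hR])
        (by omega) (by omega) ?_
      refine .op (enc (D ∪ R (X \ T') τ)) (by simp [hacc₂, enc_or]) (by omega) ?_
      refine ⟨L.erase v, ⟨(Finset.erase_subset _ _).trans hLX, by simp [hL₂],
        Function.update T v T', D ∪ R (X \ T') τ, fun u hu huL => ?_, by simp, fun a => ?_⟩, ?_⟩
      · by_cases huv : u = v
        · subst huv
          rw [Function.update_self, ← Finset.coe_singleton]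
          exact hT'
        · rw [Function.update_of_ne huv]
          exact hT u hu fun h => huL (Finset.mem_erase.2 ⟨huv, h⟩)
      · rw [Finset.mem_union, hDa]
        constructor
        · rintro (⟨u, hu, huL, h⟩ | h)
          · have huv : u ≠ v := fun e => huL (e ▸ hv)
            exact ⟨u, hu, fun h' => huL (Finset.mem_of_mem_erase h'),
              by rwa [Function.update_of_ne huv]⟩
          · exact ⟨v, hvX, by simp, by rwa [Function.update_self]⟩
        · rintro ⟨u, hu, huL, h⟩
          by_cases huv : u = v
          · subst huv
            rw [Function.update_self] at h
            exact .inr h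
          · rw [Function.update_of_ne huv] at h
            exact .inl ⟨u, hu, fun h' => huL (Finset.mem_erase.2 ⟨huv, h'⟩), h⟩
      · rw [← Finset.card_erase_add_one hv, add_mul]
        omega
  · rintro L t s' ⟨-, hL, T, D, hT, hD, hDa⟩ - hb ht
    simp only [Test.Holds, Operand.eval, hL, enc_pos, Finset.not_nonempty_iff_eq_empty] at hb
    subst hb
    refine ⟨?_, T, D, fun v hv => hT v hv (by simp), hD, by simpa using hDa⟩
    have h1 := Finset.card_le_univ X
    rw [Fintype.card_fin] at h1
    have h2 := Nat.mul_le_mul_right (26 * A.edges.card + 13) h1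
    omega

theorem extendProg_run {τ : Fin 2} {X D : Finset (Fin n)} {s : State}
    {R : Finset (Fin n) → Fin 2 → Finset (Fin n)}
    (hS : b + 5 * 2 ^ n ≤ S) (hW : b + 5 * 2 ^ n ≤ W) (hE : Env A b s)
    (hg : GraphTables A b s.mem) (hR : ∀ Y σ, s.mem (winAddr b σ Y) = enc (R Y σ))
    (hX : s.reg rX = enc X) (hAcc : s.reg rAcc = enc D) (hDX : D ⊆ X)
    (hownO : s.reg rOwnO = enc (owned A τ)) (hwinO : s.reg rWinO = b + (3 + τ) * 2 ^ n) :
    Run S W extendProg s fun t s' => t ≤ 26 * A.edges.card + 8 ∧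
      ∃ B : Finset (Fin n), IsAttr A τ X D B ∧ s'.reg rA = enc (B ∪ R (X \ B) τ) := by
  have h1 := enc_lt D
  have h2 := enc_lt (owned A τ)
  refine .seq_op (enc D) (by simp [hAcc]) (by omega) ?_
  refine .seq_op (enc D) (by simp [hAcc]) (by omega) ?_
  refine .seq_op (enc (owned A τ)) (by simp [hownO]) (by omega) ?_
  refine .seq_of (attrProg_run (A := A) (σ := τ) (X := X) (b := b) (S₀ := D) (by omega)
    (by omega) ?_ ?_ ?_ ?_ ?_ ?_ ?_ hDX) ?_
  · simpa using hg
  · simpa using hX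
  · simp
  · simpa using hE.rPre
  · simpa using hE.rSuc
  · simp
  · simp
  · rintro t s₂ ⟨ht, B, hA, hB⟩ hF₂
    have hBX : B ⊆ X := hB.le
    have hX₂ : s₂.reg rX = enc X := by rw [hF₂.reg rX rfl]; simpa using hX
    have hw₂ : s₂.reg rWinO = b + (3 + τ) * 2 ^ n := by
      rw [hF₂.reg rWinO rfl]; simpa using hwinO
    have hm₂ : s₂.mem = s.mem := by rw [hF₂.mem rfl]; simp
    have h3 := enc_lt (X \ B)
    have h4 := winAddr_lt b τ (X \ B)
    have h5 := enc_lt (R (X \ B) τ)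
    have h6 := enc_lt (B ∪ R (X \ B) τ)
    refine .seq_op (enc (X \ B)) (by simp [hX₂, hA, enc_sub_of_subset hBX]) (by omega) ?_
    refine .seq_op (winAddr b τ (X \ B)) (by simp [hw₂, winAddr]) (by omega) ?_
    refine .seq_load (winAddr b τ (X \ B)) (enc (R (X \ B) τ)) (by simp) (by simp [hm₂, hR])
      (by omega) (by omega) ?_
    refine .op (enc (B ∪ R (X \ B) τ)) (by simp [hA, enc_or]) (by omega) ?_
    exact ⟨by omega, B, hB, by simp⟩

theorem storeProg_run {σ τ : Fin 2} {X D : Finset (Fin n)} {s : State}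
    (hS : b + 5 * 2 ^ n ≤ S) (hW : b + 5 * 2 ^ n ≤ W) (hX : s.reg rX = enc X)
    (hA : s.reg rA = enc D) (hDX : D ⊆ X)
    (hwinS : s.reg rWinS = b + (3 + σ) * 2 ^ n) (hwinO : s.reg rWinO = b + (3 + τ) * 2 ^ n) :
    Run S W storeProg s fun t s' => t = 5 ∧ ∀ a, s'.mem a =
      if a = winAddr b σ X then enc (X \ D) else if a = winAddr b τ X then enc D else s.mem a := by
  have h1 := winAddr_lt b τ X
  have h2 := winAddr_lt b σ X
  have h3 := enc_lt D
  have h4 := enc_lt (X \ D)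
  refine .seq_op (winAddr b τ X) (by simp [hwinO, hX, winAddr]) (by omega) ?_
  refine .seq_store (winAddr b τ X) (enc D) (by simp) (by simp [hA]) (by omega) (by omega) ?_
  refine .seq_op (enc (X \ D)) (by simp [hX, hA, enc_sub_of_subset hDX]) (by omega) ?_
  refine .seq_op (winAddr b σ X) (by simp [hwinS, hX, winAddr]) (by omega) ?_
  refine .store (winAddr b σ X) (enc (X \ D)) (by simp) (by simp) (by omega) (by omega) ?_
  simp

/-- The tables of the winning regions are filled correctly, by strong induction on the words. For
sets that are not subarenas the entries are meaningless, but still partition the set. -/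
theorem solveProg_run {α : Fin 2} {s : State} {D : Finset (Fin n) → Finset (Fin n)}
    (hS : b + 5 * 2 ^ n ≤ S) (hW : b + 5 * 2 ^ n < W) (hE : Env A b s)
    (hg : GraphTables A b s.mem) (hD : ∀ Z, s.mem (b + 2 * 2 ^ n + enc Z) = enc (D Z))
    (hΩ : ∀ X : Finset (Fin n), Good Ω α X ↔ (D Xᶜ ∩ X).Nonempty)
    (hz : ∀ a, b + 3 * 2 ^ n ≤ a → s.mem a = 0) (hX : s.reg rX = 1) :
    Run S W (solveProg α) s fun t s' =>
      t ≤ 2 ^ n * ((n + 1) * (26 * A.edges.card + 13) + 27) + 1 ∧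
      ∃ R : Fin 2 → Finset (Fin n), (∀ σ, s'.mem (winAddr b σ (Finset.univ : Finset (Fin n))) =
        enc (R σ)) ∧ Solves A Ω Set.univ fun σ => (R σ : Set (Fin n)) := by
  have hN : 1 ≤ 2 ^ n := Nat.one_le_two_pow
  refine .loop (fun x s' => x ≤ 2 ^ n ∧ s'.reg rX = x ∧ (∀ a < b + 3 * 2 ^ n, s'.mem a = s.mem a) ∧
      ∃ R : Finset (Fin n) → Fin 2 → Finset (Fin n),
        (∀ Y σ, s'.mem (winAddr b σ Y) = enc (R Y σ)) ∧
        (∀ Y, enc Y < x → Solves A Ω Y fun σ => (R Y σ : Set (Fin n))) ∧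
        ∀ Y, x ≤ enc Y → ∀ σ, R Y σ = ∅)
    (fun x => (2 ^ n - x) * ((n + 1) * (26 * A.edges.card + 13) + 27)) 1
    ⟨hN, hX, fun _ _ => rfl, fun _ _ => ∅, fun Y σ => ?_, fun Y hY => ?_, fun _ _ _ => rfl⟩ ?_ ?_
  · rw [hz _ (le_winAddr b σ Y), enc_empty]
  · obtain rfl := enc_eq_zero.1 (show enc Y = 0 by omega)
    exact ⟨by simp, by simp, fun _ σ => by simpa using wins_empty⟩
  · rintro x s₁ ⟨-, hx, hm, R, hR, hRs, hR0⟩ hF hb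
    have hE₁ := hE.frame hF (solveProg_writes α)
    simp only [Test.Holds, Operand.eval, hx, hE₁.rN] at hb
    obtain ⟨X, rfl⟩ := exists_enc hb
    have h1 := enc_lt X
    have hD₁ : s₁.mem (b + 2 * 2 ^ n + enc Xᶜ) = enc (D Xᶜ) := by
      have := enc_lt Xᶜ
      rw [hm _ (by omega), hD]
    have hg₁ : GraphTables A b s₁.mem := by
      refine ⟨fun v => ?_, fun v => ?_⟩
      · have := enc_lt ({v} : Finset (Fin n))
        rw [hm _ (by omega), hg.pre]
      · have := enc_lt ({v} : Finset (Fin n))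
        rw [hm _ (by omega), hg.suc]
    refine .seq_of (winnerProg_run (A := A) (α := α) (X := X) (D := D Xᶜ) (Ω := Ω) hS hW.le hE₁ hx
      hD₁ (hΩ X)) ?_
    rintro t₁ s₂ ⟨ht₁, σ, τ, hστ, hgood, hownS, hownO, hwinS, hwinO⟩ hF₁
    have hX₂ : s₂.reg rX = enc X := by rw [hF₁.reg rX rfl, hx]
    have hm₂ : s₂.mem = s₁.mem := hF₁.mem rfl
    have hE₂ := hE₁.frame hF₁ (winnerProg_writes α)
    refine .seq_op 0 (by simp) (by omega) ?_
    refine .seq_op (enc X) (by simp [hX₂]) (by omega) ?_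
    refine .seq_of (searchProg_run (A := A) (σ := σ) (τ := τ) (X := X) (R := R) (b := b) hS hW.le
      ?_ ?_ ?_ ?_ ?_ ?_ ?_ ?_) ?_
    · refine hE₂.congr fun r hr => ?_
      have h2 : r ≠ rAcc := by simp only [rAcc]; omega
      have h3 : r ≠ rL := by simp only [rL]; omega
      simp [h2, h3]
    · simpa [hm₂] using hg₁
    · simpa [hm₂] using hR
    · simpa using hX₂
    · simp
    · simp
    · simpa using hownS
    · simpa using hwinO
    rintro t₂ s₃ ⟨ht₂, T, C, hT, hC, hCa⟩ hF₂
    have hX₃ : s₃.reg rX = enc X := by rw [hF₂.reg rX rfl]; simpa using hX₂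
    have hm₃ : s₃.mem = s₁.mem := by rw [hF₂.mem rfl]; simpa using hm₂
    have hwinS₃ : s₃.reg rWinS = b + (3 + σ) * 2 ^ n := by
      rw [hF₂.reg rWinS rfl]; simpa using hwinS
    have hwinO₃ : s₃.reg rWinO = b + (3 + τ) * 2 ^ n := by
      rw [hF₂.reg rWinO rfl]; simpa using hwinO
    have hlt : ∀ v ∈ X, enc (X \ T v) < enc X := by
      intro v hv
      have h2 : v ∈ (T v : Set (Fin n)) := (hT v hv).subset rfl
      refine enc_lt_of_ssubset (Finset.ssubset_iff_subset_ne.2 ⟨Finset.sdiff_subset, fun h => ?_⟩)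
      have h3 : v ∈ X \ T v := by rw [h]; exact hv
      exact (Finset.mem_sdiff.1 h3).2 h2
    have hCX : C ⊆ X := by
      intro a ha
      obtain ⟨v, hv, hav⟩ := (hCa a).1 ha
      have h2 : a ∈ ((X \ T v : Finset (Fin n)) : Set (Fin n)) :=
        (hRs _ (hlt v hv)).subset τ hav
      exact (Finset.mem_sdiff.1 h2).1
    refine .seq_of (extendProg_run (A := A) (τ := τ) (X := X) (D := C) (R := R) (b := b) hS hW.le
      ?_ ?_ ?_ hX₃ hC hCX ?_ hwinO₃) ?_
    · refine hE₂.congr fun r hr => ?_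
      rw [hF₂.reg r (by revert r; decide)]
      have h2 : r ≠ rAcc := by simp only [rAcc]; omega
      have h3 : r ≠ rL := by simp only [rL]; omega
      simp [h2, h3]
    · rwa [hm₃]
    · rwa [hm₃]
    · rw [hF₂.reg rOwnO rfl]; simpa using hownO
    rintro t₃ s₄ ⟨ht₃, B, hB, hA⟩ hF₃
    have hBX : B ⊆ X := hB.le
    have hX₄ : s₄.reg rX = enc X := by rw [hF₃.reg rX rfl, hX₃]
    have hm₄ : s₄.mem = s₁.mem := by rw [hF₃.mem rfl, hm₃]
    have hBlt : B ≠ ∅ → enc (X \ B) < enc X := by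
      intro h
      obtain ⟨v, hv⟩ := Finset.nonempty_iff_ne_empty.2 h
      refine enc_lt_of_ssubset (Finset.ssubset_iff_subset_ne.2 ⟨Finset.sdiff_subset, fun h => ?_⟩)
      have h3 : v ∈ X \ B := by rw [h]; exact hBX hv
      exact (Finset.mem_sdiff.1 h3).2 hv
    -- if nothing has been attracted, then the entry for `X` itself is read, which is still `0`
    have hB0 : B = ∅ → R (X \ B) τ = ∅ := by
      rintro rfl
      exact hR0 _ (by rw [Finset.sdiff_empty]) _
    have hrX : B ∪ R (X \ B) τ ⊆ X := by
      refine Finset.union_subset hBX ?_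
      by_cases h : B = ∅
      · rw [hB0 h]
        exact Finset.empty_subset _
      · have h2 : R (X \ B) τ ⊆ X \ B := (hRs _ (hBlt h)).subset τ
        exact h2.trans Finset.sdiff_subset
    refine .seq_of (storeProg_run (σ := σ) (τ := τ) (X := X) (D := B ∪ R (X \ B) τ) hS hW.le hX₄ hA
      hrX ?_ ?_) ?_
    · rw [hF₃.reg rWinS rfl, hwinS₃]
    · rw [hF₃.reg rWinO rfl, hwinO₃]
    rintro t₄ s₅ ⟨ht₄, hm₅⟩ hF₄
    have hX₅ : s₅.reg rX = enc X := by rw [hF₄.reg rX rfl, hX₄]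
    rw [hm₄] at hm₅
    refine .op (enc X + 1) (by simp [hX₅]) (by omega) ?_
    have hcases : ∀ ς : Fin 2, ς = σ ∨ ς = τ := by omega
    refine ⟨enc X + 1, ⟨hb, by simp, fun a ha => ?_, Function.update R X fun ς =>
      if ς = τ then B ∪ R (X \ B) τ else X \ (B ∪ R (X \ B) τ), fun Y ς => ?_, fun Y hY => ?_,
      fun Y hY ς => ?_⟩, ?_⟩
    · have h2 := le_winAddr b σ X
      have h3 := le_winAddr b τ X
      rw [State.set_mem, hm₅, if_neg (by omega), if_neg (by omega), hm a ha]
    · rw [State.set_mem, hm₅]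
      by_cases hYX : Y = X
      · subst hYX
        rcases hcases ς with rfl | rfl
        · simp [hστ]
        · simp [winAddr_inj, hστ.symm]
      · simp [winAddr_inj, hYX, hR]
    · by_cases hYX : Y = X
      · subst hYX
        simp only [Function.update_self]
        refine ⟨fun ς => ?_, fun v hv => ?_, fun hsub => ?_⟩
        · split_ifs
          · exact hrX
          · exact Finset.sdiff_subset
        · have h2 : (σ = 0 ∧ τ = 1) ∨ (σ = 1 ∧ τ = 0) := by omega
          have hv : v ∈ Y := hv
          by_cases hvr : v ∈ B ∪ R (Y \ B) τ <;> rcases h2 with ⟨rfl, rfl⟩ | ⟨rfl, rfl⟩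
          · exact .inr (by simpa using hvr)
          · exact .inl (by simpa using hvr)
          · exact .inl (by simpa [hv] using hvr)
          · exact .inr (by simpa [hv] using hvr)
        · have key := wins_step (Ω := Ω) hστ hsub hgood (T := fun v => (T v : Set (Fin n))) hT
            (r₁ := fun v ς => (R (Y \ T v) ς : Set (Fin n)))
            (fun v hv => by simpa using hRs _ (hlt v hv)) (W := C) (B := B) (Z := R (Y \ B) τ)
            (by ext a; simp [hCa]) hB (r₂ := fun ς => (R (Y \ B) ς : Set (Fin n)))
            (fun hne => ?_) (fun h0 => ?_) (fun _ => rfl)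
          · intro ς
            rcases hcases ς with rfl | rfl
            · simpa [hστ] using key.2
            · simpa using key.1
          · have h2 : B ≠ ∅ := by
              rintro rfl
              have h3 := hB.subset
              rw [Finset.coe_empty, Set.subset_empty_iff] at h3
              exact hne h3
            simpa using hRs _ (hBlt h2)
          · have h2 : B = ∅ := by
              have h3 := hB.seq
              rw [h0] at h3
              exact Finset.coe_eq_empty.1 (h3.eq_empty hsub)
            rw [hB0 h2, h2]
            simp
      · rw [Function.update_of_ne hYX]
        refine hRs Y ?_
        have : enc Y ≠ enc X := fun h => hYX (enc_inj.1 h)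
        omega
    · rw [Function.update_of_ne (by rintro rfl; omega)]
      exact hR0 Y (by omega) ς
    · obtain ⟨d, hd⟩ : ∃ d, 2 ^ n - enc X = d + 1 := ⟨2 ^ n - enc X - 1, by omega⟩
      rw [hd, show 2 ^ n - (enc X + 1) = d by omega, add_mul d 1, add_mul n 1]
      omega
  · rintro x t s' ⟨hx2, hx, hm, R, hR, hRs, -⟩ hF hb ht
    have hE' := hE.frame hF (solveProg_writes α)
    simp only [Test.Holds, Operand.eval, hx, hE'.rN] at hb
    refine ⟨?_, R Finset.univ, fun σ => hR _ σ, ?_⟩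
    · refine (Nat.le_add_right _ _).trans (ht.trans ?_)
      gcongr
      omega
    · simpa using hRs Finset.univ ((enc_lt _).trans_le (by omega))

end

/-! ### Reading the input -/

section

variable {n : ℕ} {S W : ℕ}

open Program Operand Test

/-- The number of vertices. -/
abbrev rNum : ℕ := 26
/-- The address at which the pairs start. -/
abbrev rE : ℕ := 27
/-- The number of pairs. -/
abbrev rK : ℕ := 28
/-- The address at which the input is read. -/
abbrev rPtr : ℕ := 29
/-- A counter. -/
abbrev rI : ℕ := 30
/-- The address at which the set that is read ends. -/
abbrev rEnd : ℕ := 31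

/-- Reads the numbers of vertices, edges and pairs. -/
def headProg : Program :=
  load rNum (const 0) ;; load rTmp (const 1) ;; load rK (const 2) ;;
  op rN .shl (const 1) (reg rNum) ;; op rFull .sub (reg rN) (const 1) ;;
  op rPtr .add (reg rNum) (const 3) ;; op rE .add (reg rTmp) (reg rTmp) ;;
  op rE .add (reg rPtr) (reg rE)

/-- Finds the end of the input, where the tables start. -/
def skipProg : Program :=
  loop (lt (const 0) (reg rI))
    (load rTmp (reg rPre) ;; op rPre .add (reg rPre) (reg rTmp) ;;
      op rPre .add (reg rPre) (const 1) ;; load rTmp (reg rPre) ;;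
      op rPre .add (reg rPre) (reg rTmp) ;; op rPre .add (reg rPre) (const 1) ;;
      op rI .sub (reg rI) (const 1))

/-- Computes the base addresses of the tables. -/
def baseProg : Program :=
  op rSuc .add (reg rPre) (reg rN) ;; op rPairs .add (reg rSuc) (reg rN) ;;
  op rWin0 .add (reg rPairs) (reg rN) ;; op rWin1 .add (reg rWin0) (reg rN)

/-- Reads the owners. -/
def ownerProg : Program :=
  loop (lt (reg rI) (reg rNum))
    (op rTmp .add (reg rI) (const 3) ;; load rTmp (reg rTmp) ;; op rTmp .shl (reg rTmp) (reg rI) ;;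
      op rOwn1 .or (reg rOwn1) (reg rTmp) ;; op rI .add (reg rI) (const 1))

/-- Reads the edges, and fills the tables of predecessors and successors. -/
def edgeProg : Program :=
  loop (lt (reg rPtr) (reg rE))
    (load rU (reg rPtr) ;; op rU .shl (const 1) (reg rU) ;; op rPtr .add (reg rPtr) (const 1) ;;
      load rV (reg rPtr) ;; op rV .shl (const 1) (reg rV) ;; op rPtr .add (reg rPtr) (const 1) ;;
      op rTmp .add (reg rPre) (reg rV) ;; load rTmp' (reg rTmp) ;;
      op rTmp' .or (reg rTmp') (reg rU) ;; store (reg rTmp) (reg rTmp') ;;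
      op rTmp .add (reg rSuc) (reg rU) ;; load rTmp' (reg rTmp) ;;
      op rTmp' .or (reg rTmp') (reg rV) ;; store (reg rTmp) (reg rTmp'))

/-- Reads a set into `rAcc`. -/
def readSet : Program :=
  load rTmp (reg rPtr) ;; op rPtr .add (reg rPtr) (const 1) ;; op rEnd .add (reg rPtr) (reg rTmp) ;;
  op rAcc .add (const 0) (const 0) ;;
  loop (lt (reg rPtr) (reg rEnd))
    (load rTmp (reg rPtr) ;; op rTmp .shl (const 1) (reg rTmp) ;;
      op rAcc .or (reg rAcc) (reg rTmp) ;; op rPtr .add (reg rPtr) (const 1))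

/-- Reads the pairs, and fills the table of `pairsAt`. -/
def pairProg : Program :=
  loop (lt (const 0) (reg rI))
    (readSet ;; op rU .add (reg rAcc) (const 0) ;; readSet ;;
      op rTmp .add (reg rPairs) (reg rAcc) ;; load rTmp' (reg rTmp) ;;
      op rTmp' .or (reg rTmp') (reg rU) ;; store (reg rTmp) (reg rTmp') ;;
      op rI .sub (reg rI) (const 1))

/-- The memory holds the list `l` from the address `a` on. -/
def MemList (m : ℕ → ℕ) : ℕ → List ℕ → Prop
  | _, [] => True
  | a, x :: l => m a = x ∧ MemList m (a + 1) l

theorem memList_append {m : ℕ → ℕ} {a : ℕ} {l l' : List ℕ} :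
    MemList m a (l ++ l') ↔ MemList m a l ∧ MemList m (a + l.length) l' := by
  induction l generalizing a with
  | nil => simp [MemList]
  | cons x l ih =>
    simp only [List.cons_append, MemList, ih, List.length_cons, and_assoc,
      show a + 1 + l.length = a + (l.length + 1) by omega]

theorem MemList.congr {m m' : ℕ → ℕ} {a : ℕ} {l : List ℕ} (h : MemList m a l)
    (h' : ∀ i < a + l.length, m' i = m i) : MemList m' a l := by
  induction l generalizing a with
  | nil => trivial
  | cons x l ih =>
    simp only [List.length_cons] at h'
    exact ⟨by rw [h' a (by omega), h.1], ih h.2 fun i hi => h' i (by omega)⟩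

theorem MemList.get {m : ℕ → ℕ} {a : ℕ} {l : List ℕ} (h : MemList m a l) (i : ℕ)
    (hi : i < l.length) : m (a + i) = l[i] := by
  induction l generalizing a i with
  | nil => simp at hi
  | cons x l ih =>
    cases i with
    | zero => exact h.1
    | succ i =>
      rw [show a + (i + 1) = a + 1 + i by omega]
      simpa using ih h.2 i (by simpa using hi)

theorem memList_initState (w : List ℕ) : MemList (initState w).mem 0 w := by
  have : ∀ l l' : List ℕ, MemList (initState (l ++ l')).mem l.length l' := by
    intro l l'
    induction l' generalizing l with
    | nil => trivial
    | cons x l' ih =>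
      refine ⟨by simp [initState], ?_⟩
      simpa using ih (l ++ [x])
  exact this [] w

/-- The encoding of a list of edges. -/
def edgeWords (es : List (Fin n × Fin n)) : List ℕ := es.flatMap fun e => [(e.1 : ℕ), (e.2 : ℕ)]

theorem edgeWords_cons (e : Fin n × Fin n) (es : List (Fin n × Fin n)) :
    edgeWords (e :: es) = (e.1 : ℕ) :: (e.2 : ℕ) :: edgeWords es := rfl

theorem length_edgeWords (es : List (Fin n × Fin n)) : (edgeWords es).length = 2 * es.length := by
  induction es with
  | nil => rfl
  | cons e es ih =>
    simp only [edgeWords_cons, List.length_cons, ih]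
    omega

/-- The encoding of a list of vertices, preceded by its length. -/
def setWords (l : List (Fin n)) : List ℕ := l.length :: l.map fun v => (v : ℕ)

theorem length_setWords (l : List (Fin n)) : (setWords l).length = l.length + 1 := by
  simp [setWords]

/-- The encoding of a list of pairs. -/
def pairWords (ps : List (List (Fin n) × List (Fin n))) : List ℕ :=
  ps.flatMap fun p => setWords p.1 ++ setWords p.2

theorem pairWords_cons (p : List (Fin n) × List (Fin n)) (ps : List (List (Fin n) × List (Fin n))) :
    pairWords (p :: ps) = setWords p.1 ++ (setWords p.2 ++ pairWords ps) := by
  simp [pairWords]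

theorem two_mul_length_le_pairWords (ps : List (List (Fin n) × List (Fin n))) :
    2 * ps.length ≤ (pairWords ps).length := by
  induction ps with
  | nil => simp
  | cons p ps ih =>
    simp only [pairWords_cons, List.length_append, length_setWords, List.length_cons]
    omega

theorem skipProg_run {ps : List (List (Fin n) × List (Fin n))} {b c : ℕ} {s : State}
    (hS : b ≤ S) (hW : b < W) (hPre : s.reg rPre = c) (hI : s.reg rI = ps.length)
    (hc : c + (pairWords ps).length = b) (hm : MemList s.mem c (pairWords ps)) :
    Run S W skipProg s fun t s' => t ≤ 8 * ps.length + 1 ∧ s'.reg rPre = b := by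
  refine .loop (fun ps s' => ∃ c, s'.reg rPre = c ∧ s'.reg rI = ps.length ∧
    c + (pairWords ps).length = b ∧ MemList s.mem c (pairWords ps)) (fun ps => 8 * ps.length) ps
    ⟨c, hPre, hI, hc, hm⟩ ?_ ?_
  · rintro ps s₁ ⟨c, hPre, hI, hc, hm⟩ hF hb
    have hm₁ := hF.mem rfl
    simp only [Test.Holds, Operand.eval, hI] at hb
    cases ps with
    | nil => simp at hb
    | cons p ps =>
      have h2 := two_mul_length_le_pairWords ps
      simp only [pairWords_cons, List.length_append, length_setWords] at hc
      simp only [pairWords_cons, memList_append, length_setWords] at hm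
      obtain ⟨⟨hp1, -⟩, ⟨hp2, -⟩, hm⟩ := hm
      refine .seq_load c p.1.length (by simp [hPre]) (by rw [hm₁, hp1]) (by omega) (by omega) ?_
      refine .seq_op (c + p.1.length) (by simp [hPre]) (by omega) ?_
      refine .seq_op (c + (p.1.length + 1)) (by simp [Nat.add_assoc]) (by omega) ?_
      refine .seq_load (c + (p.1.length + 1)) p.2.length (by simp) (by simp [hm₁, hp2])
        (by omega) (by omega) ?_
      refine .seq_op (c + (p.1.length + 1) + p.2.length) (by simp) (by omega) ?_
      refine .seq_op (c + (p.1.length + 1) + (p.2.length + 1)) (by simp [Nat.add_assoc])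
        (by omega) ?_
      refine .op ps.length (by simp [hI]) (by omega) ?_
      refine ⟨ps, ⟨_, by simp, by simp, by omega, hm⟩, ?_⟩
      simp only [List.length_cons]
      omega
  · rintro ps t s' ⟨c, hPre, hI, hc, -⟩ - hb ht
    simp only [Test.Holds, Operand.eval, hI, not_lt, nonpos_iff_eq_zero,
      List.length_eq_zero_iff] at hb
    subst hb
    simp only [pairWords, List.flatMap_nil, List.length_nil, Nat.add_zero] at hc
    exact ⟨by omega, by rw [hPre, hc]⟩

theorem ownerProg_run {A : Arena (Fin n)} {b : ℕ} {s : State} (hS : b ≤ S) (hn : n + 3 ≤ b)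
    (hW : b + 5 * 2 ^ n < W) (hNum : s.reg rNum = n) (hI : s.reg rI = 0)
    (hown : s.reg rOwn1 = 0) (hm : ∀ v : Fin n, s.mem (3 + v) = A.owner v) :
    Run S W ownerProg s fun t s' => t ≤ 6 * n + 1 ∧ s'.reg rOwn1 = enc (owned A 1) := by
  refine .loop (fun i s' => i ≤ n ∧ s'.reg rI = i ∧ ∃ D : Finset (Fin n), s'.reg rOwn1 = enc D ∧
    ∀ v, v ∈ D ↔ (v : ℕ) < i ∧ A.owner v = 1) (fun i => 6 * (n - i)) 0
    ⟨by simp, hI, ∅, by rw [hown, enc_empty], by simp⟩ ?_ ?_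
  · rintro i s₁ ⟨-, hi, D, hD, hDv⟩ hF hb
    have hNum₁ : s₁.reg rNum = n := by rw [hF.reg rNum rfl, hNum]
    simp only [Test.Holds, Operand.eval, hi, hNum₁] at hb
    obtain ⟨v, rfl⟩ : ∃ v : Fin n, i = v := ⟨⟨i, hb⟩, rfl⟩
    obtain ⟨E, hE, hEv⟩ : ∃ E : Finset (Fin n), (A.owner v : ℕ) <<< (v : ℕ) = enc E ∧
        ∀ u, u ∈ E ↔ u = v ∧ A.owner v = 1 := by
      have h : A.owner v = 0 ∨ A.owner v = 1 := by omega
      rcases h with h | h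
      · exact ⟨∅, by simp [h, enc_empty], by simp [h]⟩
      · exact ⟨{v}, by rw [← shiftLeft_eq_enc, h]; rfl, by simp [h]⟩
    have h1 := enc_lt E
    have h2 := enc_lt (D ∪ E)
    have h3 := hm v
    have h4 := (A.owner v).2
    refine .seq_op (3 + v) (by simp [hi, Nat.add_comm]) (by omega) ?_
    refine .seq_load (3 + v) (A.owner v) (by simp) (by simp [hF.mem rfl, h3]) (by omega)
      (by omega) ?_
    refine .seq_op (enc E) (by simp [hi, hE]) (by omega) ?_
    refine .seq_op (enc (D ∪ E)) (by simp [hD, enc_or]) (by omega) ?_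
    refine .op (v + 1) (by simp [hi]) (by omega) ?_
    refine ⟨v + 1, ⟨hb, by simp, D ∪ E, by simp, fun u => ?_⟩, by omega⟩
    rw [Finset.mem_union, hDv, hEv]
    constructor
    · rintro (⟨h, h'⟩ | ⟨rfl, h'⟩)
      · exact ⟨by omega, h'⟩
      · exact ⟨by omega, h'⟩
    · rintro ⟨h, h'⟩
      by_cases huv : u = v
      · subst huv
        exact .inr ⟨rfl, h'⟩
      · exact .inl ⟨by omega, h'⟩
  · rintro i t s' ⟨hin, hi, D, hD, hDv⟩ hF hb ht
    have hNum₁ : s'.reg rNum = n := by rw [hF.reg rNum rfl, hNum]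
    simp only [Test.Holds, Operand.eval, hi, hNum₁] at hb
    refine ⟨by omega, ?_⟩
    rw [hD, enc_inj]
    ext v
    rw [hDv, mem_owned]
    have : (v : ℕ) < i := by omega
    simp [this]

/-- The predecessors of `v` with respect to a list of edges. -/
def listPreds (es : List (Fin n × Fin n)) (v : Fin n) : Finset (Fin n) :=
  Finset.univ.filter fun u => (u, v) ∈ es

/-- The successors of `v` with respect to a list of edges. -/
def listSuccs (es : List (Fin n × Fin n)) (v : Fin n) : Finset (Fin n) :=
  Finset.univ.filter fun u => (v, u) ∈ es

theorem listPreds_append (es : List (Fin n × Fin n)) (e : Fin n × Fin n) (v : Fin n) :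
    listPreds (es ++ [e]) v = if v = e.2 then listPreds es v ∪ {e.1} else listPreds es v := by
  obtain ⟨a, c⟩ := e
  ext u
  split_ifs with h <;> simp [listPreds, h, or_comm]

theorem listSuccs_append (es : List (Fin n × Fin n)) (e : Fin n × Fin n) (v : Fin n) :
    listSuccs (es ++ [e]) v = if v = e.1 then listSuccs es v ∪ {e.2} else listSuccs es v := by
  obtain ⟨a, c⟩ := e
  ext u
  split_ifs with h <;> simp [listSuccs, h, or_comm]

theorem edgeProg_run {A : Arena (Fin n)} {b : ℕ} {s : State} {es : List (Fin n × Fin n)}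
    (hS : b + 5 * 2 ^ n ≤ S) (hW : b + 5 * 2 ^ n < W) (hn : n ≤ b) (hes : es.toFinset = A.edges)
    (hPre : s.reg rPre = b) (hSuc : s.reg rSuc = b + 2 ^ n)
    (hE : s.reg rE = s.reg rPtr + 2 * es.length) (hEb : s.reg rE ≤ b)
    (hm : MemList s.mem (s.reg rPtr) (edgeWords es)) (hz : ∀ a, b ≤ a → s.mem a = 0) :
    Run S W edgeProg s fun t s' => t ≤ 15 * es.length + 1 ∧ s'.reg rPtr = s.reg rE ∧
      GraphTables A b s'.mem ∧ (∀ a < b, s'.mem a = s.mem a) ∧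
      ∀ a, b + 2 * 2 ^ n ≤ a → s'.mem a = 0 := by
  -- the ghost data are the edges that remain to be read
  refine .loop (fun es' s' => s'.reg rPtr + 2 * es'.length = s.reg rE ∧
    MemList s'.mem (s'.reg rPtr) (edgeWords es') ∧ (∀ a < b, s'.mem a = s.mem a) ∧
    (∀ a, b + 2 * 2 ^ n ≤ a → s'.mem a = 0) ∧ ∃ es₀, es = es₀ ++ es' ∧
    (∀ v, s'.mem (b + enc {v}) = enc (listPreds es₀ v)) ∧
    ∀ v, s'.mem (b + 2 ^ n + enc {v}) = enc (listSuccs es₀ v)) (fun es' => 15 * es'.length) es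
    ⟨hE.symm, hm, fun _ _ => rfl, fun a ha => hz a (by omega), [], rfl, fun v => ?_, fun v => ?_⟩
    ?_ ?_
  · rw [hz _ (by omega)]
    simp [listPreds, enc_empty]
  · rw [hz _ (by omega)]
    simp [listSuccs, enc_empty]
  · rintro es' s₁ ⟨hlen, hm, hmb, hz, es₀, hes₀, hp, hs⟩ hF hb
    have hE₁ : s₁.reg rE = s.reg rE := hF.reg rE rfl
    have hPre₁ : s₁.reg rPre = b := by rw [hF.reg rPre rfl, hPre]
    have hSuc₁ : s₁.reg rSuc = b + 2 ^ n := by rw [hF.reg rSuc rfl, hSuc]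
    simp only [Test.Holds, Operand.eval, hE₁] at hb
    cases es' with
    | nil => simp only [List.length_nil] at hlen; omega
    | cons e es' =>
      obtain ⟨u, v⟩ := e
      simp only [List.length_cons] at hlen
      rw [edgeWords_cons] at hm
      obtain ⟨hu, hv, hm⟩ := hm
      generalize hc : s₁.reg rPtr = c at *
      have h1 := enc_lt ({u} : Finset (Fin n))
      have h2 := enc_lt ({v} : Finset (Fin n))
      have h3 := enc_lt (listPreds es₀ v)
      have h4 := enc_lt (listPreds es₀ v ∪ {u})
      have h5 := enc_lt (listSuccs es₀ u)
      have h6 := enc_lt (listSuccs es₀ u ∪ {v})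
      have hun := u.2
      have hvn := v.2
      simp only at hu hv
      refine .seq_load c u (by simp [hc]) hu (by omega) (by omega) ?_
      refine .seq_op (enc {u}) (by simp [shiftLeft_eq_enc]) (by omega) ?_
      refine .seq_op (c + 1) (by simp [hc]) (by omega) ?_
      refine .seq_load (c + 1) v (by simp) (by simp [hv]) (by omega) (by omega) ?_
      refine .seq_op (enc {v}) (by simp [shiftLeft_eq_enc]) (by omega) ?_
      refine .seq_op (c + 1 + 1) (by simp) (by omega) ?_
      refine .seq_op (b + enc {v}) (by simp [hPre₁]) (by omega) ?_
      refine .seq_load (b + enc {v}) (enc (listPreds es₀ v)) (by simp) (by simp [hp])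
        (by omega) (by omega) ?_
      refine .seq_op (enc (listPreds es₀ v ∪ {u})) (by simp [enc_or]) (by omega) ?_
      refine .seq_store (b + enc {v}) (enc (listPreds es₀ v ∪ {u})) (by simp) (by simp)
        (by omega) (by omega) ?_
      refine .seq_op (b + 2 ^ n + enc {u}) (by simp [hSuc₁]) (by omega) ?_
      refine .seq_load (b + 2 ^ n + enc {u}) (enc (listSuccs es₀ u)) (by simp)
        (by
          have : b + 2 ^ n + enc {u} ≠ b + enc {v} := by omega
          simp [hs, this]) (by omega) (by omega) ?_
      refine .seq_op (enc (listSuccs es₀ u ∪ {v})) (by simp [enc_or]) (by omega) ?_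
      refine .store (b + 2 ^ n + enc {u}) (enc (listSuccs es₀ u ∪ {v})) (by simp) (by simp)
        (by omega) (by omega) ?_
      have hb' : ∀ a < b, a ≠ b + 2 ^ n + enc {u} ∧ a ≠ b + enc {v} := fun a ha => by omega
      refine ⟨es', ⟨?_, ?_, fun a ha => ?_, fun a ha => ?_, es₀ ++ [(u, v)], by simp [hes₀],
        fun x => ?_, fun x => ?_⟩, ?_⟩
      · simp only [State.put_reg, State.set_reg]
        simp
        omega
      · simp only [State.put_reg, State.set_reg]
        simp only [if_true]
        refine hm.congr fun a ha => ?_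
        rw [length_edgeWords] at ha
        have := hb' a (by omega)
        simp [this]
      · have := hb' a ha
        simp [this, hmb a ha]
      · have h7 : a ≠ b + 2 ^ n + enc {u} := by omega
        have h8 : a ≠ b + enc {v} := by omega
        simp [h7, h8, hz a ha]
      · have := enc_lt ({x} : Finset (Fin n))
        have h7 : b + enc {x} ≠ b + 2 ^ n + enc {u} := by omega
        rw [listPreds_append]
        by_cases hx : x = v
        · subst hx
          simp [h7]
        · simp [h7, hx, enc_inj, hp]
      · have := enc_lt ({x} : Finset (Fin n))
        have h7 : b + 2 ^ n + enc {x} ≠ b + enc {v} := by omega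
        rw [listSuccs_append]
        by_cases hx : x = u
        · subst hx
          simp
        · simp [h7, hx, enc_inj, hs]
      · simp only [List.length_cons]
        omega
  · rintro es' t s' ⟨hlen, -, hmb, hz, es₀, hes₀, hp, hs⟩ hF hb ht
    simp only [Test.Holds, Operand.eval, hF.reg rE rfl] at hb
    have h0 : es'.length = 0 := by omega
    obtain rfl := List.length_eq_zero_iff.1 h0
    rw [List.append_nil] at hes₀
    subst hes₀
    refine ⟨by omega, by omega, ⟨fun v => ?_, fun v => ?_⟩, hmb, hz⟩
    · rw [hp]
      congr 1
      ext u
      simp [listPreds, mem_preds, ← hes]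
    · rw [hs]
      congr 1
      ext u
      simp [listSuccs, mem_succs, ← hes]

theorem readSet_run {b a : ℕ} {s : State} {l : List (Fin n)} (hS : b ≤ S)
    (hW : b + 5 * 2 ^ n < W) (hn : n ≤ b) (hPtr : s.reg rPtr = a) (hab : a + l.length + 1 ≤ b)
    (hm : MemList s.mem a (setWords l)) :
    Run S W readSet s fun t s' => t ≤ 5 * l.length + 5 ∧ s'.reg rPtr = a + (l.length + 1) ∧
      s'.reg rAcc = enc l.toFinset := by
  obtain ⟨hlen, hm⟩ := hm
  refine .seq_load a l.length (by simp [hPtr]) hlen (by omega) (by omega) ?_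
  refine .seq_op (a + 1) (by simp [hPtr]) (by omega) ?_
  refine .seq_op (a + 1 + l.length) (by simp) (by omega) ?_
  refine .seq_op 0 (by simp) (by omega) ?_
  refine .loop (fun l' s' => s'.reg rPtr + l'.length = a + 1 + l.length ∧
    MemList s.mem (s'.reg rPtr) (l'.map fun v => (v : ℕ)) ∧ ∃ l₀, l = l₀ ++ l' ∧
    s'.reg rAcc = enc l₀.toFinset) (fun l' => 5 * l'.length) l
    ⟨by simp, by simpa using hm, [], by simp [enc_empty]⟩ ?_ ?_
  · rintro l' s₁ ⟨hlen', hm, l₀, hl₀, hacc⟩ hF hb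
    have hEnd : s₁.reg rEnd = a + 1 + l.length := by rw [hF.reg rEnd rfl]; simp
    have hm₁ : s₁.mem = s.mem := by rw [hF.mem rfl]; simp
    simp only [Test.Holds, Operand.eval, hEnd] at hb
    cases l' with
    | nil => simp only [List.length_nil] at hlen'; omega
    | cons v l' =>
      obtain ⟨hv, hm⟩ := hm
      simp only [List.length_cons] at hlen'
      generalize hc : s₁.reg rPtr = c at *
      have h1 := enc_lt ({v} : Finset (Fin n))
      have h2 := enc_lt (l₀.toFinset ∪ {v})
      have hvn := v.2
      refine .seq_load c v (by simp [hc]) (by rw [hm₁, hv]) (by omega) (by omega) ?_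
      refine .seq_op (enc {v}) (by simp [shiftLeft_eq_enc]) (by omega) ?_
      refine .seq_op (enc (l₀.toFinset ∪ {v})) (by simp [hacc, enc_or]) (by omega) ?_
      refine .op (c + 1) (by simp [hc]) (by omega) ?_
      refine ⟨l', ⟨by simp; omega, ?_, l₀ ++ [v], by simp [hl₀], ?_⟩, ?_⟩
      · rw [State.set_reg, if_pos rfl]
        exact hm
      · simp [List.toFinset_append]
      · simp only [List.length_cons]
        omega
  · rintro l' t s' ⟨hlen', -, l₀, hl₀, hacc⟩ hF hb ht
    have hEnd : s'.reg rEnd = a + 1 + l.length := by rw [hF.reg rEnd rfl]; simp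
    simp only [Test.Holds, Operand.eval, hEnd] at hb
    have h0 : l'.length = 0 := by omega
    obtain rfl := List.length_eq_zero_iff.1 h0
    rw [List.append_nil] at hl₀
    subst hl₀
    exact ⟨by omega, by omega, hacc⟩

/-- The pairs of sets that are given by pairs of lists. -/
def toPairs (ps : List (List (Fin n) × List (Fin n))) : List (Finset (Fin n) × Finset (Fin n)) :=
  ps.map fun p => (p.1.toFinset, p.2.toFinset)

theorem pairsAt_append (l : List (Finset (Fin n) × Finset (Fin n)))
    (p : Finset (Fin n) × Finset (Fin n)) (Z : Finset (Fin n)) :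
    pairsAt (l ++ [p]) Z = if Z = p.2 then pairsAt l Z ∪ p.1 else pairsAt l Z := by
  ext a
  split_ifs with h
  · subst h
    simp [pairsAt, or_and_right, exists_or]
  · have h' : p.2 ≠ Z := fun e => h e.symm
    simp [pairsAt, or_and_right, exists_or, h']

theorem pairProg_run {b : ℕ} {s : State} {ps : List (List (Fin n) × List (Fin n))}
    (hS : b + 5 * 2 ^ n ≤ S) (hW : b + 5 * 2 ^ n < W) (hn : n ≤ b)
    (hnd : ∀ p ∈ ps, p.1.Nodup ∧ p.2.Nodup) (hP : s.reg rPairs = b + 2 * 2 ^ n)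
    (hI : s.reg rI = ps.length) (hb : s.reg rPtr + (pairWords ps).length = b)
    (hm : MemList s.mem (s.reg rPtr) (pairWords ps))
    (hz : ∀ a, b + 2 * 2 ^ n ≤ a → s.mem a = 0) :
    Run S W pairProg s fun t s' => t ≤ (10 * n + 17) * ps.length + 1 ∧
      (∀ Z, s'.mem (b + 2 * 2 ^ n + enc Z) = enc (pairsAt (toPairs ps) Z)) ∧
      ∀ a, (a < b + 2 * 2 ^ n ∨ b + 3 * 2 ^ n ≤ a) → s'.mem a = s.mem a := by
  -- the ghost data are the pairs that remain to be read
  refine .loop (fun ps' s' => s'.reg rI = ps'.length ∧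
    s'.reg rPtr + (pairWords ps').length = b ∧ MemList s.mem (s'.reg rPtr) (pairWords ps') ∧
    (∀ a, (a < b + 2 * 2 ^ n ∨ b + 3 * 2 ^ n ≤ a) → s'.mem a = s.mem a) ∧
    ∃ ps₀, ps = ps₀ ++ ps' ∧
      ∀ Z, s'.mem (b + 2 * 2 ^ n + enc Z) = enc (pairsAt (toPairs ps₀) Z))
    (fun ps' => (10 * n + 17) * ps'.length) ps
    ⟨hI, hb, hm, fun _ _ => rfl, [], rfl, fun Z => ?_⟩ ?_ ?_
  · rw [hz _ (by omega)]
    simp [toPairs, pairsAt, enc_empty]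
  · rintro ps' s₁ ⟨hI, hb, hm, hma, ps₀, hps₀, hpt⟩ hF ht
    simp only [Test.Holds, Operand.eval, hI] at ht
    cases ps' with
    | nil => simp at ht
    | cons p ps' =>
      have hpn := hnd p (by simp [hps₀])
      have hl1 : p.1.length ≤ n := by simpa using hpn.1.length_le_card
      have hl2 : p.2.length ≤ n := by simpa using hpn.2.length_le_card
      have h2 := two_mul_length_le_pairWords ps'
      simp only [pairWords_cons, List.length_append, length_setWords] at hb
      simp only [pairWords_cons, memList_append, length_setWords] at hm
      obtain ⟨hm1, hm2, hm⟩ := hm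
      have hP₁ : s₁.reg rPairs = b + 2 * 2 ^ n := by rw [hF.reg rPairs rfl, hP]
      generalize hc : s₁.reg rPtr = c at *
      have h3 := enc_lt p.1.toFinset
      have h4 := enc_lt p.2.toFinset
      have h5 := enc_lt (pairsAt (toPairs ps₀) p.2.toFinset)
      have h6 := enc_lt (pairsAt (toPairs ps₀) p.2.toFinset ∪ p.1.toFinset)
      refine .seq_of (readSet_run (l := p.1) (a := c) (b := b) (by omega) hW hn hc (by omega)
        (hm1.congr fun i hi => hma i ?_)) ?_
      · rw [length_setWords] at hi
        omega
      rintro t₁ s₂ ⟨ht₁, hptr₂, hacc₂⟩ hF₂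
      refine .seq_op (enc p.1.toFinset) (by simp [hacc₂]) (by omega) ?_
      refine .seq_of (readSet_run (l := p.2) (a := c + (p.1.length + 1)) (b := b) (by omega) hW hn
        (by simp [hptr₂]) (by omega) (hm2.congr fun i hi => ?_)) ?_
      · rw [length_setWords] at hi
        rw [State.set_mem, hF₂.mem rfl]
        exact hma i (by omega)
      rintro t₂ s₃ ⟨ht₂, hptr₃, hacc₃⟩ hF₃
      have hm₃ : s₃.mem = s₁.mem := by rw [hF₃.mem rfl, State.set_mem, hF₂.mem rfl]
      have hP₃ : s₃.reg rPairs = b + 2 * 2 ^ n := by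
        rw [hF₃.reg rPairs rfl]
        simp [hF₂.reg rPairs rfl, hP₁]
      have hU₃ : s₃.reg rU = enc p.1.toFinset := by
        rw [hF₃.reg rU rfl]
        simp
      have hI₃ : s₃.reg rI = ps'.length + 1 := by
        rw [hF₃.reg rI rfl]
        simp [hF₂.reg rI rfl, hI]
      refine .seq_op (b + 2 * 2 ^ n + enc p.2.toFinset) (by simp [hP₃, hacc₃]) (by omega) ?_
      refine .seq_load (b + 2 * 2 ^ n + enc p.2.toFinset)
        (enc (pairsAt (toPairs ps₀) p.2.toFinset)) (by simp) (by simp [hm₃, hpt])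
        (by omega) (by omega) ?_
      refine .seq_op (enc (pairsAt (toPairs ps₀) p.2.toFinset ∪ p.1.toFinset))
        (by simp [hU₃, enc_or]) (by omega) ?_
      refine .seq_store (b + 2 * 2 ^ n + enc p.2.toFinset)
        (enc (pairsAt (toPairs ps₀) p.2.toFinset ∪ p.1.toFinset)) (by simp) (by simp)
        (by omega) (by omega) ?_
      refine .op ps'.length (by simp [hI₃]) (by omega) ?_
      refine ⟨ps', ⟨by simp, ?_, ?_, fun a ha => ?_, ps₀ ++ [p], by simp [hps₀], fun Z => ?_⟩, ?_⟩
      · simp [hptr₃]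
        omega
      · simpa [hptr₃] using hm
      · have h7 : a ≠ b + 2 * 2 ^ n + enc p.2.toFinset := by omega
        simp [h7, hm₃, hma a ha]
      · rw [show toPairs (ps₀ ++ [p]) = toPairs ps₀ ++ [(p.1.toFinset, p.2.toFinset)] by
          simp [toPairs], pairsAt_append]
        by_cases hZ : Z = p.2.toFinset
        · subst hZ
          simp
        · simp [hZ, enc_inj, hm₃, hpt]
      · simp only [List.length_cons, mul_add]
        omega
  · rintro ps' t s' ⟨hI, hb, -, hma, ps₀, hps₀, hpt⟩ hF ht ht'
    simp only [Test.Holds, Operand.eval, hI, not_lt, nonpos_iff_eq_zero,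
      List.length_eq_zero_iff] at ht
    subst ht
    rw [List.append_nil] at hps₀
    subst hps₀
    exact ⟨by simpa using ht', hpt, hma⟩

end

/-! ### The decision procedure -/

section

variable {n : ℕ} {S W : ℕ}

open Program Operand Test

/-- Reads the input and fills the tables of the arena and of the pairs. -/
def initProg : Program :=
  headProg ;; op rPre .add (reg rE) (const 0) ;; op rI .add (reg rK) (const 0) ;; skipProg ;;
  baseProg ;; op rI .add (const 0) (const 0) ;; ownerProg ;;
  op rOwn0 .sub (reg rFull) (reg rOwn1) ;; edgeProg ;; op rI .add (reg rK) (const 0) ;; pairProg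

/-- Writes the bits of `rTmp` to the memory cells `0, …, n - 1`. -/
def outProg : Program :=
  loop (lt (reg rI) (reg rNum))
    (op rTmp' .and (reg rTmp) (const 1) ;; store (reg rI) (reg rTmp') ;;
      op rTmp .shr (reg rTmp) (const 1) ;; op rI .add (reg rI) (const 1))

/-- Decides the games in which player `α` wins the plays that satisfy the Rabin condition. -/
def gameProg (α : Fin 2) : Program :=
  initProg ;; op rX .add (const 0) (const 0) ;; closeProg ;; op rX .add (const 0) (const 1) ;;
  solveProg α ;; op rTmp .add (reg rWin1) (reg rFull) ;; load rTmp (reg rTmp) ;;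
  op rI .add (const 0) (const 0) ;; outProg

theorem headProg_run {s : State} {e k : ℕ} (hS : 3 ≤ S) (hn : 3 + n + 2 * e < W) (hN : 2 ^ n < W)
    (hk : k < W) (h0 : s.mem 0 = n) (h1 : s.mem 1 = e) (h2 : s.mem 2 = k) :
    Run S W headProg s fun t s' => t = 8 ∧ s'.reg rNum = n ∧ s'.reg rN = 2 ^ n ∧
      s'.reg rFull = enc (Finset.univ : Finset (Fin n)) ∧ s'.reg rPtr = 3 + n ∧
      s'.reg rE = 3 + n + 2 * e ∧ s'.reg rK = k := by
  refine .seq_load 0 n (by simp) h0 (by omega) (by omega) ?_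
  refine .seq_load 1 e (by simp) (by simp [h1]) (by omega) (by omega) ?_
  refine .seq_load 2 k (by simp) (by simp [h2]) (by omega) (by omega) ?_
  refine .seq_op (2 ^ n) (by simp [Nat.one_shiftLeft]) (by omega) ?_
  refine .seq_op (2 ^ n - 1) (by simp) (by omega) ?_
  refine .seq_op (3 + n) (by simp [Nat.add_comm]) (by omega) ?_
  refine .seq_op (2 * e) (by simp [two_mul]) (by omega) ?_
  refine .op (3 + n + 2 * e) (by simp) (by omega) ?_
  simp [enc_univ]

theorem baseProg_run {b : ℕ} {s : State} (hW : b + 5 * 2 ^ n < W) (hPre : s.reg rPre = b)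
    (hN : s.reg rN = 2 ^ n) :
    Run S W baseProg s fun t s' => t = 4 ∧ s'.reg rSuc = b + 2 ^ n ∧
      s'.reg rPairs = b + 2 * 2 ^ n ∧ s'.reg rWin0 = b + 3 * 2 ^ n ∧
      s'.reg rWin1 = b + 4 * 2 ^ n := by
  refine .seq_op (b + 2 ^ n) (by simp [hPre, hN]) (by omega) ?_
  refine .seq_op (b + 2 * 2 ^ n) (by simp [hN]; omega) (by omega) ?_
  refine .seq_op (b + 3 * 2 ^ n) (by simp [hN]; omega) (by omega) ?_
  refine .op (b + 4 * 2 ^ n) (by simp [hN]; omega) (by omega) ?_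
  simp

theorem initProg_run {A : Arena (Fin n)} {w : List ℕ} {es : List (Fin n × Fin n)}
    {ps : List (List (Fin n) × List (Fin n))}
    (hS : w.length + 5 * 2 ^ n ≤ S) (hW : w.length + 5 * 2 ^ n < W)
    (hes : es.toFinset = A.edges) (hnd : ∀ p ∈ ps, p.1.Nodup ∧ p.2.Nodup)
    (hw : w = [n, es.length, ps.length] ++ List.ofFn (fun v : Fin n => (A.owner v : ℕ)) ++
      edgeWords es ++ pairWords ps) :
    Run S W initProg (initState w) fun t s' =>
      t ≤ (10 * n + 25) * ps.length + 6 * n + 15 * es.length + 30 ∧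
      Env A w.length s' ∧ s'.reg rNum = n ∧ GraphTables A w.length s'.mem ∧
      (∀ Z, s'.mem (w.length + 2 * 2 ^ n + enc Z) = enc (pairsAt (toPairs ps) Z)) ∧
      ∀ a, w.length + 3 * 2 ^ n ≤ a → s'.mem a = 0 := by
  have hmem := memList_initState w
  have hz : ∀ a, w.length ≤ a → (initState w).mem a = 0 := fun a ha => by
    simp [initState, ha]
  have hlen : 3 + n + 2 * es.length + (pairWords ps).length = w.length := by
    rw [hw]
    simp only [List.length_append, length_edgeWords, List.length_ofFn, List.length_cons,
      List.length_nil]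
  have h2 := two_mul_length_le_pairWords ps
  have hN : 0 < 2 ^ n := by positivity
  generalize hb : w.length = b at *
  generalize hs : initState w = s at *
  rw [hw, memList_append, memList_append, memList_append] at hmem
  simp only [List.length_append, length_edgeWords, List.length_ofFn, List.length_cons,
    List.length_nil, Nat.zero_add] at hmem
  obtain ⟨⟨⟨⟨h0, h1, h2', -⟩, hmo⟩, hme⟩, hmp⟩ := hmem
  refine .seq_of (headProg_run (n := n) (e := es.length) (k := ps.length) (by omega) (by omega)
    (by omega) (by omega) h0 h1 h2') ?_
  rintro t₁ s₁ ⟨ht₁, hNum, hrN, hFull, hPtr, hE, hK⟩ hF₁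
  have hm₁ : s₁.mem = s.mem := hF₁.mem rfl
  have hO₁ : s₁.reg rOwn1 = 0 := by rw [hF₁.reg rOwn1 rfl, ← hs]; rfl
  refine .seq_op (3 + n + 2 * es.length) (by simp [hE]) (by omega) ?_
  refine .seq_op ps.length (by simp [hK]) (by omega) ?_
  refine .seq_of (skipProg_run (ps := ps) (b := b) (c := 3 + n + 2 * es.length) (by omega)
    (by omega) (by simp) (by simp) hlen (by simpa [hm₁] using hmp)) ?_
  rintro t₂ s₂ ⟨ht₂, hPre₂⟩ hF₂
  have hm₂ : s₂.mem = s.mem := by rw [hF₂.mem rfl]; simp [hm₁]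
  refine .seq_of (baseProg_run (n := n) (b := b) hW hPre₂ (by rw [hF₂.reg rN rfl]; simp [hrN])) ?_
  rintro t₃ s₃ ⟨ht₃, hSuc₃, hPairs₃, hWin0₃, hWin1₃⟩ hF₃
  have hm₃ : s₃.mem = s.mem := by rw [hF₃.mem rfl, hm₂]
  refine .seq_op 0 (by simp) (by omega) ?_
  refine .seq_of (ownerProg_run (A := A) (b := b) (by omega) (by omega) hW ?_ ?_ ?_ ?_) ?_
  · simp [hF₃.reg rNum rfl, hF₂.reg rNum rfl, hNum]
  · simp
  · simp [hF₃.reg rOwn1 rfl, hF₂.reg rOwn1 rfl, hO₁]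
  · intro v
    rw [State.set_mem, hm₃, hmo.get v (by simp)]
    simp
  rintro t₄ s₄ ⟨ht₄, hO₄⟩ hF₄
  have hm₄ : s₄.mem = s.mem := by rw [hF₄.mem rfl, State.set_mem, hm₃]
  have h3 := enc_lt (owned A 0)
  refine .seq_op (enc (owned A 0)) ?_ (by omega) ?_
  · have : owned A 0 = Finset.univ \ owned A 1 := by
      ext v
      simp only [mem_owned, Finset.mem_sdiff, Finset.mem_univ, true_and]
      omega
    simp [hF₄.reg rFull rfl, hF₃.reg rFull rfl, hF₂.reg rFull rfl, hFull, hO₄, this,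
      enc_sub_of_subset]
  have hPtr₄ : s₄.reg rPtr = 3 + n := by
    rw [hF₄.reg rPtr rfl]
    simp [hF₃.reg rPtr rfl, hF₂.reg rPtr rfl, hPtr]
  have hE₄ : s₄.reg rE = 3 + n + 2 * es.length := by
    rw [hF₄.reg rE rfl]
    simp [hF₃.reg rE rfl, hF₂.reg rE rfl, hE]
  refine .seq_of (edgeProg_run (A := A) (b := b) (es := es) hS hW (by omega) hes ?_ ?_ ?_ ?_ ?_
    ?_) ?_
  · simp [hF₄.reg rPre rfl, hF₃.reg rPre rfl, hPre₂]
  · simp [hF₄.reg rSuc rfl, hSuc₃]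
  · simp [hPtr₄, hE₄]
  · simp [hE₄]
    omega
  · simpa [hPtr₄, hm₄] using hme
  · simpa [hm₄] using hz
  rintro t₅ s₅ ⟨ht₅, hPtr₅, hg₅, hmb₅, hz₅⟩ hF₅
  have hPtr₅ : s₅.reg rPtr = 3 + n + 2 * es.length := by rw [hPtr₅]; simp [hE₄]
  have hmb₅ : ∀ a < b, s₅.mem a = s.mem a := fun a ha => by rw [hmb₅ a ha, State.set_mem, hm₄]
  refine .seq_op ps.length ?_ (by omega) ?_
  · simp [hF₅.reg rK rfl, hF₄.reg rK rfl, hF₃.reg rK rfl, hF₂.reg rK rfl, hK]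
  refine (pairProg_run (ps := ps) (b := b) hS hW (by omega) hnd ?_ ?_ ?_ ?_ ?_).mono ?_
  · simp [hF₅.reg rPairs rfl, hF₄.reg rPairs rfl, hPairs₃]
  · simp
  · simpa [hPtr₅] using hlen
  · have : MemList s₅.mem (3 + n + 2 * es.length) (pairWords ps) :=
      MemList.congr (m := s.mem) (by simpa using hmp) fun i hi => hmb₅ i (by omega)
    simpa [hPtr₅] using this
  · simpa using hz₅
  rintro t₆ s₆ ⟨ht₆, hpt, hm₆⟩ hF₆
  refine ⟨?_, ⟨?_, ?_, ?_, ?_, ?_, ?_, ?_⟩, ?_, ⟨?_, ?_⟩, hpt, ?_⟩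
  · rw [add_mul] at ht₆ ⊢
    omega
  · simp [hF₆.reg rN rfl, hF₅.reg rN rfl, hF₄.reg rN rfl, hF₃.reg rN rfl, hF₂.reg rN rfl, hrN]
  · simp [hF₆.reg rFull rfl, hF₅.reg rFull rfl, hF₄.reg rFull rfl, hF₃.reg rFull rfl,
      hF₂.reg rFull rfl, hFull]
  · simp [hF₆.reg rPre rfl, hF₅.reg rPre rfl, hF₄.reg rPre rfl, hF₃.reg rPre rfl, hPre₂]
  · simp [hF₆.reg rSuc rfl, hF₅.reg rSuc rfl, hF₄.reg rSuc rfl, hSuc₃]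
  · simp [hF₆.reg rPairs rfl, hF₅.reg rPairs rfl, hF₄.reg rPairs rfl, hPairs₃]
  · intro σ
    have h : σ = 0 ∨ σ = 1 := by omega
    rcases h with rfl | rfl
    · rw [show rOwnOf 0 = rOwn0 from rfl]
      simp [hF₆.reg rOwn0 rfl, hF₅.reg rOwn0 rfl]
    · rw [show rOwnOf 1 = rOwn1 from rfl]
      simp [hF₆.reg rOwn1 rfl, hF₅.reg rOwn1 rfl, hO₄]
  · intro σ
    have h : σ = 0 ∨ σ = 1 := by omega
    rcases h with rfl | rfl
    · rw [show rWinOf 0 = rWin0 from rfl]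
      simp [hF₆.reg rWin0 rfl, hF₅.reg rWin0 rfl, hF₄.reg rWin0 rfl, hWin0₃]
    · rw [show rWinOf 1 = rWin1 from rfl]
      simp [hF₆.reg rWin1 rfl, hF₅.reg rWin1 rfl, hF₄.reg rWin1 rfl, hWin1₃]
  · simp [hF₆.reg rNum rfl, hF₅.reg rNum rfl, hF₄.reg rNum rfl, hF₃.reg rNum rfl,
      hF₂.reg rNum rfl, hNum]
  · intro v
    have := enc_lt ({v} : Finset (Fin n))
    rw [hm₆ _ (by omega), State.set_mem, hg₅.pre]
  · intro v
    have := enc_lt ({v} : Finset (Fin n))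
    rw [hm₆ _ (by omega), State.set_mem, hg₅.suc]
  · intro a ha
    rw [hm₆ _ (by omega), State.set_mem, hz₅ a (by omega)]

theorem outProg_run {D : Finset (Fin n)} {s : State} (hS : n ≤ S) (hW : 2 ^ n < W)
    (hNum : s.reg rNum = n) (hI : s.reg rI = 0) (hT : s.reg rTmp = enc D) :
    Run S W outProg s fun t s' => t ≤ 5 * n + 1 ∧
      ∀ v : Fin n, s'.mem v = if v ∈ D then 1 else 0 := by
  have hnN : n < 2 ^ n := Nat.lt_two_pow_self
  refine .loop (fun i s' => i ≤ n ∧ s'.reg rI = i ∧ s'.reg rTmp = enc D >>> i ∧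
    ∀ v : Fin n, (v : ℕ) < i → s'.mem v = if v ∈ D then 1 else 0) (fun i => 5 * (n - i)) 0
    ⟨by simp, hI, by simpa using hT, by simp⟩ ?_ ?_
  · rintro i s₁ ⟨-, hi, hT, hm⟩ hF hb
    simp only [Test.Holds, Operand.eval, hi, hF.reg rNum rfl, hNum] at hb
    obtain ⟨v, rfl⟩ : ∃ v : Fin n, i = v := ⟨⟨i, hb⟩, rfl⟩
    have hbit : (enc D >>> (v : ℕ)) &&& 1 = if v ∈ D then 1 else 0 := by
      rw [Nat.and_one_is_mod, Nat.shiftRight_eq_div_pow, ← Nat.toNat_testBit, testBit_enc_val]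
      by_cases h : v ∈ D <;> simp [h]
    have h1 : (if v ∈ D then 1 else 0) < 2 := by split_ifs <;> omega
    have h2 : enc D >>> ((v : ℕ) + 1) < 2 ^ n :=
      (Nat.shiftRight_le _ _).trans_lt (enc_lt D)
    refine .seq_op (if v ∈ D then 1 else 0) (by simp [hT, hbit]) (by omega) ?_
    refine .seq_store v (if v ∈ D then 1 else 0) (by simp [hi]) (by simp) (by omega) (by omega) ?_
    refine .seq_op (enc D >>> ((v : ℕ) + 1)) (by simp [hT, Nat.shiftRight_add]) (by omega) ?_
    refine .op (v + 1) (by simp [hi]) (by omega) ?_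
    refine ⟨v + 1, ⟨hb, by simp, by simp, fun u hu => ?_⟩, by omega⟩
    by_cases huv : u = v
    · subst huv
      simp
    · have : (u : ℕ) ≠ v := fun h => huv (Fin.ext h)
      simp [this, hm u (by omega)]
  · rintro i t s' ⟨hin, hi, hT, hm⟩ hF hb ht
    simp only [Test.Holds, Operand.eval, hi, hF.reg rNum rfl, hNum] at hb
    exact ⟨by omega, fun v => hm v (by omega)⟩

/-- Correctness of the decision procedure, with an explicit bound on its number of steps. -/
theorem gameProg_run {α : Fin 2} {G : PairGame (Fin n)} {Ω : Set (Fin n) → Prop}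
    (hΩ : ∀ X, Good Ω α X ↔ G.RabinCond X) {w : List ℕ} {es : List (Fin n × Fin n)}
    {ps : List (List (Fin n) × List (Fin n))}
    (hS : w.length + 5 * 2 ^ n ≤ S) (hW : w.length + 5 * 2 ^ n < W)
    (hes : es.toFinset = G.arena.edges) (hnd : ∀ p ∈ ps, p.1.Nodup ∧ p.2.Nodup)
    (hps : toPairs ps = G.pairs)
    (hw : w = [n, es.length, ps.length] ++ List.ofFn (fun v : Fin n => (G.arena.owner v : ℕ)) ++
      edgeWords es ++ pairWords ps) :
    Run S W (gameProg α) (initState w) fun t s =>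
      t ≤ (10 * n + 25) * ps.length + 11 * n + 15 * es.length + 50 + 2 ^ n * (9 * n + 8) +
        2 ^ n * ((n + 1) * (26 * G.arena.edges.card + 13) + 27) ∧
      ∀ v : Fin n, ∃ σ : Fin 2, s.mem (v : ℕ) = (σ : ℕ) ∧
        ∀ τ : Fin 2, v ∈ G.arena.winRegion Ω τ ↔ τ = σ := by
  have hN : 1 ≤ 2 ^ n := Nat.one_le_two_pow
  have hnN : n < 2 ^ n := Nat.lt_two_pow_self
  refine .seq_of (initProg_run hS hW hes hnd hw) ?_
  rintro t₁ s₁ ⟨ht₁, hE₁, hNum₁, hg₁, hp₁, hz₁⟩ hF₁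
  generalize w.length = b at *
  have hX : ∀ {s : State} v, Env G.arena b s → Env G.arena b (s.set rX v) := fun v h =>
    h.congr fun r hr => by
      have : r ≠ rX := by simp only [rX]; omega
      simp [this]
  refine .seq_op 0 (by simp) (by omega) ?_
  refine .seq_of (closeProg_run (A := G.arena) (l := G.pairs) hS hW.le (hX _ hE₁) (by simp)
    (fun Z => by simp [hp₁, hps])) ?_
  rintro t₂ s₂ ⟨ht₂, hp₂, hm₂⟩ hF₂
  have hE₂ : Env G.arena b s₂ := (hX _ hE₁).frame hF₂ (by decide)
  refine .seq_op 1 (by simp) (by omega) ?_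
  refine .seq_of (solveProg_run (A := G.arena) (Ω := Ω) (D := pairsBelow G.pairs) hS hW (hX _ hE₂)
    ?_ (fun Z => by simp [hp₂]) (fun X => ?_) (fun a ha => ?_) (by simp)) ?_
  · refine ⟨fun v => ?_, fun v => ?_⟩
    · have := enc_lt ({v} : Finset (Fin n))
      rw [State.set_mem, hm₂ _ (by omega), State.set_mem, hg₁.pre]
    · have := enc_lt ({v} : Finset (Fin n))
      rw [State.set_mem, hm₂ _ (by omega), State.set_mem, hg₁.suc]
  · rw [hΩ, pairsBelow_inter_nonempty]
  · rw [State.set_mem, hm₂ _ (by omega), State.set_mem, hz₁ a ha]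
  rintro t₃ s₃ ⟨ht₃, R, hR, hsol⟩ hF₃
  have hE₃ : Env G.arena b s₃ := (hX _ hE₂).frame hF₃ (solveProg_writes α)
  have h1 := winAddr_lt b 1 (Finset.univ : Finset (Fin n))
  have h2 := enc_lt (R 1)
  refine .seq_op (winAddr b 1 (Finset.univ : Finset (Fin n))) ?_ (by omega) ?_
  · have := hE₃.rWin 1
    rw [show rWinOf 1 = rWin1 from rfl] at this
    simp [this, hE₃.rFull, winAddr]
  refine .seq_load (winAddr b 1 (Finset.univ : Finset (Fin n))) (enc (R 1)) (by simp)
    (by simp [hR]) (by omega) (by omega) ?_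
  refine .seq_op 0 (by simp) (by omega) ?_
  refine (outProg_run (D := R 1) (by omega) (by omega) ?_ (by simp) (by simp)).mono ?_
  · simp [hF₃.reg rNum rfl, hF₂.reg rNum rfl, hNum₁]
  rintro t₄ s₄ ⟨ht₄, hout⟩ -
  refine ⟨by omega, fun v => ?_⟩
  by_cases hv : v ∈ R 1
  · exact ⟨1, by simp [hout, hv], hsol.mem_winRegion_iff hv⟩
  · refine ⟨0, by simp [hout, hv], hsol.mem_winRegion_iff ?_⟩
    rcases hsol.cover (Set.mem_univ v) with h | h
    · exact h
    · exact (hv h).elim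

/-- The length of the encoding of the pairs is linear in their contribution to the size of the
game. -/
theorem length_pairWords_le (ps : List (List (Fin n) × List (Fin n)))
    (hnd : ∀ p ∈ ps, p.1.Nodup ∧ p.2.Nodup) :
    (pairWords ps).length ≤ 2 * ((toPairs ps).map fun p => 1 + p.1.card + p.2.card).sum := by
  induction ps with
  | nil => simp [pairWords]
  | cons p ps ih =>
    have h := hnd p (by simp)
    have := ih fun q hq => hnd q (by simp [hq])
    simp only [toPairs, List.map_cons, List.sum_cons, pairWords_cons, List.length_append,
      length_setWords, List.toFinset_card_of_nodup h.1, List.toFinset_card_of_nodup h.2] at this ⊢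
    omega

/-- The procedure meets the resource bounds, for either condition. The bounds on time and words use
that `1 ≤ n ≤ |E|`, so that `2 ^ n * |E| * n` dominates the lower terms, and that `2 ≤ |G|`, so that
the logarithm is positive. -/
theorem gameProg_decides (α : Fin 2) (Ω : ∀ {n : ℕ}, PairGame (Fin n) → Set (Fin n) → Prop)
    (hΩ : ∀ {n : ℕ} (G : PairGame (Fin n)) (X : Set (Fin n)), Good (Ω G) α X ↔ G.RabinCond X) :
    Decides (gameProg α) 500 Ω (fun n e k => (k * n + 2 ^ n * e) * n)
      (fun n g => g + 2 ^ n * n) := by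
  rintro n hn G w ⟨es, ps, hesn, hes, hnd, hps, hw⟩
  have he : es.length = G.arena.edges.card := by rw [← hes, List.toFinset_card_of_nodup hesn]
  have hk : ps.length = G.index := by rw [PairGame.index, ← hps, List.length_map]
  have hne := le_card_edges G.arena
  have hN : 1 ≤ 2 ^ n := Nat.one_le_two_pow
  have hlen : w.length ≤ 2 * G.size + 3 := by
    have h1 := length_pairWords_le ps hnd
    have h2 := length_edgeWords es
    rw [show toPairs ps = G.pairs from hps] at h1
    rw [hw]
    simp only [List.length_append, List.length_ofFn, List.length_cons, List.length_nil,
      PairGame.size, Fintype.card_fin]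
    simp only [edgeWords, pairWords, setWords] at h1 h2
    omega
  have hsize : 2 ≤ G.size := by
    simp only [PairGame.size, Fintype.card_fin]
    omega
  have hNn : 2 ^ n ≤ 2 ^ n * n := Nat.le_mul_of_pos_right _ hn
  have hword : w.length + 5 * 2 ^ n < 2 ^ (500 * (n + Nat.log 2 G.size)) := by
    have h1 : G.size < 2 * 2 ^ Nat.log 2 G.size := by
      have := Nat.lt_pow_succ_log_self (b := 2) one_lt_two G.size
      rw [pow_succ] at this
      omega
    generalize Nat.log 2 G.size = L at *
    have hL : 1 ≤ 2 ^ L := Nat.one_le_two_pow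
    have h2 : 2 ^ n ≤ 2 ^ n * 2 ^ L := Nat.le_mul_of_pos_right _ hL
    have h3 : 2 ^ L ≤ 2 ^ n * 2 ^ L := Nat.le_mul_of_pos_left _ hN
    have h4 : 2 ^ (n + L + 4) ≤ 2 ^ (500 * (n + L)) := Nat.pow_le_pow_right two_pos (by omega)
    have h5 : 2 ^ (n + L + 4) = 16 * (2 ^ n * 2 ^ L) := by ring
    omega
  obtain ⟨t, s, hexec, ht, hwin⟩ := gameProg_run (α := α) (G := G) (Ω := Ω G) (hΩ G)
    (S := 500 * (G.size + 2 ^ n * n)) (W := 2 ^ (500 * (n + Nat.log 2 G.size)))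
    (by omega) hword hes hnd hps hw
  refine ⟨t, s, hexec, ht.trans ?_, hwin⟩
  rw [hk, he]
  generalize G.index = k
  generalize G.arena.edges.card = e at *
  have h1 : k * n ≤ k * n * n := Nat.le_mul_of_pos_right _ hn
  have h2 : k ≤ k * n := Nat.le_mul_of_pos_right _ hn
  have he0 : 0 < e := by omega
  have h3 : e * n ≤ 2 ^ n * e * n := by
    rw [mul_assoc]
    exact Nat.le_mul_of_pos_left _ hN
  have h4 : e ≤ e * n := Nat.le_mul_of_pos_right _ hn
  have h5 : 2 ^ n * n ≤ 2 ^ n * e * n := Nat.mul_le_mul_right _ (Nat.le_mul_of_pos_right _ he0)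
  have h6 : 2 ^ n * e ≤ 2 ^ n * e * n := Nat.le_mul_of_pos_right _ hn
  have e1 : (10 * n + 25) * k = 10 * (k * n) + 25 * k := by ring
  have e2 : 2 ^ n * (9 * n + 8) = 9 * (2 ^ n * n) + 8 * 2 ^ n := by ring
  have e3 : 2 ^ n * ((n + 1) * (26 * e + 13) + 27) =
      26 * (2 ^ n * e * n) + 26 * (2 ^ n * e) + 13 * (2 ^ n * n) + 40 * 2 ^ n := by ring
  have e4 : 500 * ((k * n + 2 ^ n * e) * n) = 500 * (k * n * n) + 500 * (2 ^ n * e * n) := by ring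
  rw [e1, e2, e3, e4]
  omega

end

end RegularGames

theorem mainTheorem1 :
    (∃ (P : RegularGames.Program) (c : ℕ),
      RegularGames.Decides P c RegularGames.PairGame.RabinCond
        (fun n e k => (k * n + 2 ^ n * e) * n) (fun n g => g + 2 ^ n * n)) ∧
    (∃ (P : RegularGames.Program) (c : ℕ),
      RegularGames.Decides P c RegularGames.PairGame.StreettCond
        (fun n e k => (k * n + 2 ^ n * e) * n) (fun n g => g + 2 ^ n * n)) := by
  refine ⟨⟨RegularGames.gameProg 0, 500, RegularGames.gameProg_decides 0 _ fun G X => ?_⟩,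
    ⟨RegularGames.gameProg 1, 500, RegularGames.gameProg_decides 1 _ fun G X => ?_⟩⟩
  · simp [RegularGames.Good]
  · simp [RegularGames.Good, RegularGames.PairGame.StreettCond, RegularGames.PairGame.RabinCond,
      Set.not_nonempty_iff_eq_empty]
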